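/- Manifolds are finite-dimensional, Hausdorff, second countable, without boundary, and everything is smooth. Let $G$ be a real Lie group with Lie algebra $\mathfrak g$, and let $p\colon P\to M$ be a principal $G$-bundle with right action; for $z\in\mathfrak g$ let $Y_z$ be the fundamental vector field on $P$. Let $\hat E$ be an exact Courant algebroid over $P$, with pairing $\langle\cdot,\cdot\rangle$, Dorfman bracket $[\cdot,\cdot]$ and anchor $\pi\colon\hat E\to TP$ (normalized by $[e,e]=\tfrac12\pi^*d\langle e,e\rangle$). Let $\rho\colon\mathfrak g\to\Gamma(\hat E)$ be a lift of the $G$-action: a linear map with $\rho([z,w])=[\rho(z),\rho(w)]$ and $\pi\rho(z)=Y_z$, such that the infinitesimal action $z\mapsto[\rho(z),\cdot]$ integrates to a right $G$-action on $\hat E$ by Courant algebroid automorphisms covering the action on $P$. Assume that $\rho$ is equivariant, $\rho(\operatorname{Ad}(g)z)=g\rho(z)$ with $(g\sigma)(q)=\sigma(qg)g^{-1}$, and that there is a $G$-equivariant isotropic splitting $TP\to\hat E$ of $\pi$. Assume that $-\langle\rho(z),\rho(z)\rangle=c(z,z)$ is constant on $P$ for every $z\in\mathfrak g$, where $c$ is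 a symmetric bilinear form on $\mathfrak g$, and that $c$ is non-degenerate. Put $K=\rho(\mathfrak g)\subset\hat E$ and let $$E=\frac{K^\perp}{K\cap K^\perp}\Big/G$$ be the reduced Courant algebroid over $M$: its sections are induced by the $G$-invariant sections of $K^\perp$, and its pairing and Dorfman bracket are induced by those of $\hat E$. The anchor of $\hat E$ induces a natural projection $E\to TP/G$. Let $A$ be a connection on $P$, written as a $\mathfrak g$-valued $1$-form; let $A^\perp$ denote horizontal parts and horizontal lifts, $F(X,Y)=-A[A^\perp X,A^\perp Y]$ its curvature, and $\nabla^A_Z r=[A^\perp Z,r]$ the induced connection on $\operatorname{ad}P$ (vertical vectors being identified with elements of $\mathfrak g$ inside $c$). Consider pairs $(\Phi,H)$ consisting of an isomorphism of vector bundles $\Phi\colon TP/G\oplus T^*M\to E$ compatible with the projections to $TP/G$ and a $3$-form $H\in\Omega^3(M)$, such that, under $\Phi$, the pairing is $$\langle X+\xi,Y+\eta\rangle=\tfrac12\big(i_{pX}\eta+i_{pY}\xi\big)+c(AX,AY)$$ and the Dorfman bracket is $$[X+\xi,Y+\eta]=[X,Y]+L_{pX}\eta-i_{pY}d\xi+i_{pY}i_{pX}H+2c(\nabla^A(AX),AY)+2c(F(X,\cdot),AY)-2c(F(Y,\cdot),AX)$$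 for all sections $X,Y$ of $TP/G$ (invariant vector fields on $P$) and $\xi,\eta\in\Omega^1(M)$. Then: 1. such a pair $(\Phi,H)$ exists; 2. if $(\Phi,H)$ and $(\Phi',H')$ are two such pairs, there is $b\in\Omega^2(M)$ with $\Phi'(X+\xi)=\Phi(X+\xi+i_{pX}b)$ and $H'=H+db$; 3. conversely, if $(\Phi,H)$ is such a pair and $b\in\Omega^2(M)$, then $\Phi'(X+\xi)=\Phi(X+\xi+i_{pX}b)$ and $H'=H+db$ form such a pair. So $H$ is unique exactly up to adding $db$ with $b\in\Omega^2(M)$. -/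

import Mathlib

open Set Bundle Manifold VectorField
open scoped Manifold ContDiff Topology

noncomputable section

namespace CourantReduction

/-! ### Vector fields and differential forms on a manifold without boundary -/

section Forms

variable {E : Type*} [NormedAddCommGroup E] [NormedSpace ℝ E]
  {M : Type*} [TopologicalSpace M] [ChartedSpace E M]

/-- `X` is a smooth vector field. -/
def SmoothField [IsManifold 𝓘(ℝ, E) ∞ M] (X : ∀ x : M, TangentSpace 𝓘(ℝ, E) x) : Prop :=
  ContMDiff 𝓘(ℝ, E) 𝓘(ℝ, E).tangent ∞ (fun x => (⟨x, X x⟩ : TangentBundle 𝓘(ℝ, E) M))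

/-- The derivative `X(f)` of a function along a vector field. -/
def dirDeriv (X : ∀ x : M, TangentSpace 𝓘(ℝ, E) x) (f : M → ℝ) (x : M) : ℝ :=
  mvfderiv 𝓘(ℝ, E) f x (X x)

/-- A field of covectors (a section of the cotangent bundle) is smooth if its value on every
smooth vector field is a smooth function. -/
def SmoothCovector [IsManifold 𝓘(ℝ, E) ∞ M]
    (ξ : ∀ x : M, Module.Dual ℝ (TangentSpace 𝓘(ℝ, E) x)) : Prop :=
  ∀ X : ∀ x : M, TangentSpace 𝓘(ℝ, E) x, SmoothField X →
    ContMDiff 𝓘(ℝ, E) 𝓘(ℝ, ℝ) ∞ (fun x => ξ x (X x))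

variable (E M) in
/-- Smooth differential `k`-forms: fields of alternating `k`-linear forms whose value on
any `k` smooth vector fields is a smooth function. -/
structure SmoothForm [IsManifold 𝓘(ℝ, E) ∞ M] (k : ℕ) where
  toFun : ∀ x : M, (TangentSpace 𝓘(ℝ, E) x) [⋀^Fin k]→ₗ[ℝ] ℝ
  smooth : ∀ X : Fin k → ∀ x : M, TangentSpace 𝓘(ℝ, E) x, (∀ i, SmoothField (X i)) →
    ContMDiff 𝓘(ℝ, E) 𝓘(ℝ, ℝ) ∞ (fun x => toFun x (fun i => X i x))

/-- `dξ(X,Y) = X(ξ(Y)) - Y(ξ(X)) - ξ([X,Y])`. -/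
def extDerivOne (ξ : ∀ x : M, Module.Dual ℝ (TangentSpace 𝓘(ℝ, E) x))
    (X Y : ∀ x : M, TangentSpace 𝓘(ℝ, E) x) (x : M) : ℝ :=
  dirDeriv X (fun y => ξ y (Y y)) x - dirDeriv Y (fun y => ξ y (X y)) x
    - ξ x (mlieBracket 𝓘(ℝ, E) X Y x)

/-- `(L_X η)(Z) = X(η(Z)) - η([X,Z])`. -/
def lieDerivOne (X : ∀ x : M, TangentSpace 𝓘(ℝ, E) x)
    (η : ∀ x : M, Module.Dual ℝ (TangentSpace 𝓘(ℝ, E) x))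
    (Z : ∀ x : M, TangentSpace 𝓘(ℝ, E) x) (x : M) : ℝ :=
  dirDeriv X (fun y => η y (Z y)) x - η x (mlieBracket 𝓘(ℝ, E) X Z x)

/-- `db(X,Y,Z)` for a `2`-form `b`, by the invariant formula. -/
def extDerivTwo [IsManifold 𝓘(ℝ, E) ∞ M] (b : SmoothForm E M 2)
    (X Y Z : ∀ x : M, TangentSpace 𝓘(ℝ, E) x) (x : M) : ℝ :=
  dirDeriv X (fun y => b.toFun y ![Y y, Z y]) x
    - dirDeriv Y (fun y => b.toFun y ![X y, Z y]) x
    + dirDeriv Z (fun y => b.toFun y ![X y, Y y]) x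
    - b.toFun x ![mlieBracket 𝓘(ℝ, E) X Y x, Z x]
    + b.toFun x ![mlieBracket 𝓘(ℝ, E) X Z x, Y x]
    - b.toFun x ![mlieBracket 𝓘(ℝ, E) Y Z x, X x]

/-- `H' = H + db`. -/
def EqAddExact [IsManifold 𝓘(ℝ, E) ∞ M] (H' H : SmoothForm E M 3) (b : SmoothForm E M 2) : Prop :=
  ∀ X Y Z : ∀ x : M, TangentSpace 𝓘(ℝ, E) x, SmoothField X → SmoothField Y → SmoothField Z →
    ∀ x, H'.toFun x ![X x, Y x, Z x] = H.toFun x ![X x, Y x, Z x] + extDerivTwo b X Y Z x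

end Forms

/-! ### Courant algebroids -/

section Courant

variable (EP : Type*) [NormedAddCommGroup EP] [NormedSpace ℝ EP]
  {P : Type*} [TopologicalSpace P] [ChartedSpace EP P] [IsManifold 𝓘(ℝ, EP) ∞ P]
  (F : Type*) [NormedAddCommGroup F] [NormedSpace ℝ F]
  (V : P → Type*) [TopologicalSpace (TotalSpace F V)]
  [∀ q, AddCommGroup (V q)] [∀ q, Module ℝ (V q)] [∀ q, TopologicalSpace (V q)]
  [FiberBundle F V] [VectorBundle ℝ F V]

/-- A Courant algebroid structure, with its Dorfman bracket, on a smooth vector bundle `V → P`. -/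
structure CourantAlgebroid where
  pairing : ∀ q, LinearMap.BilinForm ℝ (V q)
  anchor : ∀ q, V q →ₗ[ℝ] TangentSpace 𝓘(ℝ, EP) q
  bracket : Cₛ^∞⟮𝓘(ℝ, EP); F, V⟯ →ₗ[ℝ] Cₛ^∞⟮𝓘(ℝ, EP); F, V⟯ →ₗ[ℝ] Cₛ^∞⟮𝓘(ℝ, EP); F, V⟯
  pairing_symm : ∀ q v w, pairing q v w = pairing q w v
  pairing_nondegenerate : ∀ q v, (∀ w, pairing q v w = 0) → v = 0
  pairing_smooth : ∀ σ τ : Cₛ^∞⟮𝓘(ℝ, EP); F, V⟯,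
    ContMDiff 𝓘(ℝ, EP) 𝓘(ℝ, ℝ) ∞ (fun q => pairing q (σ q) (τ q))
  anchor_smooth : ∀ σ : Cₛ^∞⟮𝓘(ℝ, EP); F, V⟯, SmoothField (fun q => anchor q (σ q))
  jacobi : ∀ σ τ υ, bracket σ (bracket τ υ) = bracket (bracket σ τ) υ + bracket τ (bracket σ υ)
  anchor_bracket : ∀ (σ τ : Cₛ^∞⟮𝓘(ℝ, EP); F, V⟯) (q : P), anchor q (bracket σ τ q) =
    mlieBracket 𝓘(ℝ, EP) (fun q' => anchor q' (σ q')) (fun q' => anchor q' (τ q')) q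
  leibniz : ∀ (f : P → ℝ) (σ τ τ' : Cₛ^∞⟮𝓘(ℝ, EP); F, V⟯), ContMDiff 𝓘(ℝ, EP) 𝓘(ℝ, ℝ) ∞ f →
    (∀ q, τ' q = f q • τ q) → ∀ q, bracket σ τ' q =
      f q • bracket σ τ q + dirDeriv (fun q' => anchor q' (σ q')) f q • τ q
  bracket_pairing : ∀ (σ τ υ : Cₛ^∞⟮𝓘(ℝ, EP); F, V⟯) (q : P),
    dirDeriv (fun q' => anchor q' (σ q')) (fun q' => pairing q' (τ q') (υ q')) q =
      pairing q (bracket σ τ q) (υ q) + pairing q (τ q) (bracket σ υ q)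
  /-- `[σ,σ] = ½ π^* d⟨σ,σ⟩`. -/
  bracket_self : ∀ (σ υ : Cₛ^∞⟮𝓘(ℝ, EP); F, V⟯) (q : P), pairing q (bracket σ σ q) (υ q) =
    (1 / 2 : ℝ) * dirDeriv (fun q' => anchor q' (υ q')) (fun q' => pairing q' (σ q') (σ q')) q

variable {EP F V}

/-- Exactness of `0 → T^*P → V → TP → 0`, where the first map `π^*` is the dual of the
anchor `π` followed by the identification of `V` with its dual: `⟨π^*α, w⟩ = α(π w)`. (Injectivity
of `π^*` is the surjectivity of `π`, and `π ∘ π^* = 0` holds in every Courant algebroid.) -/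
def CourantAlgebroid.IsExact (C : CourantAlgebroid EP F V) : Prop :=
  ∀ q, Function.Surjective (C.anchor q) ∧
    ∀ v, C.anchor q v = 0 → ∃ α : Module.Dual ℝ (TangentSpace 𝓘(ℝ, EP) q),
      ∀ w, C.pairing q v w = α (C.anchor q w)

end Courant

/-! ### Principal bundles, connections and the Atiyah bundle `TP/G` -/

section Principal

variable {EG : Type*} [NormedAddCommGroup EG] [NormedSpace ℝ EG]
  {G : Type*} [TopologicalSpace G] [ChartedSpace EG G] [Group G]
  {EP : Type*} [NormedAddCommGroup EP] [NormedSpace ℝ EP]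
  {P : Type*} [TopologicalSpace P] [ChartedSpace EP P]
  {EM : Type*} [NormedAddCommGroup EM] [NormedSpace ℝ EM]
  {M : Type*} [TopologicalSpace M] [ChartedSpace EM M]

variable (EG G EP P EM M) in
/-- A smooth principal `G`-bundle `proj : P → M` with right action `act`. -/
structure PrincipalBundle where
  act : P → G → P
  proj : P → M
  act_one : ∀ q, act q 1 = q
  act_mul : ∀ q g h, act (act q g) h = act q (g * h)
  contMDiff_act :
    ContMDiff (𝓘(ℝ, EP).prod 𝓘(ℝ, EG)) 𝓘(ℝ, EP) ∞ (fun a : P × G => act a.1 a.2)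
  contMDiff_proj : ContMDiff 𝓘(ℝ, EP) 𝓘(ℝ, EM) ∞ proj
  proj_act : ∀ q g, proj (act q g) = proj q
  locally_trivial : ∀ x : M, ∃ (U : Set M) (φ : OpenPartialHomeomorph P (M × G)),
    IsOpen U ∧ x ∈ U ∧ φ.source = proj ⁻¹' U ∧ φ.target = U ×ˢ univ ∧
    ContMDiffOn 𝓘(ℝ, EP) (𝓘(ℝ, EM).prod 𝓘(ℝ, EG)) ∞ φ φ.source ∧
    ContMDiffOn (𝓘(ℝ, EM).prod 𝓘(ℝ, EG)) 𝓘(ℝ, EP) ∞ φ.symm φ.target ∧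
    ∀ q ∈ φ.source, (φ q).1 = proj q ∧ ∀ g, (φ (act q g)).2 = (φ q).2 * g

variable (EG) in
/-- The adjoint action of a Lie group on its Lie algebra. -/
def Ad (g : G) : GroupLieAlgebra 𝓘(ℝ, EG) G →L[ℝ] GroupLieAlgebra 𝓘(ℝ, EG) G :=
  mfderiv 𝓘(ℝ, EG) 𝓘(ℝ, EG) (fun h : G => g * h * g⁻¹) 1

namespace PrincipalBundle

variable (B : PrincipalBundle EG G EP P EM M)

/-- The differential of `R_g : q ↦ q g`. -/
def dAct (g : G) (q : P) : TangentSpace 𝓘(ℝ, EP) q →L[ℝ] TangentSpace 𝓘(ℝ, EP) (B.act q g) :=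
  mfderiv 𝓘(ℝ, EP) 𝓘(ℝ, EP) (fun q' => B.act q' g) q

/-- The differential of the projection. -/
def dProj (q : P) : TangentSpace 𝓘(ℝ, EP) q →L[ℝ] TangentSpace 𝓘(ℝ, EM) (B.proj q) :=
  mfderiv 𝓘(ℝ, EP) 𝓘(ℝ, EM) B.proj q

/-- The infinitesimal action `ψ(z)`, that is, the fundamental vector field `Y_z`. -/
def fundamental (q : P) (z : GroupLieAlgebra 𝓘(ℝ, EG) G) : TangentSpace 𝓘(ℝ, EP) q :=
  (mfderiv 𝓘(ℝ, EG) 𝓘(ℝ, EP) (fun g => B.act q g) 1 z : EP)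

/-- The fibre of `P` over `x`. -/
abbrev Fib (x : M) : Type _ := {q : P // B.proj q = x}

/-- The action of `G` on a fibre. -/
def actFib {x : M} (q : B.Fib x) (g : G) : B.Fib x :=
  ⟨B.act q.1 g, (B.proj_act q.1 g).trans q.2⟩

/-- The fibre of `TP/G` over `x`: `G`-equivariant families of tangent vectors of `P` along the
fibre of `P` over `x`. Evaluation at a point `q` of the fibre identifies it with `T_q P`. -/
def AtiyahFiber (x : M) : Submodule ℝ (∀ q : B.Fib x, TangentSpace 𝓘(ℝ, EP) q.1) where
  carrier := {X | ∀ (q : B.Fib x) (g : G), X (B.actFib q g) = B.dAct g q.1 (X q)}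
  add_mem' := by
    intro X Y hX hY q g
    simp only [Pi.add_apply, hX q g, hY q g, map_add]
    rfl
  zero_mem' := by
    intro q g
    simp only [Pi.zero_apply, map_zero]
    rfl
  smul_mem' := by
    intro r X hX q g
    simp only [Pi.smul_apply, hX q g, map_smul]
    rfl

/-- The `G`-invariant vector field on `P` that corresponds to a section of `TP/G`. -/
def field (X : ∀ x, B.AtiyahFiber x) (q : P) : TangentSpace 𝓘(ℝ, EP) q :=
  (X (B.proj q)).1 ⟨q, rfl⟩

/-- The vector field `Z` on `M` is the image `pX` of the vector field `X` on `P`. -/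
def Projects (X : ∀ q : P, TangentSpace 𝓘(ℝ, EP) q)
    (Z : ∀ x : M, TangentSpace 𝓘(ℝ, EM) x) : Prop :=
  ∀ q, B.dProj q (X q) = Z (B.proj q)

/-- A connection on `P`, as an equivariant `𝔤`-valued `1`-form reproducing the generators of
the action; composed with `𝔤 ≅ V_q P` it is the projection of `TP` to the vertical bundle. -/
structure Connection [IsManifold 𝓘(ℝ, EP) ∞ P] where
  form : ∀ q : P, TangentSpace 𝓘(ℝ, EP) q →ₗ[ℝ] GroupLieAlgebra 𝓘(ℝ, EG) G
  smooth : ∀ X : ∀ q : P, TangentSpace 𝓘(ℝ, EP) q, SmoothField X →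
    ContMDiff 𝓘(ℝ, EP) 𝓘(ℝ, EG) ∞ (M' := EG) (fun q => form q (X q))
  form_fundamental : ∀ q z, form q (B.fundamental q z) = z
  equivariant : ∀ g q v, form (B.act q g) (B.dAct g q v) = Ad EG g⁻¹ (form q v)

namespace Connection

variable {B} [IsManifold 𝓘(ℝ, EP) ∞ P] (A : B.Connection)

/-- The vertical part `AX` of a vector field, as a vector field. -/
def ver (X : ∀ q : P, TangentSpace 𝓘(ℝ, EP) q) (q : P) : TangentSpace 𝓘(ℝ, EP) q :=
  B.fundamental q (A.form q (X q))

/-- The horizontal part `A^⊥X` of a vector field. -/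
def hor (X : ∀ q : P, TangentSpace 𝓘(ℝ, EP) q) (q : P) : TangentSpace 𝓘(ℝ, EP) q :=
  X q - A.ver X q

/-- The curvature `F(X,Y) = -A[A^⊥X, A^⊥Y]`, with values in `𝔤`. -/
def curv (X Y : ∀ q : P, TangentSpace 𝓘(ℝ, EP) q) (q : P) : GroupLieAlgebra 𝓘(ℝ, EG) G :=
  -A.form q (mlieBracket 𝓘(ℝ, EP) (A.hor X) (A.hor Y) q)

/-- `Zh` is the horizontal lift `A^⊥Z` of the vector field `Z` on `M`. -/
def IsHorLift (Z : ∀ x : M, TangentSpace 𝓘(ℝ, EM) x)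
    (Zh : ∀ q : P, TangentSpace 𝓘(ℝ, EP) q) : Prop :=
  B.Projects Zh Z ∧ ∀ q, A.form q (Zh q) = 0

/-- `∇^A_Z(AX) = [A^⊥Z, AX]`, as a function with values in `𝔤`, where `Zh = A^⊥Z`. -/
def covDeriv (Zh X : ∀ q : P, TangentSpace 𝓘(ℝ, EP) q) (q : P) : GroupLieAlgebra 𝓘(ℝ, EG) G :=
  A.form q (mlieBracket 𝓘(ℝ, EP) Zh (A.ver X) q)

end Connection

end PrincipalBundle

end Principal

/-! ### Lifted actions and the reduced Courant algebroid -/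

section Lift

variable {EG : Type*} [NormedAddCommGroup EG] [NormedSpace ℝ EG]
  {G : Type*} [TopologicalSpace G] [ChartedSpace EG G] [Group G]
  {EP : Type*} [NormedAddCommGroup EP] [NormedSpace ℝ EP]
  {P : Type*} [TopologicalSpace P] [ChartedSpace EP P] [IsManifold 𝓘(ℝ, EP) ∞ P]
  {EM : Type*} [NormedAddCommGroup EM] [NormedSpace ℝ EM]
  {M : Type*} [TopologicalSpace M] [ChartedSpace EM M]
  {F : Type*} [NormedAddCommGroup F] [NormedSpace ℝ F]
  {V : P → Type*} [TopologicalSpace (TotalSpace F V)]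
  [∀ q, AddCommGroup (V q)] [∀ q, Module ℝ (V q)] [∀ q, TopologicalSpace (V q)]
  [FiberBundle F V] [VectorBundle ℝ F V]

/-- A lift of the `G`-action on `P` to the Courant algebroid `V`: an algebra morphism
`ρ : 𝔤 → Γ(V)` over the infinitesimal action, such that the infinitesimal action
`z ↦ [ρ(z), ·]` of `𝔤` integrates to a smooth right action `lift` of `G` on `V` by automorphisms of
the Courant algebroid that cover the action on `P`. -/
structure LiftedAction (B : PrincipalBundle EG G EP P EM M) (C : CourantAlgebroid EP F V) where
  rho : GroupLieAlgebra 𝓘(ℝ, EG) G →ₗ[ℝ] Cₛ^∞⟮𝓘(ℝ, EP); F, V⟯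
  rho_lie : ∀ z w, rho ⁅z, w⁆ = C.bracket (rho z) (rho w)
  anchor_rho : ∀ z q, C.anchor q (rho z q) = B.fundamental q z
  lift : ∀ (g : G) (q : P), V q ≃ₗ[ℝ] V (B.act q g)
  lift_one : ∀ q (v : V q),
    (⟨B.act q 1, lift 1 q v⟩ : TotalSpace F V) = ⟨q, v⟩
  lift_mul : ∀ g h q (v : V q),
    (⟨B.act (B.act q g) h, lift h (B.act q g) (lift g q v)⟩ : TotalSpace F V) =
      ⟨B.act q (g * h), lift (g * h) q v⟩
  lift_smooth : ContMDiff ((𝓘(ℝ, EP).prod 𝓘(ℝ, F)).prod 𝓘(ℝ, EG)) (𝓘(ℝ, EP).prod 𝓘(ℝ, F)) ∞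
    (fun a : TotalSpace F V × G => (⟨B.act a.1.1 a.2, lift a.2 a.1.1 a.1.2⟩ : TotalSpace F V))
  lift_anchor : ∀ g q v, C.anchor (B.act q g) (lift g q v) = B.dAct g q (C.anchor q v)
  lift_pairing : ∀ g q v w, C.pairing (B.act q g) (lift g q v) (lift g q w) = C.pairing q v w
  lift_bracket : ∀ g (σ σ' τ τ' : Cₛ^∞⟮𝓘(ℝ, EP); F, V⟯),
    (∀ q, lift g q (σ q) = σ' (B.act q g)) → (∀ q, lift g q (τ q) = τ' (B.act q g)) →
    ∀ q, lift g q (C.bracket σ τ q) = C.bracket σ' τ' (B.act q g)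
  /-- The derivative at `g = 1`, in the direction `z`, of `g ↦ g⁻¹ · σ(q g) ∈ V q` is
  `[ρ(z), σ](q)`; it is tested against all linear forms on the finite-dimensional space `V q`. -/
  integrates : ∀ (z : GroupLieAlgebra 𝓘(ℝ, EG) G) (σ : Cₛ^∞⟮𝓘(ℝ, EP); F, V⟯) (q : P)
    (ℓ : Module.Dual ℝ (V q)),
    mvfderiv 𝓘(ℝ, EG) (fun g : G => ℓ ((lift g q).symm (σ (B.act q g)))) 1 z =
      ℓ (C.bracket (rho z) σ q)

namespace LiftedAction

variable {B : PrincipalBundle EG G EP P EM M} {C : CourantAlgebroid EP F V}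
  (L : LiftedAction B C)

/-- `ρ(Ad(g) z) = g ρ(z)`, where `(g σ)(q) = g⁻¹ · σ(q g)` is the action of `G` on sections. -/
def IsEquivariant : Prop :=
  ∀ (g : G) (z : GroupLieAlgebra 𝓘(ℝ, EG) G) (q : P),
    L.rho (Ad EG g z) q = (L.lift g q).symm (L.rho z (B.act q g))

/-- `s` is a smooth equivariant isotropic splitting `TP → V` of the anchor. -/
def IsEquivariantIsotropicSplitting (s : ∀ q, TangentSpace 𝓘(ℝ, EP) q →ₗ[ℝ] V q) : Prop :=
  (∀ X : ∀ q : P, TangentSpace 𝓘(ℝ, EP) q, SmoothField X →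
    ContMDiff 𝓘(ℝ, EP) (𝓘(ℝ, EP).prod 𝓘(ℝ, F)) ∞
      (fun q => (⟨q, s q (X q)⟩ : TotalSpace F V))) ∧
  (∀ q v, C.anchor q (s q v) = v) ∧
  (∀ q v w, C.pairing q (s q v) (s q w) = 0) ∧
  ∀ g q v, L.lift g q (s q v) = s (B.act q g) (B.dAct g q v)

/-- `c` is the symmetric bilinear form on `𝔤` of the quadratic form `c(z) = -⟨ρ(z), ρ(z)⟩`. -/
def IsQuadraticForm (c : LinearMap.BilinForm ℝ (GroupLieAlgebra 𝓘(ℝ, EG) G)) : Prop :=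
  (∀ z w, c z w = c w z) ∧ ∀ z q, c z z = -C.pairing q (L.rho z q) (L.rho z q)

/-- The fibre at `q` of `K = ρ(𝔤)`. -/
def K (q : P) : Submodule ℝ (V q) where
  carrier := {v | ∃ z, L.rho z q = v}
  add_mem' := by
    rintro _ _ ⟨z, rfl⟩ ⟨w, rfl⟩
    exact ⟨z + w, by simp⟩
  zero_mem' := ⟨0, by simp⟩
  smul_mem' := by
    rintro r _ ⟨z, rfl⟩
    exact ⟨r • z, by simp⟩

/-- The fibre at `q` of the orthogonal `K^⊥` of `K`. -/
def Kperp (q : P) : Submodule ℝ (V q) where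
  carrier := {v | ∀ w ∈ L.K q, C.pairing q v w = 0}
  add_mem' := by
    intro u v hu hv w hw
    simp [hu w hw, hv w hw]
  zero_mem' := by
    intro w _
    simp
  smul_mem' := by
    intro r v hv w hw
    simp [hv w hw]

/-- The fibre over `x` of `S/G`, for a family `S` of subspaces of the fibres of `V`: equivariant
families of elements of `S` along the fibre of `P` over `x`. If `S` is an invariant subbundle,
evaluation at a point `q` of the fibre identifies it with `S q`. -/
def quot (S : ∀ q, Submodule ℝ (V q)) (x : M) : Submodule ℝ (∀ q : B.Fib x, V q.1) where
  carrier := {u | (∀ q, u q ∈ S q.1) ∧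
    ∀ (q : B.Fib x) (g : G), u (B.actFib q g) = L.lift g q.1 (u q)}
  add_mem' := by
    rintro u v ⟨hu, hu'⟩ ⟨hv, hv'⟩
    refine ⟨fun q => (S q.1).add_mem (hu q) (hv q), fun q g => ?_⟩
    simp only [Pi.add_apply, hu' q g, hv' q g, map_add]
    rfl
  zero_mem' := by
    refine ⟨fun q => (S q.1).zero_mem, fun q g => ?_⟩
    simp only [Pi.zero_apply, map_zero]
    rfl
  smul_mem' := by
    rintro r u ⟨hu, hu'⟩
    refine ⟨fun q => (S q.1).smul_mem r (hu q), fun q g => ?_⟩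
    simp only [Pi.smul_apply, hu' q g, map_smul]
    rfl

/-- The fibre over `x` of the reduced bundle `E = (K^⊥ / (K ∩ K^⊥)) / G`, written as
`(K^⊥/G) / ((K ∩ K^⊥)/G)`. -/
abbrev RedFiber (x : M) : Type _ :=
  L.quot L.Kperp x ⧸ (L.quot (fun q => L.K q ⊓ L.Kperp q) x).submoduleOf (L.quot L.Kperp x)

/-- The class in `E` of an element of `K^⊥/G`. -/
abbrev cls {x : M} (u : L.quot L.Kperp x) : L.RedFiber x := Submodule.Quotient.mk u

/-- The smooth section `σ` of `V` is a `G`-invariant section of `K^⊥`, and it induces the section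
`s` of `E`. -/
def Represents (σ : Cₛ^∞⟮𝓘(ℝ, EP); F, V⟯) (s : ∀ x, L.RedFiber x) : Prop :=
  ∀ x, ∃ h : (fun q : B.Fib x => σ q.1) ∈ L.quot L.Kperp x, s x = L.cls ⟨_, h⟩

/-- The smooth sections of `E` are those induced by the smooth `G`-invariant sections of `K^⊥`. -/
def SmoothSection (s : ∀ x, L.RedFiber x) : Prop :=
  ∃ σ, L.Represents σ s

/-- The pairing of `K^⊥`, evaluated at a point `q` of the fibre over `x`. -/
def pairingAux {x : M} (q : B.Fib x) :
    L.quot L.Kperp x →ₗ[ℝ] L.quot L.Kperp x →ₗ[ℝ] ℝ :=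
  LinearMap.mk₂ ℝ (fun u v => C.pairing q.1 (u.1 q) (v.1 q))
    (by intro u u' v; simp) (by intro r u v; simp) (by intro u v v'; simp)
    (by intro r u v; simp)

/-- The pairing of `E` induced by that of `V`, computed at a point `q` of the fibre over `x`. -/
def pairing {x : M} (q : B.Fib x) : L.RedFiber x →ₗ[ℝ] L.RedFiber x →ₗ[ℝ] ℝ :=
  (L.pairingAux q).liftQ₂ _ _
    (by
      intro u hu
      refine LinearMap.mem_ker.2 (LinearMap.ext fun v => ?_)
      have h1 : u.1 q ∈ L.K q.1 ⊓ L.Kperp q.1 := hu.1 q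
      have h2 : v.1 q ∈ L.Kperp q.1 := v.2.1 q
      exact (C.pairing_symm _ _ _).trans (h2 _ h1.1))
    (by
      intro u hu
      refine LinearMap.mem_ker.2 (LinearMap.ext fun v => ?_)
      have h1 : u.1 q ∈ L.K q.1 ⊓ L.Kperp q.1 := hu.1 q
      have h2 : v.1 q ∈ L.Kperp q.1 := v.2.1 q
      exact h2 _ h1.1)

/-- The Dorfman bracket of the smooth sections `s` and `t` of `E` is well defined and equal to `r`:
it is induced by the bracket in `V` of any invariant sections of `K^⊥` that represent `s` and
`t`. -/
def IsBracket (s t r : ∀ x, L.RedFiber x) : Prop :=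
  L.SmoothSection s ∧ L.SmoothSection t ∧
    ∀ σ τ, L.Represents σ s → L.Represents τ t → L.Represents (C.bracket σ τ) r

variable [IsManifold 𝓘(ℝ, EM) ∞ M]

/-- The value at `Z`, at the point `q`, of the `1`-form
`L_{pX}η - i_{pY}dξ + i_{pY}i_{pX}H + 2c(∇^A(AX),AY) + 2c(F(X,·),AY) - 2c(F(Y,·),AX)`,
where `Xm = pX`, `Ym = pY` and `Zh = A^⊥Z`. -/
def dorfmanForm (c : LinearMap.BilinForm ℝ (GroupLieAlgebra 𝓘(ℝ, EG) G)) (A : B.Connection)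
    (H : SmoothForm EM M 3) (X Y Zh : ∀ q : P, TangentSpace 𝓘(ℝ, EP) q)
    (Xm Ym Z : ∀ x : M, TangentSpace 𝓘(ℝ, EM) x)
    (ξ η : ∀ x : M, Module.Dual ℝ (TangentSpace 𝓘(ℝ, EM) x)) (q : P) : ℝ :=
  lieDerivOne Xm η Z (B.proj q) - extDerivOne ξ Ym Z (B.proj q)
    + H.toFun (B.proj q) ![Xm (B.proj q), Ym (B.proj q), Z (B.proj q)]
    + 2 * c (A.covDeriv Zh X q) (A.form q (Y q))
    + 2 * c (A.curv X Zh q) (A.form q (Y q))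
    - 2 * c (A.curv Y Zh q) (A.form q (X q))

/-- The fibrewise linear isomorphism `Φ : TP/G ⊕ T^*M → E` and the `3`-form `H` present the reduced
Courant algebroid in terms of the connection `A`. -/
structure IsPresentation (c : LinearMap.BilinForm ℝ (GroupLieAlgebra 𝓘(ℝ, EG) G))
    (A : B.Connection)
    (Φ : ∀ x, (B.AtiyahFiber x × Module.Dual ℝ (TangentSpace 𝓘(ℝ, EM) x)) ≃ₗ[ℝ] L.RedFiber x)
    (H : SmoothForm EM M 3) : Prop where
  /-- `Φ` is an isomorphism of smooth vector bundles. -/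
  smooth_iff : ∀ (X : ∀ x, B.AtiyahFiber x)
    (ξ : ∀ x : M, Module.Dual ℝ (TangentSpace 𝓘(ℝ, EM) x)),
    L.SmoothSection (fun x => Φ x (X x, ξ x)) ↔ SmoothField (B.field X) ∧ SmoothCovector ξ
  /-- `Φ` is compatible with the natural projection `E → TP/G` induced by the anchor of `V`. -/
  proj : ∀ x X ξ (u : L.quot L.Kperp x), Φ x (X, ξ) = L.cls u →
    ∀ q : B.Fib x, C.anchor q.1 (u.1 q) = X.1 q
  /-- `⟨X + ξ, Y + η⟩ = ½(i_{pX}η + i_{pY}ξ) + c(AX, AY)`. -/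
  pairing_eq : ∀ (q : P) (X Y : B.AtiyahFiber (B.proj q))
    (ξ η : Module.Dual ℝ (TangentSpace 𝓘(ℝ, EM) (B.proj q))),
    L.pairing ⟨q, rfl⟩ (Φ (B.proj q) (X, ξ)) (Φ (B.proj q) (Y, η)) =
      (1 / 2 : ℝ) * (η (B.dProj q (X.1 ⟨q, rfl⟩)) + ξ (B.dProj q (Y.1 ⟨q, rfl⟩)))
        + c (A.form q (X.1 ⟨q, rfl⟩)) (A.form q (Y.1 ⟨q, rfl⟩))
  /-- `[X + ξ, Y + η] = W + ζ`, where `W = [X, Y]` and `ζ` is the `1`-form of `dorfmanForm`. -/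
  bracket_eq : ∀ (X Y : ∀ x, B.AtiyahFiber x)
    (ξ η : ∀ x : M, Module.Dual ℝ (TangentSpace 𝓘(ℝ, EM) x)),
    SmoothField (B.field X) → SmoothField (B.field Y) → SmoothCovector ξ → SmoothCovector η →
    ∃ (W : ∀ x, B.AtiyahFiber x) (ζ : ∀ x : M, Module.Dual ℝ (TangentSpace 𝓘(ℝ, EM) x)),
      (∀ q, B.field W q = mlieBracket 𝓘(ℝ, EP) (B.field X) (B.field Y) q) ∧
      (∀ (Xm Ym Z : ∀ x : M, TangentSpace 𝓘(ℝ, EM) x) (Zh : ∀ q : P, TangentSpace 𝓘(ℝ, EP) q),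
        B.Projects (B.field X) Xm → B.Projects (B.field Y) Ym → SmoothField Z →
        A.IsHorLift Z Zh → ∀ q, ζ (B.proj q) (Z (B.proj q)) =
          dorfmanForm c A H (B.field X) (B.field Y) Zh Xm Ym Z ξ η q) ∧
      L.IsBracket (fun x => Φ x (X x, ξ x)) (fun x => Φ x (Y x, η x))
        (fun x => Φ x (W x, ζ x))

/-- `Φ'` is the composition of `Φ` with the transformation `X + ξ ↦ X + ξ + i_{pX}b`. -/
def IsBTransform
    (Φ' Φ : ∀ x, (B.AtiyahFiber x × Module.Dual ℝ (TangentSpace 𝓘(ℝ, EM) x)) ≃ₗ[ℝ] L.RedFiber x)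
    (b : SmoothForm EM M 2) : Prop :=
  ∀ (q : P) (X : B.AtiyahFiber (B.proj q))
    (ξ ξ' : Module.Dual ℝ (TangentSpace 𝓘(ℝ, EM) (B.proj q))),
    (∀ v, ξ' v = ξ v + b.toFun (B.proj q) ![B.dProj q (X.1 ⟨q, rfl⟩), v]) →
    Φ' (B.proj q) (X, ξ) = Φ (B.proj q) (X, ξ')

end LiftedAction

end Lift

end CourantReduction

end

open CourantReduction

/-!
Since `c` is non-degenerate, `K ∩ K^⊥ = 0`, so `E` is `K^⊥/G`. Twisting the isotropic splitting by
the connection gives an equivariant `λ : TP → K^⊥` with `⟨λX, λY⟩ = c(AX, AY)`, and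
`Φ(X + ξ) = λX + ½ π^* p^* ξ` is onto `K^⊥` by exactness. The component of the Dorfman bracket of
`λX` and `λY` along `T^*M` is read off by pairing it with `λ A^⊥ Z`: terms in which `X` or `Y` is
vertical are given by the infinitesimal action, and `2⟨[λ A^⊥ X, λ A^⊥ Y], λ A^⊥ Z⟩` is tensorial
and alternating, which defines `H`. For uniqueness, `Φ⁻¹ ∘ Φ'` preserves the projection to `TP/G`
and the pairing, hence is `X + ξ ↦ X + ξ + i_{pX} b` for a `2`-form `b`, and the identity
`L_X i_Y b - i_Y d i_X b = i_Y i_X db + i_{[X, Y]} b` turns this change of `Φ` into `H' = H + db`.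
-/

noncomputable section

namespace CourantReduction

open Filter

section Manifold

variable {E : Type*} [NormedAddCommGroup E] [NormedSpace ℝ E]
  {M : Type*} [TopologicalSpace M] [ChartedSpace E M]

theorem dirDeriv_const (X : ∀ x : M, TangentSpace 𝓘(ℝ, E) x) (r : ℝ) (x : M) :
    dirDeriv X (fun _ => r) x = 0 := by
  simp [dirDeriv, mvfderiv_const]

theorem dirDeriv_add (X : ∀ x : M, TangentSpace 𝓘(ℝ, E) x) {f g : M → ℝ} {x : M}
    (hf : MDifferentiableAt 𝓘(ℝ, E) 𝓘(ℝ, ℝ) f x) (hg : MDifferentiableAt 𝓘(ℝ, E) 𝓘(ℝ, ℝ) g x) :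
    dirDeriv X (fun y => f y + g y) x = dirDeriv X f x + dirDeriv X g x :=
  congrArg (fun T => T (X x)) (mvfderiv_add hf hg)

theorem dirDeriv_mul (X : ∀ x : M, TangentSpace 𝓘(ℝ, E) x) {f g : M → ℝ} {x : M}
    (hf : MDifferentiableAt 𝓘(ℝ, E) 𝓘(ℝ, ℝ) f x) (hg : MDifferentiableAt 𝓘(ℝ, E) 𝓘(ℝ, ℝ) g x) :
    dirDeriv X (fun y => f y * g y) x = f x * dirDeriv X g x + dirDeriv X f x * g x := by
  refine (congrArg (fun T => T (X x)) (mvfderiv_mul hf hg)).trans ?_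
  rw [mul_comm (dirDeriv X f x)]
  rfl

theorem dirDeriv_const_mul (X : ∀ x : M, TangentSpace 𝓘(ℝ, E) x) (r : ℝ) {f : M → ℝ} {x : M}
    (hf : MDifferentiableAt 𝓘(ℝ, E) 𝓘(ℝ, ℝ) f x) :
    dirDeriv X (fun y => r * f y) x = r * dirDeriv X f x := by
  rw [dirDeriv_mul X mdifferentiableAt_const hf, dirDeriv_const, zero_mul, add_zero]

theorem dirDeriv_comp {E' : Type*} [NormedAddCommGroup E'] [NormedSpace ℝ E']
    {N : Type*} [TopologicalSpace N] [ChartedSpace E' N] {p : M → N} {x : M}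
    {X : ∀ x : M, TangentSpace 𝓘(ℝ, E) x} {X' : ∀ x : N, TangentSpace 𝓘(ℝ, E') x} {f : N → ℝ}
    (hf : MDifferentiableAt 𝓘(ℝ, E') 𝓘(ℝ, ℝ) f (p x))
    (hp : MDifferentiableAt 𝓘(ℝ, E) 𝓘(ℝ, E') p x)
    (h : mfderiv 𝓘(ℝ, E) 𝓘(ℝ, E') p x (X x) = X' (p x)) :
    dirDeriv X (fun y => f (p y)) x = dirDeriv X' f (p x) :=
  (mvfderiv_comp_apply x hf hp (X x)).trans (congrArg _ h)

section SmoothFields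

variable [IsManifold 𝓘(ℝ, E) ∞ M] {X Y Z : ∀ x : M, TangentSpace 𝓘(ℝ, E) x} {f : M → ℝ}

theorem SmoothField.mdifferentiableAt (hX : SmoothField X) (x : M) :
    MDifferentiableAt 𝓘(ℝ, E) 𝓘(ℝ, E).tangent
      (fun x => (⟨x, X x⟩ : TangentBundle 𝓘(ℝ, E) M)) x :=
  (hX x).mdifferentiableAt (by simp)

theorem SmoothField.smul (hf : ContMDiff 𝓘(ℝ, E) 𝓘(ℝ, ℝ) ∞ f) (hX : SmoothField X) :
    SmoothField (f • X) :=
  ContMDiff.smul_section hf hX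

theorem SmoothField.contMDiff_dirDeriv (hX : SmoothField X)
    (hf : ContMDiff 𝓘(ℝ, E) 𝓘(ℝ, ℝ) ∞ f) :
    ContMDiff 𝓘(ℝ, E) 𝓘(ℝ, ℝ) ∞ (dirDeriv X f) :=
  (contMDiff_snd_tangentBundle_modelSpace ℝ 𝓘(ℝ, ℝ)).comp
    ((hf.contMDiff_tangentMap (m := ∞) (by simp)).comp hX)

variable [CompleteSpace E]

theorem SmoothField.mlieBracket (hX : SmoothField X) (hY : SmoothField Y) :
    SmoothField (mlieBracket 𝓘(ℝ, E) X Y) := by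
  have : IsManifold 𝓘(ℝ, E) (minSmoothness ℝ 2) M := by
    simp only [minSmoothness_of_isRCLikeNormedField]
    infer_instance
  have : IsManifold 𝓘(ℝ, E) (((⊤ : ℕ∞) : WithTop ℕ∞) + 1) M :=
    inferInstanceAs (IsManifold 𝓘(ℝ, E) ∞ M)
  exact fun x => ContMDiffAt.mlieBracket_vectorField (n := ⊤) (m := ⊤) (hX x) (hY x) (by simp)

theorem mlieBracket_mlieBracket_smul (hY : SmoothField Y) (hZ : SmoothField Z)
    (hf : ContMDiff 𝓘(ℝ, E) 𝓘(ℝ, ℝ) ∞ f) (x : M) :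
    mlieBracket 𝓘(ℝ, E) X (mlieBracket 𝓘(ℝ, E) Y (f • Z)) x =
      dirDeriv X (dirDeriv Y f) x • Z x + dirDeriv Y f x • mlieBracket 𝓘(ℝ, E) X Z x
        + (dirDeriv X f x • mlieBracket 𝓘(ℝ, E) Y Z x
          + f x • mlieBracket 𝓘(ℝ, E) X (mlieBracket 𝓘(ℝ, E) Y Z) x) := by
  have hYf := hY.contMDiff_dirDeriv hf
  have hYZ := hY.mlieBracket hZ
  have hfd : ∀ y, MDifferentiableAt 𝓘(ℝ, E) 𝓘(ℝ, ℝ) f y :=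
    fun y => (hf y).mdifferentiableAt (by simp)
  have hinner : mlieBracket 𝓘(ℝ, E) Y (f • Z) =
      dirDeriv Y f • Z + f • mlieBracket 𝓘(ℝ, E) Y Z :=
    funext fun y => mlieBracket_smul_right (hfd y) (hZ.mdifferentiableAt y)
  rw [hinner, mlieBracket_add_right ((hZ.smul hYf).mdifferentiableAt x)
      ((hYZ.smul hf).mdifferentiableAt x),
    mlieBracket_smul_right ((hYf x).mdifferentiableAt (by simp)) (hZ.mdifferentiableAt x),
    mlieBracket_smul_right (hfd x) (hYZ.mdifferentiableAt x)]
  rfl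

theorem dirDeriv_mlieBracket_smul (hX : SmoothField X) (hY : SmoothField Y) (hZ : SmoothField Z)
    (hf : ContMDiff 𝓘(ℝ, E) 𝓘(ℝ, ℝ) ∞ f) (x : M) :
    dirDeriv (mlieBracket 𝓘(ℝ, E) X Y) f x • Z x =
      (dirDeriv X (dirDeriv Y f) x - dirDeriv Y (dirDeriv X f) x) • Z x := by
  have : IsManifold 𝓘(ℝ, E) (minSmoothness ℝ 3) M := by
    simp only [minSmoothness_of_isRCLikeNormedField]
    infer_instance
  have hc : ∀ {T : ∀ x : M, TangentSpace 𝓘(ℝ, E) x}, SmoothField T →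
      ContMDiffAt 𝓘(ℝ, E) 𝓘(ℝ, E).tangent (minSmoothness ℝ 2)
        (fun x => (⟨x, T x⟩ : TangentBundle 𝓘(ℝ, E) M)) x := fun hT => by
    simp only [minSmoothness_of_isRCLikeNormedField]
    exact (hT x).of_le (WithTop.coe_le_coe.2 le_top)
  -- Subtract `f` times the Jacobi identity of `X, Y, Z` from that of `X, Y, f • Z`.
  have jacobi_smul := leibniz_identity_mlieBracket_apply (hc hX) (hc hY) (hc (hZ.smul hf))
  rw [mlieBracket_mlieBracket_smul hY hZ hf, mlieBracket_mlieBracket_smul hX hZ hf,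
    leibniz_identity_mlieBracket_apply (hc hX) (hc hY) (hc hZ),
    mlieBracket_smul_right ((hf x).mdifferentiableAt (by simp)) (hZ.mdifferentiableAt x)]
    at jacobi_smul
  change _ = dirDeriv (VectorField.mlieBracket 𝓘(ℝ, E) X Y) f x • Z x + _ + _ at jacobi_smul
  linear_combination (norm := module) (-1 : ℝ) • jacobi_smul

end SmoothFields

section TangentMaps

variable {E₁ : Type*} [NormedAddCommGroup E₁] [NormedSpace ℝ E₁]
  {H₁ : Type*} [TopologicalSpace H₁] {I₁ : ModelWithCorners ℝ E₁ H₁}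
  {M₁ : Type*} [TopologicalSpace M₁] [ChartedSpace H₁ M₁] [IsManifold I₁ ∞ M₁]
  {E₂ : Type*} [NormedAddCommGroup E₂] [NormedSpace ℝ E₂]
  {H₂ : Type*} [TopologicalSpace H₂] {I₂ : ModelWithCorners ℝ E₂ H₂}
  {M₂ : Type*} [TopologicalSpace M₂] [ChartedSpace H₂ M₂] [IsManifold I₂ ∞ M₂]

theorem contMDiffOn_tangentBundle_prodMk {u : M → TangentBundle I₁ M₁}
    {v : M → TangentBundle I₂ M₂} {s : Set M} (hu : ContMDiffOn 𝓘(ℝ, E) I₁.tangent ∞ u s)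
    (hv : ContMDiffOn 𝓘(ℝ, E) I₂.tangent ∞ v s) :
    ContMDiffOn 𝓘(ℝ, E) (I₁.prod I₂).tangent ∞
      (fun x => (⟨((u x).1, (v x).1), ((u x).2, (v x).2)⟩ :
        TangentBundle (I₁.prod I₂) (M₁ × M₂))) s :=
  contMDiff_equivTangentBundleProd_symm.comp_contMDiffOn (hu.prodMk hv)

theorem contMDiffOn_tangentMap_of_isOpen {f : M₁ → M₂} {s : Set M₁} (hs : IsOpen s)
    (hf : ContMDiffOn I₁ I₂ ∞ f s) :
    ContMDiffOn I₁.tangent I₂.tangent ∞ (tangentMap I₁ I₂ f) (TotalSpace.proj ⁻¹' s) := by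
  refine (hf.contMDiffOn_tangentMapWithin (m := ∞) (by simp) hs.uniqueMDiffOn).congr fun v hv => ?_
  rw [tangentMap, tangentMapWithin, mfderivWithin_of_isOpen hs hv]

end TangentMaps

section Extension

variable [FiniteDimensional ℝ E] [IsManifold 𝓘(ℝ, E) ∞ M] [T2Space M]
  {F : Type*} [NormedAddCommGroup F] [NormedSpace ℝ F]
  {V : M → Type*} [TopologicalSpace (TotalSpace F V)]
  [∀ q, AddCommGroup (V q)] [∀ q, Module ℝ (V q)] [∀ q, TopologicalSpace (V q)]
  [FiberBundle F V] [VectorBundle ℝ F V]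

theorem exists_mvfderiv_eq {x : M} (α : Module.Dual ℝ (TangentSpace 𝓘(ℝ, E) x)) :
    ∃ f : M → ℝ, ContMDiff 𝓘(ℝ, E) 𝓘(ℝ, ℝ) ∞ f ∧ ∀ v, mvfderiv 𝓘(ℝ, E) f x v = α v := by
  obtain ⟨ψ, -, -⟩ := (SmoothBumpFunction.nhds_basis_tsupport (I := 𝓘(ℝ, E)) x).mem_iff.1
    univ_mem
  obtain ⟨e, he⟩ := isInvertible_mfderiv_extChartAt (I := 𝓘(ℝ, E))
    (mem_extChartAt_source (I := 𝓘(ℝ, E)) x)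
  let ℓ : E →L[ℝ] ℝ := LinearMap.toContinuousLinearMap
    (α ∘ₗ (e.symm.toLinearEquiv : TangentSpace 𝓘(ℝ, E) (extChartAt 𝓘(ℝ, E) x x) →ₗ[ℝ] _))
  have hℓ : ContMDiffOn 𝓘(ℝ, E) 𝓘(ℝ, ℝ) ∞ (fun y => ℓ (extChartAt 𝓘(ℝ, E) x y))
      (chartAt E x).source :=
    ℓ.contDiff.contMDiff.comp_contMDiffOn contMDiffOn_extChartAt
  have hψ : (fun y => ψ y • ℓ (extChartAt 𝓘(ℝ, E) x y)) =ᶠ[𝓝 x]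
      (ℓ ∘ extChartAt 𝓘(ℝ, E) x) := by
    filter_upwards [ψ.eventuallyEq_one] with y hy
    simp [hy]
  refine ⟨_, ψ.contMDiff_smul hℓ, fun v => ?_⟩
  have hcomp := mfderiv_comp_apply x ℓ.mdifferentiableAt
    (mdifferentiableAt_extChartAt (I := 𝓘(ℝ, E)) (ChartedSpace.mem_chart_source x)) v
  rw [ℓ.mfderiv_eq, ← he, ← hψ.mfderiv_eq] at hcomp
  exact hcomp.trans (congrArg α (e.symm_apply_apply v))

theorem eq_of_forall_mvfderiv_eq {x : M} {v w : TangentSpace 𝓘(ℝ, E) x}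
    (h : ∀ f : M → ℝ, ContMDiff 𝓘(ℝ, E) 𝓘(ℝ, ℝ) ∞ f →
      mvfderiv 𝓘(ℝ, E) f x v = mvfderiv 𝓘(ℝ, E) f x w) : v = w := by
  refine sub_eq_zero.1 ((Module.forall_dual_apply_eq_zero_iff ℝ (v - w)).1 fun α => ?_)
  obtain ⟨f, hf, hα⟩ := exists_mvfderiv_eq α
  rw [map_sub, ← hα, ← hα, h f hf, sub_self]

theorem exists_section_eventuallyEq {U : Set M} (hU : IsOpen U) {x : M} (hx : x ∈ U)
    {t : ∀ x, V x}
    (ht : ContMDiffOn 𝓘(ℝ, E) (𝓘(ℝ, E).prod 𝓘(ℝ, F)) ∞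
      (fun x => (⟨x, t x⟩ : TotalSpace F V)) U) :
    ∃ σ : Cₛ^∞⟮𝓘(ℝ, E); F, V⟯, ∀ᶠ y in 𝓝 x, σ y = t y := by
  obtain ⟨ψ, -, hψ⟩ := (SmoothBumpFunction.nhds_basis_tsupport (I := 𝓘(ℝ, E)) x).mem_iff.1
    (hU.mem_nhds hx)
  refine ⟨⟨(ψ : M → ℝ) • t,
    ContMDiffOn.smul_section_of_tsupport ψ.contMDiff.contMDiffOn hU hψ ht⟩, ?_⟩
  filter_upwards [ψ.eventuallyEq_one] with y hy
  change ψ y • t y = t y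
  rw [hy, Pi.one_apply, one_smul]

section

variable [ContMDiffVectorBundle ∞ F V 𝓘(ℝ, E)]

theorem exists_section_apply_eq {x : M} (v : V x) : ∃ σ : Cₛ^∞⟮𝓘(ℝ, E); F, V⟯, σ x = v := by
  obtain ⟨s, hs, h⟩ := FiberBundle.exists_contMDiffOn_extend 𝓘(ℝ, E) F (k := ∞) v
  obtain ⟨U, hUs, hU, hx⟩ := mem_nhds_iff.1 hs
  obtain ⟨σ, hσ⟩ := exists_section_eventuallyEq hU hx (h.mono hUs)
  exact ⟨σ, hσ.self_of_nhds.trans (by simp)⟩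

theorem exists_local_frame [FiniteDimensional ℝ F] (x : M) :
    ∃ τ : Fin (Module.finrank ℝ F) → Cₛ^∞⟮𝓘(ℝ, E); F, V⟯, ∀ᶠ y in 𝓝 x,
      ∃ b : Module.Basis (Fin (Module.finrank ℝ F)) ℝ (V y), (∀ i, b i = τ i y) ∧
        ∀ v i, b.repr v i =
          (Module.finBasis ℝ F).repr (trivializationAt F V x ⟨y, v⟩).2 i := by
  set e := trivializationAt F V x
  have hx : x ∈ e.baseSet := FiberBundle.mem_baseSet_trivializationAt' x
  have hframe := e.isLocalFrameOn_localFrame_baseSet 𝓘(ℝ, E) ∞ (Module.finBasis ℝ F)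
  choose τ hτ using
    fun i => exists_section_eventuallyEq e.open_baseSet hx (hframe.contMDiffOn i)
  refine ⟨τ, ?_⟩
  filter_upwards [eventually_all.2 hτ, e.open_baseSet.mem_nhds hx] with y hy hye
  refine ⟨e.basisAt (Module.finBasis ℝ F) hye, fun i => ?_, fun v i => ?_⟩
  · rw [hy, e.localFrame_apply_of_mem_baseSet (Module.finBasis ℝ F) hye]
  · simp [e, Trivialization.basisAt]

end

/-- A choice of a smooth vector field with a given value at a point. -/
def extendField {x : M} (v : TangentSpace 𝓘(ℝ, E) x) :
    Cₛ^∞⟮𝓘(ℝ, E); E, (TangentSpace 𝓘(ℝ, E) : M → Type _)⟯ :=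
  (exists_section_apply_eq (E := E) (F := E) v).choose

theorem extendField_apply {x : M} (v : TangentSpace 𝓘(ℝ, E) x) : extendField v x = v :=
  (exists_section_apply_eq (E := E) (F := E) v).choose_spec

theorem SmoothCovector.contMDiff_apply
    {E' : Type*} [NormedAddCommGroup E'] [NormedSpace ℝ E']
    {N : Type*} [TopologicalSpace N] [ChartedSpace E' N]
    {ξ : ∀ x : M, Module.Dual ℝ (TangentSpace 𝓘(ℝ, E) x)} (hξ : SmoothCovector ξ)
    {u : N → TangentBundle 𝓘(ℝ, E) M} (hu : ContMDiff 𝓘(ℝ, E') 𝓘(ℝ, E).tangent ∞ u) :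
    ContMDiff 𝓘(ℝ, E') 𝓘(ℝ, ℝ) ∞ (fun n => ξ (u n).1 (u n).2) := by
  intro n
  obtain ⟨hproj, hfiber⟩ := contMDiffAt_totalSpace.1 (hu n)
  obtain ⟨τ, hτ⟩ := exists_local_frame (E := E) (F := E)
    (V := (TangentSpace 𝓘(ℝ, E) : M → Type _)) (u n).1
  have hcoord : ∀ i, ContMDiffAt 𝓘(ℝ, E') 𝓘(ℝ, ℝ) ∞ (fun n' => (Module.finBasis ℝ E).repr
      (trivializationAt E (TangentSpace 𝓘(ℝ, E)) (u n).1 (u n')).2 i) n := fun i =>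
    ((Module.finBasis ℝ E).coord i).toContinuousLinearMap.contDiff.contMDiff.contMDiffAt.comp
      n hfiber
  have hsum : ContMDiffAt 𝓘(ℝ, E') 𝓘(ℝ, ℝ) ∞ (fun n' => ∑ i, (Module.finBasis ℝ E).repr
      (trivializationAt E (TangentSpace 𝓘(ℝ, E)) (u n).1 (u n')).2 i
        * ξ (u n').1 (τ i (u n').1)) n :=
    ContMDiffAt.sum fun i _ => (hcoord i).mul ((hξ (τ i) (τ i).contMDiff _).comp n hproj)
  refine hsum.congr_of_eventuallyEq ?_
  filter_upwards [hproj.continuousAt.eventually hτ] with n' ⟨b, hb, hrepr⟩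
  conv_lhs => rw [← b.sum_repr (u n').2]
  simp only [map_sum, map_smul, smul_eq_mul, hb, hrepr]

theorem dirDeriv_mlieBracket {X Y : ∀ x : M, TangentSpace 𝓘(ℝ, E) x} {f : M → ℝ}
    (hX : SmoothField X) (hY : SmoothField Y) (hf : ContMDiff 𝓘(ℝ, E) 𝓘(ℝ, ℝ) ∞ f) (x : M) :
    dirDeriv (mlieBracket 𝓘(ℝ, E) X Y) f x =
      dirDeriv X (dirDeriv Y f) x - dirDeriv Y (dirDeriv X f) x := by
  have : CompleteSpace E := FiniteDimensional.complete ℝ E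
  by_contra hne
  have hzero : ∀ v : TangentSpace 𝓘(ℝ, E) x, v = 0 := fun v => by
    rw [← extendField_apply v]
    by_contra hv
    exact hne (smul_left_injective ℝ hv
      (dirDeriv_mlieBracket_smul hX hY (extendField v).contMDiff hf x))
  refine hne ?_
  simp only [dirDeriv]
  rw [hzero (X x), hzero (Y x), hzero (VectorField.mlieBracket _ X Y x)]
  simp only [map_zero, sub_zero]

theorem mfderiv_mlieBracket_of_related {E' : Type*} [NormedAddCommGroup E'] [NormedSpace ℝ E']
    [FiniteDimensional ℝ E'] {N : Type*} [TopologicalSpace N] [ChartedSpace E' N]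
    [IsManifold 𝓘(ℝ, E') ∞ N] [T2Space N]
    {p : M → N} (hp : ContMDiff 𝓘(ℝ, E) 𝓘(ℝ, E') ∞ p)
    {X Y : ∀ x : M, TangentSpace 𝓘(ℝ, E) x} {X' Y' : ∀ x : N, TangentSpace 𝓘(ℝ, E') x}
    (hX : SmoothField X) (hY : SmoothField Y) (hX' : SmoothField X') (hY' : SmoothField Y')
    (hXX' : ∀ x, mfderiv 𝓘(ℝ, E) 𝓘(ℝ, E') p x (X x) = X' (p x))
    (hYY' : ∀ x, mfderiv 𝓘(ℝ, E) 𝓘(ℝ, E') p x (Y x) = Y' (p x)) (x : M) :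
    mfderiv 𝓘(ℝ, E) 𝓘(ℝ, E') p x (mlieBracket 𝓘(ℝ, E) X Y x) =
      mlieBracket 𝓘(ℝ, E') X' Y' (p x) := by
  refine eq_of_forall_mvfderiv_eq fun f hf => ?_
  have hpd : ∀ y, MDifferentiableAt 𝓘(ℝ, E) 𝓘(ℝ, E') p y :=
    fun y => (hp y).mdifferentiableAt (by simp)
  have hpull : ∀ {Z : ∀ x : M, TangentSpace 𝓘(ℝ, E) x} {Z' : ∀ x : N, TangentSpace 𝓘(ℝ, E') x}
      {g : N → ℝ}, ContMDiff 𝓘(ℝ, E') 𝓘(ℝ, ℝ) ∞ g →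
      (∀ y, mfderiv 𝓘(ℝ, E) 𝓘(ℝ, E') p y (Z y) = Z' (p y)) → ∀ y,
      dirDeriv Z (fun y' => g (p y')) y = dirDeriv Z' g (p y) :=
    fun hg hZ y => dirDeriv_comp ((hg (p y)).mdifferentiableAt (by simp)) (hpd y) (hZ y)
  calc mvfderiv 𝓘(ℝ, E') f (p x) (mfderiv 𝓘(ℝ, E) 𝓘(ℝ, E') p x (mlieBracket 𝓘(ℝ, E) X Y x))
      = dirDeriv (mlieBracket 𝓘(ℝ, E) X Y) (fun y => f (p y)) x :=
        (mvfderiv_comp_apply x ((hf (p x)).mdifferentiableAt (by simp)) (hpd x) _).symm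
    _ = dirDeriv X (fun y => dirDeriv Y' f (p y)) x
          - dirDeriv Y (fun y => dirDeriv X' f (p y)) x := by
        rw [← funext (hpull hf hXX'), ← funext (hpull hf hYY')]
        exact dirDeriv_mlieBracket hX hY (hf.comp hp) x
    _ = dirDeriv (mlieBracket 𝓘(ℝ, E') X' Y') f (p x) := by
        rw [hpull (hY'.contMDiff_dirDeriv hf) hXX', hpull (hX'.contMDiff_dirDeriv hf) hYY',
          dirDeriv_mlieBracket hX' hY' hf]

end Extension

end Manifold

section Principal

variable {EG : Type*} [NormedAddCommGroup EG] [NormedSpace ℝ EG]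
  {G : Type*} [TopologicalSpace G] [ChartedSpace EG G] [Group G]
  {EP : Type*} [NormedAddCommGroup EP] [NormedSpace ℝ EP]
  {P : Type*} [TopologicalSpace P] [ChartedSpace EP P]
  {EM : Type*} [NormedAddCommGroup EM] [NormedSpace ℝ EM]
  {M : Type*} [TopologicalSpace M] [ChartedSpace EM M]

theorem Ad_Ad_inv [LieGroup 𝓘(ℝ, EG) ∞ G] (g : G) (z : GroupLieAlgebra 𝓘(ℝ, EG) G) :
    Ad EG g (Ad EG g⁻¹ z) = z := by
  have hdiff : ∀ a : G, MDifferentiableAt 𝓘(ℝ, EG) 𝓘(ℝ, EG) (fun h : G => a * h * a⁻¹) 1 :=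
    fun a => (((contMDiff_mul_left (I := 𝓘(ℝ, EG)) (n := ∞) (a := a)).mul
      contMDiff_const) 1).mdifferentiableAt (by simp)
  have hchain := mfderiv_comp_apply_of_eq (1 : G) (hdiff g) (hdiff g⁻¹) (by simp) z
  have hconj : (fun h : G => g * h * g⁻¹) ∘ (fun h : G => g⁻¹ * h * g⁻¹⁻¹) = id := by
    funext h
    simp [mul_assoc]
  rw [hconj, mfderiv_id] at hchain
  exact hchain.symm

namespace PrincipalBundle

variable (B : PrincipalBundle EG G EP P EM M)

theorem proj_surjective : Function.Surjective B.proj := by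
  intro x
  obtain ⟨U, φ, -, hx, -, htarget, -, -, hφ⟩ := B.locally_trivial x
  have hmem : (x, (1 : G)) ∈ φ.target := by simpa [htarget] using hx
  exact ⟨φ.symm (x, 1), by rw [← (hφ _ (φ.map_target hmem)).1, φ.right_inv hmem]⟩

theorem nonempty_fib (x : M) : Nonempty (B.Fib x) :=
  let ⟨q, hq⟩ := B.proj_surjective x
  ⟨⟨q, hq⟩⟩

theorem contMDiff_act_right (g : G) : ContMDiff 𝓘(ℝ, EP) 𝓘(ℝ, EP) ∞ (fun q => B.act q g) :=
  B.contMDiff_act.comp (contMDiff_id.prodMk contMDiff_const)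

theorem contMDiff_act_left (q : P) : ContMDiff 𝓘(ℝ, EG) 𝓘(ℝ, EP) ∞ (fun g => B.act q g) :=
  B.contMDiff_act.comp (contMDiff_const.prodMk contMDiff_id)

theorem mdifferentiableAt_act (a : P × G) :
    MDifferentiableAt (𝓘(ℝ, EP).prod 𝓘(ℝ, EG)) 𝓘(ℝ, EP) (fun a : P × G => B.act a.1 a.2) a :=
  (B.contMDiff_act a).mdifferentiableAt (by simp)

theorem mdifferentiableAt_proj (q : P) : MDifferentiableAt 𝓘(ℝ, EP) 𝓘(ℝ, EM) B.proj q :=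
  (B.contMDiff_proj q).mdifferentiableAt (by simp)

theorem dProj_dAct (g : G) (q : P) (v : TangentSpace 𝓘(ℝ, EP) q) :
    (B.dProj (B.act q g) (B.dAct g q v) : EM) = B.dProj q v := by
  have hchain := mfderiv_comp_apply q (B.mdifferentiableAt_proj (B.act q g))
    ((B.contMDiff_act_right g q).mdifferentiableAt (by simp)) v
  have hinvariant : B.proj ∘ (fun q => B.act q g) = B.proj := funext fun q => B.proj_act q g
  rw [hinvariant] at hchain
  exact hchain.symm

theorem dProj_fundamental (q : P) (z : GroupLieAlgebra 𝓘(ℝ, EG) G) :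
    B.dProj q (B.fundamental q z) = 0 := by
  have hchain := mfderiv_comp_apply_of_eq (1 : G) (B.mdifferentiableAt_proj q)
    ((B.contMDiff_act_left q 1).mdifferentiableAt (by simp)) (B.act_one q) z
  have hconst : B.proj ∘ (fun g => B.act q g) = fun _ => B.proj q :=
    funext fun g => B.proj_act q g
  rw [hconst, mfderiv_const] at hchain
  exact hchain.symm

/-- The infinitesimal action at a point, as a linear map. -/
def fundamentalₗ (q : P) : GroupLieAlgebra 𝓘(ℝ, EG) G →ₗ[ℝ] TangentSpace 𝓘(ℝ, EP) q where
  toFun := B.fundamental q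
  map_add' z w := map_add (mfderiv 𝓘(ℝ, EG) 𝓘(ℝ, EP) (fun g => B.act q g) 1) z w
  map_smul' r z := map_smul (mfderiv 𝓘(ℝ, EG) 𝓘(ℝ, EP) (fun g => B.act q g) 1) r z

theorem mfderiv_act_apply (q : P) (v : TangentSpace 𝓘(ℝ, EP) q)
    (z : GroupLieAlgebra 𝓘(ℝ, EG) G) :
    (mfderiv (𝓘(ℝ, EP).prod 𝓘(ℝ, EG)) 𝓘(ℝ, EP) (fun a : P × G => B.act a.1 a.2) (q, 1)
      ((v : EP), (z : EG)) : EP) = (v : EP) + (B.fundamental q z : EP) := by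
  have hleft : (mfderiv 𝓘(ℝ, EP) 𝓘(ℝ, EP) (fun q' => B.act q' 1) q v : EP) = v := by
    rw [show (fun q' => B.act q' 1) = id from funext B.act_one, mfderiv_id]
    rfl
  exact (mfderiv_prod_eq_add_apply (I := 𝓘(ℝ, EP)) (I' := 𝓘(ℝ, EG)) (I'' := 𝓘(ℝ, EP))
    (p := (q, (1 : G))) (v := ((v : EP), (z : EG)))
    (B.mdifferentiableAt_act _)).trans
      (congrArg₂ (fun u w : EP => u + w) hleft rfl)

section LocalTrivialization

variable [LieGroup 𝓘(ℝ, EG) ∞ G]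

theorem exists_local_section (q : P) : ∃ (U : Set M) (s : M → P) (γ : P → G),
    IsOpen U ∧ B.proj q ∈ U ∧ ContMDiffOn 𝓘(ℝ, EM) 𝓘(ℝ, EP) ∞ s U ∧
    ContMDiffOn 𝓘(ℝ, EP) 𝓘(ℝ, EG) ∞ γ (B.proj ⁻¹' U) ∧ s (B.proj q) = q ∧ γ q = 1 ∧
    (∀ x ∈ U, B.proj (s x) = x) ∧ ∀ a, B.proj a ∈ U → B.act (s (B.proj a)) (γ a) = a := by
  obtain ⟨U, φ, hU, hqU, hsource, htarget, hφsmooth, hφsymm, hφ⟩ :=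
    B.locally_trivial (B.proj q)
  have hmem : ∀ x ∈ U, (x, (φ q).2) ∈ φ.target := fun x hx => by simpa [htarget] using hx
  have hproj : ∀ x ∈ U, B.proj (φ.symm (x, (φ q).2)) = x := fun x hx => by
    rw [← (hφ _ (φ.map_target (hmem x hx))).1, φ.right_inv (hmem x hx)]
  have hq : q ∈ φ.source := by rwa [hsource]
  refine ⟨U, fun x => φ.symm (x, (φ q).2), fun a => (φ q).2⁻¹ * (φ a).2, hU, hqU,
    hφsymm.comp (contMDiff_id.prodMk contMDiff_const).contMDiffOn hmem, ?_, ?_,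
    inv_mul_cancel _, hproj, fun a ha => ?_⟩
  · rw [← hsource]
    exact contMDiffOn_const.mul (contMDiff_snd.comp_contMDiffOn hφsmooth)
  · change φ.symm (B.proj q, (φ q).2) = q
    rw [← (hφ q hq).1]
    exact φ.left_inv hq
  · have hact : B.proj (B.act (φ.symm (B.proj a, (φ q).2)) ((φ q).2⁻¹ * (φ a).2)) = B.proj a :=
      (B.proj_act _ _).trans (hproj _ ha)
    have hsrc : ∀ p, B.proj p = B.proj a → p ∈ φ.source := fun p hp => by
      rwa [hsource, mem_preimage, hp]
    have hact' := hsrc _ hact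
    have ha' := hsrc a rfl
    refine φ.injOn hact' ha' (Prod.ext ?_ ?_)
    · rw [(hφ _ hact').1, (hφ _ ha').1, hact]
    · rw [(hφ _ (φ.map_target (hmem _ ha))).2, φ.right_inv (hmem _ ha), mul_inv_cancel_left]

theorem exists_act_eq {a b : P} (h : B.proj a = B.proj b) : ∃ g, B.act a g = b := by
  obtain ⟨U, s, γ, -, ha, -, -, hsa, -, -, hact⟩ := B.exists_local_section a
  refine ⟨γ b, ?_⟩
  rw [← hsa, h]
  exact hact b (h ▸ ha)

omit [LieGroup 𝓘(ℝ, EG) ∞ G] in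
theorem dProj_mfderiv_section {U : Set M} {s : M → P} (hU : IsOpen U)
    (hs : ContMDiffOn 𝓘(ℝ, EM) 𝓘(ℝ, EP) ∞ s U) (hsection : ∀ x ∈ U, B.proj (s x) = x)
    {x : M} (hx : x ∈ U) (u : TangentSpace 𝓘(ℝ, EM) x) :
    (B.dProj (s x) (mfderiv 𝓘(ℝ, EM) 𝓘(ℝ, EP) s x u) : EM) = u := by
  have hchain := mfderiv_comp_apply x (B.mdifferentiableAt_proj (s x))
    ((hs.contMDiffAt (hU.mem_nhds hx)).mdifferentiableAt (by simp)) u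
  have hid : B.proj ∘ s =ᶠ[𝓝 x] id := by
    filter_upwards [hU.mem_nhds hx] using hsection
  rw [hid.mfderiv_eq, mfderiv_id] at hchain
  exact hchain.symm

theorem dProj_surjective (q : P) : Function.Surjective (B.dProj q) := by
  intro u
  obtain ⟨U, s, -, hU, hqU, hs, -, hsq, -, hsection, -⟩ := B.exists_local_section q
  have hlift : ∃ v : EP, (B.dProj (s (B.proj q)) v : EM) = u :=
    ⟨_, B.dProj_mfderiv_section hU hs hsection hqU u⟩
  rwa [hsq] at hlift

theorem exists_fundamental_eq {q : P} {v : TangentSpace 𝓘(ℝ, EP) q} (hv : B.dProj q v = 0) :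
    ∃ z, B.fundamental q z = v := by
  obtain ⟨U, s, γ, hU, hqU, hs, hγ, hsq, hγq, -, hact⟩ := B.exists_local_section q
  have hnhds : B.proj ⁻¹' U ∈ 𝓝 q :=
    (hU.preimage B.contMDiff_proj.continuous).mem_nhds hqU
  have hsdiff : MDifferentiableAt 𝓘(ℝ, EM) 𝓘(ℝ, EP) s (B.proj q) :=
    (hs.contMDiffAt (hU.mem_nhds hqU)).mdifferentiableAt (by simp)
  have hsproj : MDifferentiableAt 𝓘(ℝ, EP) 𝓘(ℝ, EP) (fun a => s (B.proj a)) q :=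
    hsdiff.comp q (B.mdifferentiableAt_proj q)
  have hγdiff : MDifferentiableAt 𝓘(ℝ, EP) 𝓘(ℝ, EG) γ q :=
    (hγ.contMDiffAt hnhds).mdifferentiableAt (by simp)
  have hid : (fun a : P × G => B.act a.1 a.2) ∘ (fun a => (s (B.proj a), γ a)) =ᶠ[𝓝 q] id := by
    filter_upwards [hnhds] using hact
  have hsv : (mfderiv 𝓘(ℝ, EP) 𝓘(ℝ, EP) (fun a => s (B.proj a)) q v : EP) = 0 :=
    ((mfderiv_comp_apply q hsdiff (B.mdifferentiableAt_proj q) v).trans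
      (congrArg (mfderiv 𝓘(ℝ, EM) 𝓘(ℝ, EP) s (B.proj q)) hv)).trans (map_zero _)
  have hchain := mfderiv_comp_apply_of_eq q (B.mdifferentiableAt_act (q, 1))
    (hsproj.prodMk hγdiff) (Prod.ext hsq hγq) v
  rw [hid.mfderiv_eq, mfderiv_id, mfderiv_prodMk hsproj hγdiff] at hchain
  refine ⟨(mfderiv 𝓘(ℝ, EP) 𝓘(ℝ, EG) γ q v : EG), Eq.trans ?_ hchain.symm⟩
  exact ((zero_add (_ : EP)).symm.trans (B.mfderiv_act_apply q 0 _).symm).trans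
    (congrArg _ (Prod.ext hsv.symm rfl))

theorem contMDiff_of_comp_proj {f : M → ℝ}
    (hf : ContMDiff 𝓘(ℝ, EP) 𝓘(ℝ, ℝ) ∞ (fun q => f (B.proj q))) :
    ContMDiff 𝓘(ℝ, EM) 𝓘(ℝ, ℝ) ∞ f := by
  intro x
  obtain ⟨q, rfl⟩ := B.proj_surjective x
  obtain ⟨U, s, -, hU, hqU, hs, -, -, -, hsection, -⟩ := B.exists_local_section q
  refine ((hf.comp_contMDiffOn hs).contMDiffAt (hU.mem_nhds hqU)).congr_of_eventuallyEq ?_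
  filter_upwards [hU.mem_nhds hqU] with y hy
  simp only [Function.comp_apply, hsection y hy]

variable [IsManifold 𝓘(ℝ, EP) ∞ P]

theorem exists_local_lift [IsManifold 𝓘(ℝ, EM) ∞ M] {Z : ∀ x : M, TangentSpace 𝓘(ℝ, EM) x}
    (hZ : SmoothField Z) (q : P) :
    ∃ (W : Set P) (T : ∀ q : P, TangentSpace 𝓘(ℝ, EP) q), IsOpen W ∧ q ∈ W ∧
      ContMDiffOn 𝓘(ℝ, EP) 𝓘(ℝ, EP).tangent ∞
        (fun q => (⟨q, T q⟩ : TangentBundle 𝓘(ℝ, EP) P)) W ∧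
      ∀ q ∈ W, B.dProj q (T q) = Z (B.proj q) := by
  obtain ⟨U, s, γ, hU, hqU, hs, hγ, -, -, hsection, hact⟩ := B.exists_local_section q
  let u : ∀ a : P, TangentSpace (𝓘(ℝ, EP).prod 𝓘(ℝ, EG)) (s (B.proj a), γ a) := fun a =>
    ((mfderiv 𝓘(ℝ, EM) 𝓘(ℝ, EP) s (B.proj a) (Z (B.proj a)) : EP), (0 : EG))
  refine ⟨B.proj ⁻¹' U, fun a => (mfderiv (𝓘(ℝ, EP).prod 𝓘(ℝ, EG)) 𝓘(ℝ, EP)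
    (fun a : P × G => B.act a.1 a.2) (s (B.proj a), γ a) (u a) : EP),
    hU.preimage B.contMDiff_proj.continuous, hqU, ?_, fun a ha => ?_⟩
  · have hu := contMDiffOn_tangentBundle_prodMk
      ((contMDiffOn_tangentMap_of_isOpen hU hs).comp (hZ.comp B.contMDiff_proj).contMDiffOn
        fun a ha => ha)
      ((contMDiff_zeroSection ℝ (TangentSpace 𝓘(ℝ, EG) : G → Type _)).comp_contMDiffOn hγ)
    refine ((B.contMDiff_act.contMDiff_tangentMap (m := ∞) (by simp)).comp_contMDiffOn hu).congr
      fun a ha => ?_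
    change (⟨a, _⟩ : TotalSpace EP fun _ : P => EP) = ⟨B.act (s (B.proj a)) (γ a), _⟩
    rw [hact a ha]
    rfl
  · have hproj : B.proj ∘ (fun a : P × G => B.act a.1 a.2) = B.proj ∘ Prod.fst :=
      funext fun a => B.proj_act a.1 a.2
    have hchain := mfderiv_comp_apply_of_eq (s (B.proj a), γ a) (B.mdifferentiableAt_proj a)
      (B.mdifferentiableAt_act (s (B.proj a), γ a)) (hact a ha) (u a)
    have hchain' := mfderiv_comp_apply (s (B.proj a), γ a)
      (B.mdifferentiableAt_proj (s (B.proj a))) mdifferentiableAt_fst (u a)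
    rw [hproj] at hchain
    rw [mfderiv_fst] at hchain'
    exact (hchain.symm.trans hchain').trans
      (B.dProj_mfderiv_section hU hs hsection ha (Z (B.proj a)))

theorem Projects.smoothField [IsManifold 𝓘(ℝ, EM) ∞ M]
    {X : ∀ q : P, TangentSpace 𝓘(ℝ, EP) q} {Z : ∀ x : M, TangentSpace 𝓘(ℝ, EM) x}
    (h : B.Projects X Z) (hX : SmoothField X) : SmoothField Z := by
  intro x
  obtain ⟨q, rfl⟩ := B.proj_surjective x
  obtain ⟨U, s, -, hU, hqU, hs, -, -, -, hsection, -⟩ := B.exists_local_section q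
  have hdProj := ((B.contMDiff_proj.contMDiff_tangentMap (m := ∞) (by simp)).comp
    hX).comp_contMDiffOn hs
  refine (hdProj.contMDiffAt (hU.mem_nhds hqU)).congr_of_eventuallyEq ?_
  filter_upwards [hU.mem_nhds hqU] with y hy
  change (⟨y, Z y⟩ : TangentBundle 𝓘(ℝ, EM) M) = ⟨B.proj (s y), B.dProj (s y) (X (s y))⟩
  rw [h (s y), hsection y hy]

end LocalTrivialization

theorem smoothField_fundamental [IsManifold 𝓘(ℝ, EP) ∞ P] [LieGroup 𝓘(ℝ, EG) ∞ G]
    (z : GroupLieAlgebra 𝓘(ℝ, EG) G) : SmoothField (fun q => B.fundamental q z) := by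
  have hpair := contMDiffOn_tangentBundle_prodMk (s := univ)
    (contMDiff_zeroSection ℝ (TangentSpace 𝓘(ℝ, EP) : P → Type _)).contMDiffOn
    (contMDiffOn_const (c := (⟨1, z⟩ : TangentBundle 𝓘(ℝ, EG) G)))
  refine ((B.contMDiff_act.contMDiff_tangentMap (m := ∞) (by simp)).comp
    (contMDiffOn_univ.1 hpair)).congr fun q => ?_
  change (⟨q, B.fundamental q z⟩ : TotalSpace EP fun _ : P => EP) = ⟨B.act q 1,
    (mfderiv (𝓘(ℝ, EP).prod 𝓘(ℝ, EG)) 𝓘(ℝ, EP) (fun a : P × G => B.act a.1 a.2) (q, 1)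
      ((0 : EP), (z : EG)) : EP)⟩
  have hderiv : (mfderiv (𝓘(ℝ, EP).prod 𝓘(ℝ, EG)) 𝓘(ℝ, EP) (fun a : P × G => B.act a.1 a.2)
      (q, 1) ((0 : EP), (z : EG)) : EP) = B.fundamental q z :=
    (B.mfderiv_act_apply q 0 z).trans (zero_add (_ : EP))
  rw [hderiv, B.act_one]

theorem contMDiff_pullback [IsManifold 𝓘(ℝ, EP) ∞ P] [IsManifold 𝓘(ℝ, EM) ∞ M]
    [FiniteDimensional ℝ EM] [T2Space M]
    {ξ : ∀ x : M, Module.Dual ℝ (TangentSpace 𝓘(ℝ, EM) x)} (hξ : SmoothCovector ξ)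
    {X : ∀ q : P, TangentSpace 𝓘(ℝ, EP) q} (hX : SmoothField X) :
    ContMDiff 𝓘(ℝ, EP) 𝓘(ℝ, ℝ) ∞ (fun q => ξ (B.proj q) (B.dProj q (X q))) :=
  hξ.contMDiff_apply ((B.contMDiff_proj.contMDiff_tangentMap (m := ∞) (by simp)).comp hX)

/-- Invariance of a vector field on `P` under the action of `G`. -/
def IsInvariant (X : ∀ q : P, TangentSpace 𝓘(ℝ, EP) q) : Prop :=
  ∀ q g, X (B.act q g) = B.dAct g q (X q)

theorem isInvariant_field (X : ∀ x, B.AtiyahFiber x) : B.IsInvariant (B.field X) := by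
  intro q g
  have htransport : ∀ (x : M) (hx : B.proj (B.act q g) = x),
      (B.field X (B.act q g) : EP) = (X x).1 ⟨B.act q g, hx⟩ := by
    rintro _ rfl
    rfl
  exact (htransport _ (B.proj_act q g)).trans ((X (B.proj q)).2 ⟨q, rfl⟩ g)

/-- The projection `TP/G → TM`, computed at a chosen point of the fibre. -/
def atiyahProj (x : M) : B.AtiyahFiber x →ₗ[ℝ] TangentSpace 𝓘(ℝ, EM) x where
  toFun X := (B.dProj (B.nonempty_fib x).some.1 (X.1 (B.nonempty_fib x).some) : EM)
  map_add' _ _ := map_add (B.dProj _) _ _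
  map_smul' _ _ := map_smul (B.dProj _) _ _

variable {B} in
theorem Projects.unique {X : ∀ q : P, TangentSpace 𝓘(ℝ, EP) q}
    {Z Z' : ∀ x : M, TangentSpace 𝓘(ℝ, EM) x}
    (h : B.Projects X Z) (h' : B.Projects X Z') : Z = Z' := by
  funext x
  obtain ⟨q, rfl⟩ := B.proj_surjective x
  exact (h q).symm.trans (h' q)

variable [LieGroup 𝓘(ℝ, EG) ∞ G]

theorem dProj_eq_atiyahProj {x : M} (X : B.AtiyahFiber x) (q : B.Fib x) :
    (B.dProj q.1 (X.1 q) : EM) = B.atiyahProj x X := by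
  obtain ⟨g, hg⟩ := B.exists_act_eq (q.2.trans (B.nonempty_fib x).some.2.symm)
  have hq : B.actFib q g = (B.nonempty_fib x).some := Subtype.ext hg
  change _ = (B.dProj _ (X.1 (B.nonempty_fib x).some) : EM)
  rw [← hq, X.2 q g]
  exact (B.dProj_dAct g q.1 _).symm

theorem projects_atiyahProj (X : ∀ x, B.AtiyahFiber x) :
    B.Projects (B.field X) (fun x => B.atiyahProj x (X x)) :=
  fun q => B.dProj_eq_atiyahProj (X (B.proj q)) ⟨q, rfl⟩

theorem atiyah_ext {x : M} {X Y : B.AtiyahFiber x} (q : B.Fib x) (h : X.1 q = Y.1 q) :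
    X = Y := by
  refine Subtype.ext (funext fun q' => ?_)
  obtain ⟨g, hg⟩ := B.exists_act_eq (q.2.trans q'.2.symm)
  obtain rfl : B.actFib q g = q' := Subtype.ext hg
  rw [X.2 q g, Y.2 q g, h]

namespace Connection

variable {B} [IsManifold 𝓘(ℝ, EP) ∞ P] (A : B.Connection)

theorem eq_of_dProj_eq {q : P} {v w : TangentSpace 𝓘(ℝ, EP) q}
    (hproj : B.dProj q v = B.dProj q w) (hform : A.form q v = A.form q w) : v = w := by
  obtain ⟨z, hz⟩ := B.exists_fundamental_eq (q := q) (v := v - w)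
    (by rw [map_sub, hproj, sub_self])
  have hz0 : z = 0 := by rw [← A.form_fundamental q z, hz, map_sub, hform, sub_self]
  have hvw : v - w = 0 := by
    rw [← hz, hz0]
    exact map_zero (B.fundamentalₗ q)
  exact sub_eq_zero.1 hvw

/-- The splitting `T_q P ≅ T_x M ⊕ 𝔤` defined by the connection. -/
def splitEquiv (q : P) : TangentSpace 𝓘(ℝ, EP) q ≃ₗ[ℝ]
    TangentSpace 𝓘(ℝ, EM) (B.proj q) × GroupLieAlgebra 𝓘(ℝ, EG) G :=
  LinearEquiv.ofBijective ((B.dProj q).toLinearMap.prod (A.form q)) <| by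
    refine ⟨fun v w h => A.eq_of_dProj_eq (congrArg Prod.fst h) (congrArg Prod.snd h), ?_⟩
    rintro ⟨u, z⟩
    obtain ⟨v, hv⟩ := B.dProj_surjective q u
    refine ⟨v + B.fundamental q (z - A.form q v), Prod.ext ?_ ?_⟩
    · change B.dProj q (v + B.fundamental q (z - A.form q v)) = u
      rw [map_add, B.dProj_fundamental, add_zero, hv]
    · change A.form q (v + B.fundamental q (z - A.form q v)) = z
      rw [map_add, A.form_fundamental, add_sub_cancel]

/-- The horizontal lift of tangent vectors. -/
def hlift (q : P) : TangentSpace 𝓘(ℝ, EM) (B.proj q) →ₗ[ℝ] TangentSpace 𝓘(ℝ, EP) q :=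
  (A.splitEquiv q).symm.toLinearMap ∘ₗ LinearMap.inl ℝ _ _

theorem dProj_hlift (q : P) (u : TangentSpace 𝓘(ℝ, EM) (B.proj q)) :
    B.dProj q (A.hlift q u) = u :=
  congrArg Prod.fst ((A.splitEquiv q).apply_symm_apply (u, 0))

theorem form_hlift (q : P) (u : TangentSpace 𝓘(ℝ, EM) (B.proj q)) :
    A.form q (A.hlift q u) = 0 :=
  congrArg Prod.snd ((A.splitEquiv q).apply_symm_apply (u, 0))

theorem dAct_hlift (g : G) (q : P) (u : EM) :
    A.hlift (B.act q g) u = B.dAct g q (A.hlift q u) := by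
  refine A.eq_of_dProj_eq ?_ ?_
  · exact (A.dProj_hlift _ u).trans ((B.dProj_dAct g q _).trans (A.dProj_hlift q u)).symm
  · exact (A.form_hlift _ u).trans ((A.equivariant g q _).trans
      ((congrArg (Ad EG g⁻¹) (A.form_hlift q u)).trans (map_zero _))).symm

theorem isHorLift_hlift (Z : ∀ x : M, TangentSpace 𝓘(ℝ, EM) x) :
    A.IsHorLift Z (fun q => A.hlift q (Z (B.proj q))) :=
  ⟨fun q => A.dProj_hlift q _, fun q => A.form_hlift q _⟩

variable {A} in
theorem IsHorLift.eq_hlift {Z : ∀ x : M, TangentSpace 𝓘(ℝ, EM) x}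
    {Zh : ∀ q : P, TangentSpace 𝓘(ℝ, EP) q} (h : A.IsHorLift Z Zh) :
    Zh = fun q => A.hlift q (Z (B.proj q)) :=
  funext fun q => A.eq_of_dProj_eq ((h.1 q).trans (A.dProj_hlift q _).symm)
    ((h.2 q).trans (A.form_hlift q _).symm)

/-- The horizontal lift `TM → TP/G`. -/
def atiyahLift (x : M) : TangentSpace 𝓘(ℝ, EM) x →ₗ[ℝ] B.AtiyahFiber x where
  toFun u := ⟨fun q => A.hlift q.1 (u : EM), fun q g => A.dAct_hlift g q.1 u⟩
  map_add' u v := Subtype.ext (funext fun q => map_add (A.hlift q.1) (u : EM) (v : EM))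
  map_smul' r u := Subtype.ext (funext fun q => map_smul (A.hlift q.1) r (u : EM))

theorem isInvariant_hlift (Z : ∀ x : M, TangentSpace 𝓘(ℝ, EM) x) :
    B.IsInvariant (fun q => A.hlift q (Z (B.proj q))) :=
  B.isInvariant_field (fun x => A.atiyahLift x (Z x))

theorem atiyahProj_atiyahLift (x : M) (u : TangentSpace 𝓘(ℝ, EM) x) :
    B.atiyahProj x (A.atiyahLift x u) = u :=
  A.dProj_hlift (B.nonempty_fib x).some.1 (u : EM)

section Parts

omit [LieGroup 𝓘(ℝ, EG) ∞ G]

theorem form_ver (X : ∀ q : P, TangentSpace 𝓘(ℝ, EP) q) (q : P) :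
    A.form q (A.ver X q) = A.form q (X q) :=
  A.form_fundamental q _

theorem form_hor (X : ∀ q : P, TangentSpace 𝓘(ℝ, EP) q) (q : P) : A.form q (A.hor X q) = 0 := by
  rw [hor, map_sub, A.form_ver, sub_self]

theorem dProj_ver (X : ∀ q : P, TangentSpace 𝓘(ℝ, EP) q) (q : P) :
    B.dProj q (A.ver X q) = 0 :=
  B.dProj_fundamental q _

theorem dProj_hor (X : ∀ q : P, TangentSpace 𝓘(ℝ, EP) q) (q : P) :
    B.dProj q (A.hor X q) = B.dProj q (X q) := by
  rw [hor, map_sub, A.dProj_ver, sub_zero]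

end Parts

theorem hor_eq_hlift (X : ∀ q : P, TangentSpace 𝓘(ℝ, EP) q) (q : P) :
    A.hor X q = A.hlift q (B.dProj q (X q)) :=
  A.eq_of_dProj_eq ((A.dProj_hor X q).trans (A.dProj_hlift q _).symm)
    ((A.form_hor X q).trans (A.form_hlift q _).symm)

theorem isInvariant_hor {X : ∀ q : P, TangentSpace 𝓘(ℝ, EP) q} (hX : B.IsInvariant X) :
    B.IsInvariant (A.hor X) := by
  intro q g
  have hproj : (B.dProj (B.act q g) (X (B.act q g)) : EM) = B.dProj q (X q) :=
    (congrArg (fun v => (B.dProj (B.act q g) v : EM)) (hX q g)).trans (B.dProj_dAct g q (X q))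
  exact (A.hor_eq_hlift X _).trans ((congrArg (fun u : EM => A.hlift (B.act q g) u) hproj).trans
    ((A.dAct_hlift g q _).trans (congrArg (B.dAct g q) (A.hor_eq_hlift X q).symm)))

theorem isInvariant_ver {X : ∀ q : P, TangentSpace 𝓘(ℝ, EP) q} (hX : B.IsInvariant X) :
    B.IsInvariant (A.ver X) := by
  intro q g
  rw [← sub_sub_cancel (X (B.act q g)) (A.ver X (B.act q g)), ← sub_sub_cancel (X q) (A.ver X q),
    map_sub, ← hX q g]
  exact congrArg _ (A.isInvariant_hor hX q g)

section Smooth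

variable [FiniteDimensional ℝ EG] {X : ∀ q : P, TangentSpace 𝓘(ℝ, EP) q}

omit [LieGroup 𝓘(ℝ, EG) ∞ G] in
theorem contMDiff_map_form {F : Type*} [NormedAddCommGroup F] [NormedSpace ℝ F]
    {V : P → Type*} [TopologicalSpace (TotalSpace F V)]
    [∀ q, AddCommGroup (V q)] [∀ q, Module ℝ (V q)] [∀ q, TopologicalSpace (V q)]
    [FiberBundle F V] [VectorBundle ℝ F V]
    {T : ∀ q, GroupLieAlgebra 𝓘(ℝ, EG) G →ₗ[ℝ] V q}
    (hT : ∀ z, ContMDiff 𝓘(ℝ, EP) (𝓘(ℝ, EP).prod 𝓘(ℝ, F)) ∞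
      (fun q => (⟨q, T q z⟩ : TotalSpace F V))) (hX : SmoothField X) :
    ContMDiff 𝓘(ℝ, EP) (𝓘(ℝ, EP).prod 𝓘(ℝ, F)) ∞
      (fun q => (⟨q, T q (A.form q (X q))⟩ : TotalSpace F V)) := by
  let b := Module.finBasis ℝ EG
  have hcoord : ∀ i, ContMDiff 𝓘(ℝ, EP) 𝓘(ℝ, ℝ) ∞ (fun q => b.repr (A.form q (X q)) i) :=
    fun i => (b.coord i).toContinuousLinearMap.contDiff.contMDiff.comp (A.smooth X hX)
  have hsum := ContMDiff.sum_section (s := Finset.univ) fun i _ =>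
    ContMDiff.smul_section (hcoord i) (hT (b i : EG))
  refine hsum.congr fun q => congrArg (TotalSpace.mk q) ?_
  have hrepr := congrArg (T q) (b.sum_repr (A.form q (X q))).symm
  refine hrepr.trans ((map_sum (T q) _ _).trans (Finset.sum_congr rfl fun i _ => ?_))
  exact map_smul (T q) _ _

theorem smoothField_ver (hX : SmoothField X) : SmoothField (A.ver X) :=
  A.contMDiff_map_form (T := B.fundamentalₗ) B.smoothField_fundamental hX

theorem smoothField_hor (hX : SmoothField X) : SmoothField (A.hor X) :=
  ContMDiff.sub_section hX (A.smoothField_ver hX)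

theorem smoothField_hlift [FiniteDimensional ℝ EP] [T2Space P] [IsManifold 𝓘(ℝ, EM) ∞ M]
    {Z : ∀ x : M, TangentSpace 𝓘(ℝ, EM) x} (hZ : SmoothField Z) :
    SmoothField (fun q => A.hlift q (Z (B.proj q))) := by
  intro q
  obtain ⟨W, T, hW, hq, hT, hTZ⟩ := B.exists_local_lift hZ q
  obtain ⟨σ, hσ⟩ := exists_section_eventuallyEq hW hq hT
  refine (A.smoothField_hor σ.contMDiff q).congr_of_eventuallyEq ?_
  filter_upwards [hσ, hW.mem_nhds hq] with q' hσq' hq'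
  rw [A.hor_eq_hlift, hσq', hTZ q' hq']

end Smooth

end Connection

end PrincipalBundle

end Principal

section Gram

theorem basis_repr_eq_vecMul_toMatrix₂_inv {ι V : Type*} [Fintype ι] [DecidableEq ι]
    [AddCommGroup V] [Module ℝ V] {B : LinearMap.BilinForm ℝ V} (hB : B.SeparatingLeft)
    (b : Module.Basis ι ℝ V) (v : V) :
    ⇑(b.repr v) = Matrix.vecMul (fun j => B v (b j)) (LinearMap.toMatrix₂ b b B)⁻¹ := by
  have hv : (fun j => B v (b j)) = Matrix.vecMul (b.repr v) (LinearMap.toMatrix₂ b b B) := by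
    funext j
    conv_lhs => rw [← b.sum_repr v]
    simp only [map_sum, map_smul, LinearMap.sum_apply, LinearMap.smul_apply, smul_eq_mul,
      Matrix.vecMul, dotProduct, LinearMap.toMatrix₂_apply]
  rw [hv, Matrix.vecMul_vecMul, Matrix.mul_nonsing_inv _
    ((LinearMap.separatingLeft_iff_det_ne_zero b).1 hB).isUnit, Matrix.vecMul_one]

variable {E : Type*} [NormedAddCommGroup E] [NormedSpace ℝ E]
  {H : Type*} [TopologicalSpace H] {I : ModelWithCorners ℝ E H}
  {M : Type*} [TopologicalSpace M] [ChartedSpace H M] {k : WithTop ℕ∞}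
  {n : Type*} [Fintype n] [DecidableEq n] {A : M → Matrix n n ℝ} {x : M}

theorem contMDiffAt_matrix_det (hA : ∀ i j, ContMDiffAt I 𝓘(ℝ, ℝ) k (fun y => A y i j) x) :
    ContMDiffAt I 𝓘(ℝ, ℝ) k (fun y => (A y).det) x := by
  simp only [Matrix.det_apply']
  exact ContMDiffAt.sum fun σ _ => contMDiffAt_const.mul (ContMDiffAt.prod fun i _ => hA _ _)

theorem contMDiffAt_matrix_inv (hA : ∀ i j, ContMDiffAt I 𝓘(ℝ, ℝ) k (fun y => A y i j) x)
    (hx : (A x).det ≠ 0) (i j : n) :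
    ContMDiffAt I 𝓘(ℝ, ℝ) k (fun y => (A y)⁻¹ i j) x := by
  simp only [Matrix.inv_def, Matrix.smul_apply, Ring.inverse_eq_inv', Matrix.adjugate_apply,
    smul_eq_mul]
  refine ((contMDiffAt_matrix_det hA).inv₀ hx).mul (contMDiffAt_matrix_det fun k l => ?_)
  obtain rfl | hk := eq_or_ne k j
  · simpa using contMDiffAt_const
  · simpa [Matrix.updateRow_ne hk] using hA k l

end Gram

section Courant

variable {E : Type*} [NormedAddCommGroup E] [NormedSpace ℝ E]
  {P : Type*} [TopologicalSpace P] [ChartedSpace E P] [IsManifold 𝓘(ℝ, E) ∞ P]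
  {F : Type*} [NormedAddCommGroup F] [NormedSpace ℝ F]
  {V : P → Type*} [TopologicalSpace (TotalSpace F V)]
  [∀ q, AddCommGroup (V q)] [∀ q, Module ℝ (V q)] [∀ q, TopologicalSpace (V q)]
  [FiberBundle F V] [VectorBundle ℝ F V]

namespace CourantAlgebroid

variable (C : CourantAlgebroid E F V)

theorem eq_of_pairing_eq {q : P} {v v' : V q} (h : ∀ w, C.pairing q v w = C.pairing q v' w) :
    v = v' :=
  sub_eq_zero.1 (C.pairing_nondegenerate q _ fun w => by simp [h w])

theorem pairing_bracket_swap (σ τ υ : Cₛ^∞⟮𝓘(ℝ, E); F, V⟯) (q : P) :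
    C.pairing q (C.bracket σ τ q) (υ q) = -C.pairing q (C.bracket τ σ q) (υ q) +
      dirDeriv (fun q' => C.anchor q' (υ q')) (fun q' => C.pairing q' (σ q') (τ q')) q := by
  have hdiff : ∀ σ τ : Cₛ^∞⟮𝓘(ℝ, E); F, V⟯, MDifferentiableAt 𝓘(ℝ, E) 𝓘(ℝ, ℝ)
      (fun q' => C.pairing q' (σ q') (τ q')) q :=
    fun σ τ => (C.pairing_smooth σ τ q).mdifferentiableAt (by simp)
  have hexpand : (fun q' => C.pairing q' ((σ + τ) q') ((σ + τ) q')) = fun q' =>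
      (C.pairing q' (σ q') (σ q') + C.pairing q' (τ q') (τ q')) +
        2 * C.pairing q' (σ q') (τ q') := by
    funext q'
    rw [ContMDiffSection.coe_add, Pi.add_apply, map_add, map_add, LinearMap.add_apply,
      LinearMap.add_apply, C.pairing_symm q' (τ q') (σ q')]
    ring
  have hpolar := C.bracket_self (σ + τ) υ q
  rw [hexpand, dirDeriv_add (f := fun q' => _ + _) (g := fun q' => _ * _) _
      ((hdiff σ σ).add (hdiff τ τ)) (mdifferentiableAt_const.mul (hdiff σ τ)),
    dirDeriv_add _ (hdiff σ σ) (hdiff τ τ), dirDeriv_const_mul _ _ (hdiff σ τ)] at hpolar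
  simp only [map_add, LinearMap.add_apply, ContMDiffSection.coe_add, Pi.add_apply] at hpolar
  rw [C.bracket_self σ υ q, C.bracket_self τ υ q] at hpolar
  linarith

theorem pairing_bracket_comm (σ τ υ : Cₛ^∞⟮𝓘(ℝ, E); F, V⟯) (q : P) :
    C.pairing q (C.bracket σ τ q) (υ q) =
      dirDeriv (fun q' => C.anchor q' (σ q')) (fun q' => C.pairing q' (τ q') (υ q')) q -
        C.pairing q (C.bracket σ υ q) (τ q) := by
  rw [C.bracket_pairing σ τ υ q, C.pairing_symm q (τ q)]
  ring

theorem nondegenerate_pairing (q : P) : (C.pairing q).Nondegenerate :=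
  ⟨C.pairing_nondegenerate q, fun v hv =>
    C.pairing_nondegenerate q v fun w => (C.pairing_symm q v w).trans (hv w)⟩

variable [FiniteDimensional ℝ F]

/-- The map `π^* : T^*P → V`, the transpose of the anchor for the pairing. -/
def coanchor (q : P) : Module.Dual ℝ (TangentSpace 𝓘(ℝ, E) q) →ₗ[ℝ] V q :=
  haveI : FiniteDimensional ℝ (V q) := VectorBundle.finiteDimensional ℝ F V q
  (LinearMap.BilinForm.toDual (C.pairing q) (C.nondegenerate_pairing q)).symm.toLinearMap ∘ₗ
    (C.anchor q).dualMap

theorem pairing_coanchor (q : P) (α : Module.Dual ℝ (TangentSpace 𝓘(ℝ, E) q)) (w : V q) :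
    C.pairing q (C.coanchor q α) w = α (C.anchor q w) := by
  have : FiniteDimensional ℝ (V q) := VectorBundle.finiteDimensional ℝ F V q
  exact LinearMap.BilinForm.apply_toDual_symm_apply (hB := C.nondegenerate_pairing q) _ _

theorem exists_coanchor_eq (hC : C.IsExact) {q : P} {v : V q} (hv : C.anchor q v = 0) :
    ∃ α, C.coanchor q α = v := by
  obtain ⟨α, hα⟩ := (hC q).2 v hv
  exact ⟨α, C.eq_of_pairing_eq fun w => (C.pairing_coanchor q α w).trans (hα w).symm⟩

variable [FiniteDimensional ℝ E] [T2Space P] [ContMDiffVectorBundle ∞ F V 𝓘(ℝ, E)]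

theorem coanchor_mvfderiv_pairing (σ τ : Cₛ^∞⟮𝓘(ℝ, E); F, V⟯) (q : P) :
    C.coanchor q (mvfderiv 𝓘(ℝ, E) (fun q' => C.pairing q' (σ q') (τ q')) q).toLinearMap =
      C.bracket σ τ q + C.bracket τ σ q := by
  refine C.eq_of_pairing_eq fun w => ?_
  obtain ⟨υ, rfl⟩ := exists_section_apply_eq (E := E) (F := F) w
  rw [pairing_coanchor, map_add, LinearMap.add_apply, C.pairing_bracket_swap σ τ υ q]
  exact (neg_add_cancel_comm _ _).symm

theorem anchor_coanchor_mvfderiv_pairing (σ τ : Cₛ^∞⟮𝓘(ℝ, E); F, V⟯) (q : P) :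
    C.anchor q (C.coanchor q
      (mvfderiv 𝓘(ℝ, E) (fun q' => C.pairing q' (σ q') (τ q')) q).toLinearMap) = 0 := by
  rw [coanchor_mvfderiv_pairing, map_add, C.anchor_bracket, C.anchor_bracket,
    mlieBracket_swap_apply, neg_add_cancel]

theorem anchor_coanchor (q : P) (α : Module.Dual ℝ (TangentSpace 𝓘(ℝ, E) q)) :
    C.anchor q (C.coanchor q α) = 0 := by
  obtain ⟨f, hf, hα⟩ := exists_mvfderiv_eq α
  by_contra hne
  have hv : C.coanchor q α ≠ 0 := fun h => hne (by rw [h, map_zero])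
  obtain ⟨w, hw⟩ := not_forall.1 (mt (C.pairing_nondegenerate q _) hv)
  obtain ⟨σ, hσ⟩ := exists_section_apply_eq (E := E) (F := F) (C.coanchor q α)
  obtain ⟨τ, rfl⟩ := exists_section_apply_eq (E := E) (F := F) w
  let fτ : Cₛ^∞⟮𝓘(ℝ, E); F, V⟯ := ⟨f • ⇑τ, hf.smul_section τ.contMDiff⟩
  -- Compare the previous lemma for `σ, τ` and for `σ, f • τ`.
  have hleibniz : (mvfderiv 𝓘(ℝ, E) (fun q' => C.pairing q' (σ q') (fτ q')) q).toLinearMap =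
      f q • (mvfderiv 𝓘(ℝ, E) (fun q' => C.pairing q' (σ q') (τ q')) q).toLinearMap +
        C.pairing q (σ q) (τ q) • α := by
    have hmul : (fun q' => C.pairing q' (σ q') (fτ q')) =
        fun q' => f q' * C.pairing q' (σ q') (τ q') :=
      funext fun q' => map_smul (C.pairing q' (σ q')) (f q') (τ q')
    ext v
    refine (congrArg (fun g => mvfderiv 𝓘(ℝ, E) g q v) hmul).trans ?_
    refine (congrArg (fun T => T v) (mvfderiv_mul ((hf q).mdifferentiableAt (by simp))
      ((C.pairing_smooth σ τ q).mdifferentiableAt (by simp)))).trans ?_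
    exact congrArg (fun r => f q * _ + C.pairing q (σ q) (τ q) * r) (hα v)
  have h := C.anchor_coanchor_mvfderiv_pairing σ fτ q
  rw [hleibniz, map_add, map_add, map_smul, map_smul, anchor_coanchor_mvfderiv_pairing,
    smul_zero, zero_add, map_smul, map_smul, hσ] at h
  exact (smul_ne_zero hw hne) h

theorem contMDiff_of_pairing {s : ∀ q, V q}
    (hs : ∀ τ : Cₛ^∞⟮𝓘(ℝ, E); F, V⟯,
      ContMDiff 𝓘(ℝ, E) 𝓘(ℝ, ℝ) ∞ (fun q => C.pairing q (s q) (τ q))) :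
    ContMDiff 𝓘(ℝ, E) (𝓘(ℝ, E).prod 𝓘(ℝ, F)) ∞ (fun q => (⟨q, s q⟩ : TotalSpace F V)) := by
  intro x
  obtain ⟨τ, hτ⟩ := exists_local_frame (E := E) (F := F) (V := V) x
  let gram : P → Matrix _ _ ℝ := fun q => Matrix.of fun i j => C.pairing q (τ i q) (τ j q)
  have hgram : ∀ i j, ContMDiffAt 𝓘(ℝ, E) 𝓘(ℝ, ℝ) ∞ (fun q => gram q i j) x :=
    fun i j => C.pairing_smooth (τ i) (τ j) x
  have gram_eq : ∀ {q : P} {b : Module.Basis (Fin (Module.finrank ℝ F)) ℝ (V q)},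
      (∀ i, b i = τ i q) → gram q = LinearMap.toMatrix₂ b b (C.pairing q) := fun hb => by
    ext i j
    simp [gram, LinearMap.toMatrix₂_apply, hb]
  have hdet : (gram x).det ≠ 0 := by
    obtain ⟨b, hb, -⟩ := hτ.self_of_nhds
    rw [gram_eq hb]
    exact (LinearMap.separatingLeft_iff_det_ne_zero b).1 (C.pairing_nondegenerate x)
  have hcoeff : ∀ i, ContMDiffAt 𝓘(ℝ, E) 𝓘(ℝ, ℝ) ∞
      (fun q => Matrix.vecMul (fun j => C.pairing q (s q) (τ j q)) (gram q)⁻¹ i) x := fun i => by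
    simp only [Matrix.vecMul, dotProduct]
    exact ContMDiffAt.sum fun j _ => (hs (τ j) x).mul (contMDiffAt_matrix_inv hgram hdet j i)
  have hsum : ContMDiffAt 𝓘(ℝ, E) (𝓘(ℝ, E).prod 𝓘(ℝ, F)) ∞ (fun q => (⟨q,
      ∑ i, Matrix.vecMul (fun j => C.pairing q (s q) (τ j q)) (gram q)⁻¹ i • τ i q⟩ :
        TotalSpace F V)) x :=
    ContMDiffAt.sum_section fun i _ => (hcoeff i).smul_section (τ i).contMDiff.contMDiffAt
  refine hsum.congr_of_eventuallyEq ?_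
  filter_upwards [hτ] with q ⟨b, hb, _⟩
  refine congrArg (TotalSpace.mk q) ?_
  conv_lhs => rw [← b.sum_repr (s q)]
  rw [basis_repr_eq_vecMul_toMatrix₂_inv (C.pairing_nondegenerate q) b, gram_eq hb]
  simp only [hb]

end CourantAlgebroid

end Courant

section Reduction

variable {EG : Type*} [NormedAddCommGroup EG] [NormedSpace ℝ EG]
  {G : Type*} [TopologicalSpace G] [ChartedSpace EG G] [Group G]
  {EP : Type*} [NormedAddCommGroup EP] [NormedSpace ℝ EP]
  {P : Type*} [TopologicalSpace P] [ChartedSpace EP P] [IsManifold 𝓘(ℝ, EP) ∞ P]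
  {EM : Type*} [NormedAddCommGroup EM] [NormedSpace ℝ EM]
  {M : Type*} [TopologicalSpace M] [ChartedSpace EM M]
  {B : PrincipalBundle EG G EP P EM M}
  {F : Type*} [NormedAddCommGroup F] [NormedSpace ℝ F]
  {V : P → Type*} [TopologicalSpace (TotalSpace F V)]
  [∀ q, AddCommGroup (V q)] [∀ q, Module ℝ (V q)] [∀ q, TopologicalSpace (V q)]
  [FiberBundle F V] [VectorBundle ℝ F V]
  {C : CourantAlgebroid EP F V}

namespace LiftedAction

variable {L : LiftedAction B C} {c : LinearMap.BilinForm ℝ (GroupLieAlgebra 𝓘(ℝ, EG) G)}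

theorem pairing_rho_rho (hc : L.IsQuadraticForm c) (q : P) (z w : GroupLieAlgebra 𝓘(ℝ, EG) G) :
    C.pairing q (L.rho z q) (L.rho w q) = -c z w := by
  have hpolar := hc.2 (z + w) q
  simp only [map_add, LinearMap.add_apply, ContMDiffSection.coe_add, Pi.add_apply] at hpolar
  rw [hc.2 z q, hc.2 w q, hc.1 w z, C.pairing_symm q (L.rho w q) (L.rho z q)] at hpolar
  linarith

theorem K_inf_Kperp_eq_bot (hc : L.IsQuadraticForm c) (hnd : ∀ z, (∀ w, c z w = 0) → z = 0)
    (q : P) : L.K q ⊓ L.Kperp q = ⊥ := by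
  rw [eq_bot_iff]
  rintro v ⟨⟨z, rfl⟩, hz⟩
  have hz0 : z = 0 := hnd z fun w => by
    have hzw := hz (L.rho w q) ⟨w, rfl⟩
    rwa [pairing_rho_rho hc, neg_eq_zero] at hzw
  simp [hz0]

theorem quot_submoduleOf_eq_bot (hc : L.IsQuadraticForm c)
    (hnd : ∀ z, (∀ w, c z w = 0) → z = 0) (x : M) :
    (L.quot (fun q => L.K q ⊓ L.Kperp q) x).submoduleOf (L.quot L.Kperp x) = ⊥ := by
  rw [eq_bot_iff]
  intro u hu
  refine Subtype.ext (funext fun q => ?_)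
  have huq : u.1 q ∈ L.K q.1 ⊓ L.Kperp q.1 := hu.1 q
  rwa [K_inf_Kperp_eq_bot hc hnd] at huq

theorem cls_injective (hc : L.IsQuadraticForm c) (hnd : ∀ z, (∀ w, c z w = 0) → z = 0) (x : M) :
    Function.Injective (L.cls (x := x)) := fun u u' h => by
  have hmem := (Submodule.Quotient.eq _).1 h
  rwa [quot_submoduleOf_eq_bot hc hnd, Submodule.mem_bot, sub_eq_zero] at hmem

theorem lift_rho [LieGroup 𝓘(ℝ, EG) ∞ G] (hL : L.IsEquivariant) (g : G) (q : P)
    (z : GroupLieAlgebra 𝓘(ℝ, EG) G) :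
    L.lift g q (L.rho z q) = L.rho (Ad EG g⁻¹ z) (B.act q g) := by
  have h := hL g (Ad EG g⁻¹ z) q
  rw [Ad_Ad_inv] at h
  rw [h, LinearEquiv.apply_symm_apply]

section AdaptedSplitting

/-- The value of `ρ` at a point, as a linear map. -/
def rhoAt (L : LiftedAction B C) (q : P) : GroupLieAlgebra 𝓘(ℝ, EG) G →ₗ[ℝ] V q where
  toFun z := L.rho z q
  map_add' z w := by simp
  map_smul' r z := by simp

/-- Smooth equivariant splittings `TP → K^⊥` of the anchor for which the pairing is
`⟨λ v, λ w⟩ = c(A v, A w)`. -/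
structure IsAdapted (L : LiftedAction B C)
    (c : LinearMap.BilinForm ℝ (GroupLieAlgebra 𝓘(ℝ, EG) G)) (A : B.Connection)
    (lam : ∀ q, TangentSpace 𝓘(ℝ, EP) q →ₗ[ℝ] V q) : Prop where
  smooth : ∀ X : ∀ q : P, TangentSpace 𝓘(ℝ, EP) q, SmoothField X →
    ContMDiff 𝓘(ℝ, EP) (𝓘(ℝ, EP).prod 𝓘(ℝ, F)) ∞
      (fun q => (⟨q, lam q (X q)⟩ : TotalSpace F V))
  anchor : ∀ q v, C.anchor q (lam q v) = v
  pairing_rho : ∀ q v z, C.pairing q (lam q v) (L.rho z q) = 0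
  pairing : ∀ q v w, C.pairing q (lam q v) (lam q w) = c (A.form q v) (A.form q w)
  lift : ∀ g q v, L.lift g q (lam q v) = lam (B.act q g) (B.dAct g q v)

variable [LieGroup 𝓘(ℝ, EG) ∞ G] {A : B.Connection}
  {s : ∀ q, TangentSpace 𝓘(ℝ, EP) q →ₗ[ℝ] V q}

/-- The splitting of the anchor that agrees with `s` on horizontal vectors and with `ρ` on
vertical ones. -/
def gluedSplitting (L : LiftedAction B C) (A : B.Connection)
    (s : ∀ q, TangentSpace 𝓘(ℝ, EP) q →ₗ[ℝ] V q) (q : P) : TangentSpace 𝓘(ℝ, EP) q →ₗ[ℝ] V q :=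
  s q ∘ₗ A.hlift q ∘ₗ (B.dProj q).toLinearMap + L.rhoAt q ∘ₗ A.form q

theorem gluedSplitting_apply (q : P) (v : TangentSpace 𝓘(ℝ, EP) q) :
    L.gluedSplitting A s q v = s q (A.hlift q (B.dProj q v)) + L.rho (A.form q v) q := rfl

theorem contMDiff_gluedSplitting [FiniteDimensional ℝ EG]
    (hs : L.IsEquivariantIsotropicSplitting s) {X : ∀ q : P, TangentSpace 𝓘(ℝ, EP) q}
    (hX : SmoothField X) :
    ContMDiff 𝓘(ℝ, EP) (𝓘(ℝ, EP).prod 𝓘(ℝ, F)) ∞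
      (fun q => (⟨q, L.gluedSplitting A s q (X q)⟩ : TotalSpace F V)) := by
  have hsum := ContMDiff.add_section (hs.1 _ (A.smoothField_hor hX))
    (A.contMDiff_map_form (T := L.rhoAt) (fun z => (L.rho z).contMDiff) hX)
  simp only [Pi.add_def, A.hor_eq_hlift] at hsum
  exact hsum

theorem anchor_gluedSplitting (hs : L.IsEquivariantIsotropicSplitting s) (q : P)
    (v : TangentSpace 𝓘(ℝ, EP) q) : C.anchor q (L.gluedSplitting A s q v) = v := by
  rw [gluedSplitting_apply, map_add, hs.2.1, L.anchor_rho]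
  refine A.eq_of_dProj_eq ?_ ?_
  · rw [map_add, A.dProj_hlift, B.dProj_fundamental, add_zero]
  · rw [map_add, A.form_hlift, A.form_fundamental, zero_add]

theorem lift_gluedSplitting (hL : L.IsEquivariant) (hs : L.IsEquivariantIsotropicSplitting s)
    (g : G) (q : P) (v : TangentSpace 𝓘(ℝ, EP) q) :
    L.lift g q (L.gluedSplitting A s q v) =
      L.gluedSplitting A s (B.act q g) (B.dAct g q v) := by
  have hhor : A.hlift (B.act q g) (B.dProj (B.act q g) (B.dAct g q v)) =
      B.dAct g q (A.hlift q (B.dProj q v)) :=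
    (congrArg (fun u : EM => A.hlift (B.act q g) u) (B.dProj_dAct g q v)).trans
      (A.dAct_hlift g q _)
  rw [gluedSplitting_apply, gluedSplitting_apply, map_add, hs.2.2.2, lift_rho hL, A.equivariant,
    hhor]

variable [FiniteDimensional ℝ F]

/-- The glued splitting `u`, corrected by the `1`-form `⟨u v, ρ(A ·)⟩` so as to take values in
`K^⊥`. -/
def adaptedSplitting (L : LiftedAction B C) (A : B.Connection)
    (s : ∀ q, TangentSpace 𝓘(ℝ, EP) q →ₗ[ℝ] V q) (q : P) : TangentSpace 𝓘(ℝ, EP) q →ₗ[ℝ] V q :=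
  L.gluedSplitting A s q -
    C.coanchor q ∘ₗ (C.pairing q).compl₁₂ (L.gluedSplitting A s q) (L.rhoAt q ∘ₗ A.form q)

theorem pairing_adaptedSplitting (q : P) (v : TangentSpace 𝓘(ℝ, EP) q) (w : V q) :
    C.pairing q (L.adaptedSplitting A s q v) w = C.pairing q (L.gluedSplitting A s q v) w -
      C.pairing q (L.gluedSplitting A s q v) (L.rho (A.form q (C.anchor q w)) q) := by
  have hval : L.adaptedSplitting A s q v = L.gluedSplitting A s q v - C.coanchor q
      ((C.pairing q).compl₁₂ (L.gluedSplitting A s q) (L.rhoAt q ∘ₗ A.form q) v) := rfl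
  rw [hval, map_sub, LinearMap.sub_apply, C.pairing_coanchor]
  rfl

theorem lift_adaptedSplitting (hL : L.IsEquivariant) (hs : L.IsEquivariantIsotropicSplitting s)
    (g : G) (q : P) (v : TangentSpace 𝓘(ℝ, EP) q) :
    L.lift g q (L.adaptedSplitting A s q v) =
      L.adaptedSplitting A s (B.act q g) (B.dAct g q v) := by
  refine C.eq_of_pairing_eq fun w => ?_
  obtain ⟨w, rfl⟩ := (L.lift g q).surjective w
  rw [L.lift_pairing, pairing_adaptedSplitting, pairing_adaptedSplitting,
    ← lift_gluedSplitting hL hs, L.lift_pairing, L.lift_anchor, A.equivariant, ← lift_rho hL,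
    L.lift_pairing]

variable [FiniteDimensional ℝ EP] [T2Space P] [ContMDiffVectorBundle ∞ F V 𝓘(ℝ, EP)]

theorem anchor_adaptedSplitting (hs : L.IsEquivariantIsotropicSplitting s) (q : P)
    (v : TangentSpace 𝓘(ℝ, EP) q) : C.anchor q (L.adaptedSplitting A s q v) = v := by
  rw [adaptedSplitting, LinearMap.sub_apply, map_sub, anchor_gluedSplitting hs,
    LinearMap.comp_apply, C.anchor_coanchor, sub_zero]

theorem isAdapted_adaptedSplitting [FiniteDimensional ℝ EG] (hL : L.IsEquivariant)
    (hc : L.IsQuadraticForm c) (hs : L.IsEquivariantIsotropicSplitting s) (A : B.Connection) :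
    L.IsAdapted c A (L.adaptedSplitting A s) where
  smooth X hX := C.contMDiff_of_pairing fun τ => by
    simp only [pairing_adaptedSplitting]
    exact (C.pairing_smooth ⟨_, contMDiff_gluedSplitting hs hX⟩ τ).sub
      (C.pairing_smooth ⟨_, contMDiff_gluedSplitting hs hX⟩
        ⟨_, A.contMDiff_map_form (T := L.rhoAt) (fun z => (L.rho z).contMDiff)
          (C.anchor_smooth τ)⟩)
  anchor := anchor_adaptedSplitting hs
  pairing_rho q v z := by
    rw [pairing_adaptedSplitting, L.anchor_rho, A.form_fundamental, sub_self]
  pairing q v w := by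
    rw [pairing_adaptedSplitting, anchor_adaptedSplitting hs,
      C.pairing_symm q _ (L.adaptedSplitting A s q w), pairing_adaptedSplitting,
      anchor_gluedSplitting hs, gluedSplitting_apply, gluedSplitting_apply]
    simp only [map_add, LinearMap.add_apply, hs.2.2.1, pairing_rho_rho hc]
    rw [C.pairing_symm q (L.rho (A.form q w) q) (s q _), hc.1 (A.form q w)]
    ring
  lift := lift_adaptedSplitting hL hs

end AdaptedSplitting

end LiftedAction

end Reduction

section Isomorphism

variable {EG : Type*} [NormedAddCommGroup EG] [NormedSpace ℝ EG]
  {G : Type*} [TopologicalSpace G] [ChartedSpace EG G] [Group G]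
  {EP : Type*} [NormedAddCommGroup EP] [NormedSpace ℝ EP]
  {P : Type*} [TopologicalSpace P] [ChartedSpace EP P]
  {EM : Type*} [NormedAddCommGroup EM] [NormedSpace ℝ EM]
  {M : Type*} [TopologicalSpace M] [ChartedSpace EM M]
  {B : PrincipalBundle EG G EP P EM M}

namespace PrincipalBundle

variable (B) in
/-- The differential of the projection at a point of the fibre over `x`, with values in `T_x M`. -/
def dProjFib {x : M} (q : B.Fib x) :
    TangentSpace 𝓘(ℝ, EP) q.1 →ₗ[ℝ] TangentSpace 𝓘(ℝ, EM) x :=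
  (B.dProj q.1).toLinearMap

theorem dProjFib_surjective [LieGroup 𝓘(ℝ, EG) ∞ G] {x : M} (q : B.Fib x) :
    Function.Surjective (B.dProjFib q) :=
  B.dProj_surjective q.1

theorem dProjFib_fundamental {x : M} (q : B.Fib x) (z : GroupLieAlgebra 𝓘(ℝ, EG) G) :
    B.dProjFib q (B.fundamental q.1 z) = 0 :=
  B.dProj_fundamental q.1 z

theorem dProjFib_actFib {x : M} (q : B.Fib x) (g : G) (v : TangentSpace 𝓘(ℝ, EP) q.1) :
    B.dProjFib (B.actFib q g) (B.dAct g q.1 v) = B.dProjFib q v :=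
  B.dProj_dAct g q.1 v

end PrincipalBundle

variable [IsManifold 𝓘(ℝ, EP) ∞ P]
  {F : Type*} [NormedAddCommGroup F] [NormedSpace ℝ F]
  {V : P → Type*} [TopologicalSpace (TotalSpace F V)]
  [∀ q, AddCommGroup (V q)] [∀ q, Module ℝ (V q)] [∀ q, TopologicalSpace (V q)]
  [FiberBundle F V] [VectorBundle ℝ F V]
  {C : CourantAlgebroid EP F V}

section BaseCoanchor

variable [FiniteDimensional ℝ F]

namespace CourantAlgebroid

variable (C) in
/-- The map `ξ ↦ ½ π^* p^* ξ` from the cotangent space of the base. The factor `½` is that of the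
pairing `½ (i_{pX}η + i_{pY}ξ)`. -/
def baseCoanchor {x : M} (q : B.Fib x) :
    Module.Dual ℝ (TangentSpace 𝓘(ℝ, EM) x) →ₗ[ℝ] V q.1 :=
  C.coanchor q.1 ∘ₗ ((1 / 2 : ℝ) • (B.dProjFib q).dualMap)

theorem pairing_baseCoanchor {x : M} (q : B.Fib x)
    (ξ : Module.Dual ℝ (TangentSpace 𝓘(ℝ, EM) x)) (w : V q.1) :
    C.pairing q.1 (C.baseCoanchor q ξ) w = (1 / 2 : ℝ) * ξ (B.dProjFib q (C.anchor q.1 w)) :=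
  C.pairing_coanchor q.1 _ w

theorem baseCoanchor_injective [LieGroup 𝓘(ℝ, EG) ∞ G] (hC : C.IsExact) {x : M} (q : B.Fib x) :
    Function.Injective (C.baseCoanchor q) := by
  intro ξ η h
  refine LinearMap.ext fun v => ?_
  obtain ⟨v, rfl⟩ := PrincipalBundle.dProjFib_surjective q v
  obtain ⟨w, rfl⟩ := (hC q.1).1 v
  have hpair := congrArg (fun e => C.pairing q.1 e w) h
  simp only [pairing_baseCoanchor] at hpair
  linarith

section Smooth

variable [FiniteDimensional ℝ EP] [T2Space P] [ContMDiffVectorBundle ∞ F V 𝓘(ℝ, EP)]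

theorem anchor_baseCoanchor {x : M} (q : B.Fib x)
    (ξ : Module.Dual ℝ (TangentSpace 𝓘(ℝ, EM) x)) : C.anchor q.1 (C.baseCoanchor q ξ) = 0 :=
  C.anchor_coanchor q.1 _

theorem contMDiff_baseCoanchor [IsManifold 𝓘(ℝ, EM) ∞ M] [FiniteDimensional ℝ EM] [T2Space M]
    {ξ : ∀ x : M, Module.Dual ℝ (TangentSpace 𝓘(ℝ, EM) x)} (hξ : SmoothCovector ξ) :
    ContMDiff 𝓘(ℝ, EP) (𝓘(ℝ, EP).prod 𝓘(ℝ, F)) ∞ (fun q =>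
      (⟨q, C.baseCoanchor (⟨q, rfl⟩ : B.Fib (B.proj q)) (ξ (B.proj q))⟩ : TotalSpace F V)) :=
  C.contMDiff_of_pairing fun τ =>
    (contMDiff_const.mul (B.contMDiff_pullback hξ (C.anchor_smooth τ))).congr fun q =>
      pairing_baseCoanchor (⟨q, rfl⟩ : B.Fib (B.proj q)) (ξ (B.proj q)) (τ q)

end Smooth

end CourantAlgebroid

namespace LiftedAction

variable {L : LiftedAction B C}

theorem lift_baseCoanchor {x : M} (q : B.Fib x) (g : G)
    (ξ : Module.Dual ℝ (TangentSpace 𝓘(ℝ, EM) x)) :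
    L.lift g q.1 (C.baseCoanchor q ξ) = C.baseCoanchor (B.actFib q g) ξ := by
  refine C.eq_of_pairing_eq fun w => ?_
  obtain ⟨w, rfl⟩ := (L.lift g q.1).surjective w
  have hproj : B.dProjFib (B.actFib q g) (C.anchor _ (L.lift g q.1 w)) =
      B.dProjFib q (C.anchor q.1 w) :=
    (congrArg (B.dProjFib (B.actFib q g)) (L.lift_anchor g q.1 w)).trans
      (PrincipalBundle.dProjFib_actFib q g _)
  exact (L.lift_pairing g q.1 _ _).trans ((C.pairing_baseCoanchor q ξ w).trans
    ((congrArg (fun t => (1 / 2 : ℝ) * ξ t) hproj).symm.trans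
      (C.pairing_baseCoanchor (B.actFib q g) ξ _).symm))

theorem baseCoanchor_mem_Kperp {x : M} (q : B.Fib x)
    (ξ : Module.Dual ℝ (TangentSpace 𝓘(ℝ, EM) x)) : C.baseCoanchor q ξ ∈ L.Kperp q.1 := by
  rintro _ ⟨z, rfl⟩
  rw [C.pairing_baseCoanchor, L.anchor_rho, PrincipalBundle.dProjFib_fundamental, map_zero,
    mul_zero]

theorem exists_baseCoanchor_eq [LieGroup 𝓘(ℝ, EG) ∞ G] (hC : C.IsExact) {x : M} (q : B.Fib x)
    {v : V q.1} (hv : C.anchor q.1 v = 0) (hv' : v ∈ L.Kperp q.1) :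
    ∃ ξ : Module.Dual ℝ (TangentSpace 𝓘(ℝ, EM) x), C.baseCoanchor q ξ = v := by
  obtain ⟨α, rfl⟩ := C.exists_coanchor_eq hC hv
  have hker : LinearMap.ker (B.dProjFib q) ≤ LinearMap.ker α := by
    intro w hw
    obtain ⟨z, rfl⟩ := B.exists_fundamental_eq (q := q.1) (v := w) hw
    have hz := hv' (L.rho z q.1) ⟨z, rfl⟩
    rwa [C.pairing_coanchor, L.anchor_rho] at hz
  have hrange : α ∈ LinearMap.range (B.dProjFib q).dualMap := by
    rw [LinearMap.range_dualMap_eq_dualAnnihilator_ker, Submodule.mem_dualAnnihilator]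
    exact hker
  obtain ⟨ξ, rfl⟩ := hrange
  refine ⟨(2 : ℝ) • ξ, ?_⟩
  simp [CourantAlgebroid.baseCoanchor]

end LiftedAction

end BaseCoanchor

namespace LiftedAction

variable {L : LiftedAction B C} {c : LinearMap.BilinForm ℝ (GroupLieAlgebra 𝓘(ℝ, EG) G)}
  {A : B.Connection} {lam : ∀ q, TangentSpace 𝓘(ℝ, EP) q →ₗ[ℝ] V q}

/-- The family of anchors of an element of `K^⊥/G`. -/
def anchorKperp (L : LiftedAction B C) (x : M) (u : L.quot L.Kperp x) : B.AtiyahFiber x :=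
  ⟨fun q => C.anchor q.1 (u.1 q), fun q g =>
    (congrArg (C.anchor (B.act q.1 g)) (u.2.2 q g)).trans (L.lift_anchor g q.1 _)⟩

namespace IsAdapted

theorem mem_Kperp (h : L.IsAdapted c A lam) (q : P) (v : TangentSpace 𝓘(ℝ, EP) q) :
    lam q v ∈ L.Kperp q := by
  rintro _ ⟨z, rfl⟩
  exact h.pairing_rho q v z

variable [FiniteDimensional ℝ F]

/-- The map `X + ξ ↦ λ X + ½ π^* p^* ξ` to `K^⊥/G`. -/
def toKperp (h : L.IsAdapted c A lam) (x : M) :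
    (B.AtiyahFiber x × Module.Dual ℝ (TangentSpace 𝓘(ℝ, EM) x)) →ₗ[ℝ] L.quot L.Kperp x where
  toFun a := ⟨fun q => lam q.1 (a.1.1 q) + C.baseCoanchor q a.2,
    fun q => (L.Kperp q.1).add_mem (h.mem_Kperp q.1 _) (baseCoanchor_mem_Kperp q a.2),
    fun q g => (congrArg₂ (fun v w : V (B.act q.1 g) => v + w)
      ((congrArg (lam (B.act q.1 g)) (a.1.2 q g)).trans (h.lift g q.1 _).symm)
      (lift_baseCoanchor q g a.2).symm).trans (map_add (L.lift g q.1) _ _).symm⟩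
  map_add' a a' := Subtype.ext <| funext fun q =>
    (congrArg₂ (· + ·) (map_add (lam q.1) (a.1.1 q) (a'.1.1 q))
      (map_add (C.baseCoanchor q) a.2 a'.2)).trans (add_add_add_comm _ _ _ _)
  map_smul' r a := Subtype.ext <| funext fun q =>
    (congrArg₂ (· + ·) (map_smul (lam q.1) r (a.1.1 q))
      (map_smul (C.baseCoanchor q) r a.2)).trans (smul_add _ _ _).symm

theorem toKperp_apply (h : L.IsAdapted c A lam) (x : M) (X : B.AtiyahFiber x)
    (ξ : Module.Dual ℝ (TangentSpace 𝓘(ℝ, EM) x)) (q : B.Fib x) :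
    (h.toKperp x (X, ξ)).1 q = lam q.1 (X.1 q) + C.baseCoanchor q ξ := rfl

variable [FiniteDimensional ℝ EP] [T2Space P] [ContMDiffVectorBundle ∞ F V 𝓘(ℝ, EP)]

theorem anchor_toKperp (h : L.IsAdapted c A lam) (x : M) (X : B.AtiyahFiber x)
    (ξ : Module.Dual ℝ (TangentSpace 𝓘(ℝ, EM) x)) (q : B.Fib x) :
    C.anchor q.1 ((h.toKperp x (X, ξ)).1 q) = X.1 q := by
  rw [toKperp_apply, map_add, h.anchor, C.anchor_baseCoanchor, add_zero]

variable [LieGroup 𝓘(ℝ, EG) ∞ G]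

theorem toKperp_injective (h : L.IsAdapted c A lam) (hC : C.IsExact) (x : M) :
    Function.Injective (h.toKperp x) := by
  obtain ⟨q⟩ := B.nonempty_fib x
  rintro ⟨X, ξ⟩ ⟨Y, η⟩ hXY
  have hq := congrFun (congrArg Subtype.val hXY) q
  obtain rfl : X = Y := B.atiyah_ext q <| by
    rw [← h.anchor_toKperp x X ξ, hq, h.anchor_toKperp]
  exact Prod.ext rfl (C.baseCoanchor_injective hC q (add_left_cancel hq))

omit [FiniteDimensional ℝ EP] [T2Space P] [ContMDiffVectorBundle ∞ F V 𝓘(ℝ, EP)] in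
theorem toKperp_surjective (h : L.IsAdapted c A lam) (hC : C.IsExact) (x : M) :
    Function.Surjective (h.toKperp x) := by
  obtain ⟨q⟩ := B.nonempty_fib x
  intro u
  let X := L.anchorKperp x u
  obtain ⟨ξ, hξ⟩ := exists_baseCoanchor_eq (L := L) hC q (v := u.1 q - lam q.1 (X.1 q))
    (by rw [map_sub, h.anchor]; exact sub_self _)
    ((L.Kperp q.1).sub_mem (u.2.1 q) (h.mem_Kperp q.1 _))
  refine ⟨(X, ξ), Subtype.ext (funext fun q' => ?_)⟩
  obtain ⟨g, hg⟩ := B.exists_act_eq (q.2.trans q'.2.symm)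
  obtain rfl : B.actFib q g = q' := Subtype.ext hg
  rw [(h.toKperp x (X, ξ)).2.2 q g, u.2.2 q g, toKperp_apply, hξ, add_sub_cancel]

/-- The isomorphism `TP/G ⊕ T^*M → E` defined by an adapted splitting. -/
def iso (h : L.IsAdapted c A lam) (hC : C.IsExact) (hc : L.IsQuadraticForm c)
    (hnd : ∀ z, (∀ w, c z w = 0) → z = 0) (x : M) :
    (B.AtiyahFiber x × Module.Dual ℝ (TangentSpace 𝓘(ℝ, EM) x)) ≃ₗ[ℝ] L.RedFiber x :=
  (LinearEquiv.ofBijective (h.toKperp x)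
      ⟨h.toKperp_injective hC x, h.toKperp_surjective hC x⟩).trans
    (Submodule.quotEquivOfEqBot _ (quot_submoduleOf_eq_bot hc hnd x)).symm

theorem represents_iso_iff (h : L.IsAdapted c A lam) (hC : C.IsExact)
    (hc : L.IsQuadraticForm c) (hnd : ∀ z, (∀ w, c z w = 0) → z = 0)
    (X : ∀ x, B.AtiyahFiber x) (ξ : ∀ x : M, Module.Dual ℝ (TangentSpace 𝓘(ℝ, EM) x))
    (σ : Cₛ^∞⟮𝓘(ℝ, EP); F, V⟯) :
    L.Represents σ (fun x => h.iso hC hc hnd x (X x, ξ x)) ↔ ∀ q, σ q =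
      lam q (B.field X q) + C.baseCoanchor (⟨q, rfl⟩ : B.Fib (B.proj q)) (ξ (B.proj q)) := by
  constructor
  · intro hσ q
    obtain ⟨hmem, hcls⟩ := hσ (B.proj q)
    exact congrFun (congrArg Subtype.val (cls_injective hc hnd _ hcls).symm) ⟨q, rfl⟩
  · intro hσ x
    have hval : (fun q : B.Fib x => σ q.1) = (h.toKperp x (X x, ξ x)).1 := by
      funext q
      obtain ⟨q, rfl⟩ := q
      exact hσ q
    exact ⟨hval ▸ (h.toKperp x (X x, ξ x)).2, congrArg L.cls (Subtype.ext hval.symm)⟩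

end IsAdapted

end LiftedAction

end Isomorphism

section Alternating

variable {R W N ι : Type*} [Semiring R] [AddCommMonoid W] [Module R W] [AddCommGroup N]
  [Module R N] [IsAddTorsionFree N]

/-- The alternating map of a function that is linear in the slot `i₀` and changes sign when
another slot is exchanged with `i₀`. -/
def alternatingMapOfSwap [dec : DecidableEq ι] (i₀ : ι) (f : (ι → W) → N)
    (map_add : ∀ m x y, f (Function.update m i₀ (x + y)) =
      f (Function.update m i₀ x) + f (Function.update m i₀ y))
    (map_smul : ∀ m (r : R) x, f (Function.update m i₀ (r • x)) = r • f (Function.update m i₀ x))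
    (map_swap : ∀ m i, i ≠ i₀ → f (m ∘ Equiv.swap i i₀) = -f m) : W [⋀^ι]→ₗ[R] N :=
  have update_eq (m : ι → W) {i : ι} (hi : i ≠ i₀) (x : W) : f (Function.update m i x) =
      -f (Function.update (m ∘ Equiv.swap i i₀) i₀ x) := by
    rw [← map_swap _ i hi, Function.update_comp_equiv, Equiv.symm_swap, Equiv.swap_apply_right,
      Function.comp_assoc, ← Equiv.coe_trans, Equiv.swap_swap, Equiv.coe_refl, Function.comp_id]
  have eq_zero_of_eq {m : ι → W} {i : ι} (hi : i ≠ i₀) (h : m i = m i₀) : f m = 0 := by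
    rw [← self_eq_neg, ← map_swap m i hi, Equiv.comp_swap_eq_update, h, Function.update_eq_self,
      Function.update_eq_self_iff.2 h.symm]
  { toFun := f
    map_update_add' := fun {inst} m i x y => by
      obtain rfl : inst = dec := Subsingleton.elim _ _
      obtain rfl | hi := eq_or_ne i i₀
      · exact map_add m x y
      · simp only [update_eq m hi, map_add, neg_add]
    map_update_smul' := fun {inst} m i r x => by
      obtain rfl : inst = dec := Subsingleton.elim _ _
      obtain rfl | hi := eq_or_ne i i₀
      · exact map_smul m r x
      · simp only [update_eq m hi, map_smul, smul_neg]
    map_eq_zero_of_eq' := fun m i j h hij => by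
      obtain rfl | hi := eq_or_ne i i₀
      · exact eq_zero_of_eq hij.symm h.symm
      obtain rfl | hj := eq_or_ne j i₀
      · exact eq_zero_of_eq hi h
      rw [← neg_eq_zero, ← map_swap m i hi]
      refine eq_zero_of_eq hj ?_
      simp [Equiv.swap_apply_of_ne_of_ne hij.symm hj, h] }

end Alternating

section Brackets

variable {EP : Type*} [NormedAddCommGroup EP] [NormedSpace ℝ EP]
  {P : Type*} [TopologicalSpace P] [ChartedSpace EP P] [IsManifold 𝓘(ℝ, EP) ∞ P]
  {F : Type*} [NormedAddCommGroup F] [NormedSpace ℝ F]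
  {V : P → Type*} [TopologicalSpace (TotalSpace F V)]
  [∀ q, AddCommGroup (V q)] [∀ q, Module ℝ (V q)] [∀ q, TopologicalSpace (V q)]
  [FiberBundle F V] [VectorBundle ℝ F V]

namespace CourantAlgebroid

variable (C : CourantAlgebroid EP F V) {σ τ υ : Cₛ^∞⟮𝓘(ℝ, EP); F, V⟯}

theorem pairing_bracket_swap_of_orthogonal (h : ∀ q, C.pairing q (σ q) (τ q) = 0) (q : P) :
    C.pairing q (C.bracket σ τ q) (υ q) = -C.pairing q (C.bracket τ σ q) (υ q) := by
  rw [C.pairing_bracket_swap, funext h, dirDeriv_const, add_zero]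

theorem pairing_bracket_comm_of_orthogonal (h : ∀ q, C.pairing q (τ q) (υ q) = 0) (q : P) :
    C.pairing q (C.bracket σ τ q) (υ q) = -C.pairing q (C.bracket σ υ q) (τ q) := by
  rw [C.pairing_bracket_comm, funext h, dirDeriv_const, zero_sub]

variable {EG : Type*} [NormedAddCommGroup EG] [NormedSpace ℝ EG]
  {G : Type*} [TopologicalSpace G] [ChartedSpace EG G] [Group G]
  {EM : Type*} [NormedAddCommGroup EM] [NormedSpace ℝ EM] [FiniteDimensional ℝ EM]
  {M : Type*} [TopologicalSpace M] [ChartedSpace EM M] [IsManifold 𝓘(ℝ, EM) ∞ M] [T2Space M]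
  {B : PrincipalBundle EG G EP P EM M} [FiniteDimensional ℝ F] [FiniteDimensional ℝ EP]
  [T2Space P] [ContMDiffVectorBundle ∞ F V 𝓘(ℝ, EP)]
  {ξ : ∀ x : M, Module.Dual ℝ (TangentSpace 𝓘(ℝ, EM) x)}
  {Y Z : ∀ x : M, TangentSpace 𝓘(ℝ, EM) x}

variable (B) in
/-- The section `½ π^* p^* ξ`. -/
def baseCoanchorSection (hξ : SmoothCovector ξ) : Cₛ^∞⟮𝓘(ℝ, EP); F, V⟯ :=
  ⟨fun q => C.baseCoanchor (⟨q, rfl⟩ : B.Fib (B.proj q)) (ξ (B.proj q)),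
    C.contMDiff_baseCoanchor hξ⟩

theorem pairing_baseCoanchorSection (hξ : SmoothCovector ξ) (q : P) (w : V q) :
    C.pairing q (C.baseCoanchorSection B hξ q) w =
      (1 / 2 : ℝ) * ξ (B.proj q) (B.dProj q (C.anchor q w)) :=
  C.pairing_baseCoanchor (⟨q, rfl⟩ : B.Fib (B.proj q)) (ξ (B.proj q)) w

omit [FiniteDimensional ℝ F] [ContMDiffVectorBundle ∞ F V 𝓘(ℝ, EP)] in
theorem dProj_anchor_bracket [LieGroup 𝓘(ℝ, EG) ∞ G]
    (hY : B.Projects (fun q => C.anchor q (τ q)) Y) (hZ : B.Projects (fun q => C.anchor q (υ q)) Z)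
    (q : P) : B.dProj q (C.anchor q (C.bracket τ υ q)) =
      mlieBracket 𝓘(ℝ, EM) Y Z (B.proj q) := by
  rw [C.anchor_bracket]
  exact mfderiv_mlieBracket_of_related B.contMDiff_proj (C.anchor_smooth τ) (C.anchor_smooth υ)
    (hY.smoothField B (C.anchor_smooth τ)) (hZ.smoothField B (C.anchor_smooth υ)) hY hZ q

theorem dirDeriv_pairing_baseCoanchorSection [LieGroup 𝓘(ℝ, EG) ∞ G]
    (hY : B.Projects (fun q => C.anchor q (τ q)) Y) (hZ : B.Projects (fun q => C.anchor q (υ q)) Z)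
    (hξ : SmoothCovector ξ) (q : P) :
    dirDeriv (fun q' => C.anchor q' (τ q'))
        (fun q' => C.pairing q' (C.baseCoanchorSection B hξ q') (υ q')) q =
      (1 / 2 : ℝ) * dirDeriv Y (fun x => ξ x (Z x)) (B.proj q) := by
  have hpairing : (fun q' => C.pairing q' (C.baseCoanchorSection B hξ q') (υ q')) =
      fun q' => (1 / 2 : ℝ) * ξ (B.proj q') (Z (B.proj q')) := by
    funext q'
    rw [pairing_baseCoanchorSection, hZ q']
  have hbase : ContMDiff 𝓘(ℝ, EM) 𝓘(ℝ, ℝ) ∞ (fun x => ξ x (Z x)) :=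
    hξ Z (hZ.smoothField B (C.anchor_smooth υ))
  have hpull : ContMDiff 𝓘(ℝ, EP) 𝓘(ℝ, ℝ) ∞ (fun q' => ξ (B.proj q') (Z (B.proj q'))) :=
    hbase.comp B.contMDiff_proj
  rw [hpairing, dirDeriv_const_mul _ _ (hpull.mdifferentiable (by simp) q)]
  congr 1
  exact dirDeriv_comp (hbase.mdifferentiable (by simp) _)
    (B.contMDiff_proj.mdifferentiable (by simp) q) (hY q)

theorem pairing_bracket_baseCoanchorSection_right [LieGroup 𝓘(ℝ, EG) ∞ G]
    (hY : B.Projects (fun q => C.anchor q (τ q)) Y) (hZ : B.Projects (fun q => C.anchor q (υ q)) Z)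
    (hξ : SmoothCovector ξ) (q : P) :
    C.pairing q (C.bracket τ (C.baseCoanchorSection B hξ) q) (υ q) =
      (1 / 2 : ℝ) * lieDerivOne Y ξ Z (B.proj q) := by
  rw [C.pairing_bracket_comm, C.dirDeriv_pairing_baseCoanchorSection hY hZ, C.pairing_symm,
    C.pairing_baseCoanchorSection, C.dProj_anchor_bracket hY hZ, lieDerivOne]
  ring

theorem pairing_bracket_baseCoanchorSection_left [LieGroup 𝓘(ℝ, EG) ∞ G]
    (hY : B.Projects (fun q => C.anchor q (τ q)) Y) (hZ : B.Projects (fun q => C.anchor q (υ q)) Z)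
    (hξ : SmoothCovector ξ) (q : P) :
    C.pairing q (C.bracket (C.baseCoanchorSection B hξ) τ q) (υ q) =
      -(1 / 2 : ℝ) * extDerivOne ξ Y Z (B.proj q) := by
  rw [C.pairing_bracket_swap, C.pairing_bracket_baseCoanchorSection_right hY hZ,
    C.dirDeriv_pairing_baseCoanchorSection hZ hY, lieDerivOne, extDerivOne]
  ring

end CourantAlgebroid

variable {EG : Type*} [NormedAddCommGroup EG] [NormedSpace ℝ EG]
  {G : Type*} [TopologicalSpace G] [ChartedSpace EG G] [Group G]
  {EM : Type*} [NormedAddCommGroup EM] [NormedSpace ℝ EM]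
  {M : Type*} [TopologicalSpace M] [ChartedSpace EM M]
  {B : PrincipalBundle EG G EP P EM M} {C : CourantAlgebroid EP F V}

namespace LiftedAction

variable {L : LiftedAction B C} {σ τ : Cₛ^∞⟮𝓘(ℝ, EP); F, V⟯}

/-- `G`-invariant sections of `K^⊥`, which induce the sections of the reduced Courant algebroid. -/
def IsInvariantPerp (L : LiftedAction B C) (σ : Cₛ^∞⟮𝓘(ℝ, EP); F, V⟯) : Prop :=
  (∀ q z, C.pairing q (σ q) (L.rho z q) = 0) ∧ ∀ q g, σ (B.act q g) = L.lift g q (σ q)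

namespace IsInvariantPerp

theorem mem_quot (hσ : L.IsInvariantPerp σ) (x : M) :
    (fun q : B.Fib x => σ q.1) ∈ L.quot L.Kperp x :=
  ⟨fun q => by
    rintro _ ⟨z, rfl⟩
    exact hσ.1 q.1 z, fun q g => hσ.2 q.1 g⟩

theorem add (hσ : L.IsInvariantPerp σ) (hτ : L.IsInvariantPerp τ) : L.IsInvariantPerp (σ + τ) :=
  ⟨fun q z => by simp [hσ.1, hτ.1], fun q g => by simp [hσ.2, hτ.2]⟩

theorem bracket_rho (hσ : L.IsInvariantPerp σ) (z : GroupLieAlgebra 𝓘(ℝ, EG) G) (q : P) :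
    C.bracket (L.rho z) σ q = 0 := by
  refine (Module.forall_dual_apply_eq_zero_iff ℝ _).1 fun ℓ => ?_
  rw [← L.integrates z σ q ℓ]
  simp only [hσ.2, LinearEquiv.symm_apply_apply, mvfderiv_const]
  rfl

theorem bracket (hσ : L.IsInvariantPerp σ) (hτ : L.IsInvariantPerp τ) :
    L.IsInvariantPerp (C.bracket σ τ) := by
  refine ⟨fun q z => ?_, fun q g => ?_⟩
  · rw [C.pairing_bracket_comm_of_orthogonal (fun q => hτ.1 q z),
      C.pairing_bracket_swap_of_orthogonal (fun q => hσ.1 q z), hσ.bracket_rho,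
      map_zero, LinearMap.zero_apply, neg_zero, neg_zero]
  · exact (L.lift_bracket g σ σ τ τ (fun q => (hσ.2 q g).symm) (fun q => (hτ.2 q g).symm) q).symm

end IsInvariantPerp

theorem isInvariantPerp_baseCoanchorSection [FiniteDimensional ℝ EM] [IsManifold 𝓘(ℝ, EM) ∞ M]
    [T2Space M] [FiniteDimensional ℝ F] [FiniteDimensional ℝ EP] [T2Space P]
    [ContMDiffVectorBundle ∞ F V 𝓘(ℝ, EP)]
    {ξ : ∀ x : M, Module.Dual ℝ (TangentSpace 𝓘(ℝ, EM) x)} (hξ : SmoothCovector ξ) :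
    L.IsInvariantPerp (C.baseCoanchorSection B hξ) := by
  refine ⟨fun q z => baseCoanchor_mem_Kperp (⟨q, rfl⟩ : B.Fib (B.proj q)) _ _ ⟨z, rfl⟩,
    fun q g => ?_⟩
  have htransport : ∀ (x : M) (hx : B.proj (B.act q g) = x),
      C.baseCoanchorSection B hξ (B.act q g) =
        C.baseCoanchor (⟨B.act q g, hx⟩ : B.Fib x) (ξ x) := by
    rintro _ rfl
    rfl
  exact (htransport _ (B.proj_act q g)).trans (L.lift_baseCoanchor ⟨q, rfl⟩ g _).symm

namespace IsAdapted

variable {c : LinearMap.BilinForm ℝ (GroupLieAlgebra 𝓘(ℝ, EG) G)}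
  {A : B.Connection} {lam : ∀ q, TangentSpace 𝓘(ℝ, EP) q →ₗ[ℝ] V q}
  {X Y Z S : ∀ q : P, TangentSpace 𝓘(ℝ, EP) q}

/-- The section `λ X`. -/
def sec (h : L.IsAdapted c A lam) (hX : SmoothField X) : Cₛ^∞⟮𝓘(ℝ, EP); F, V⟯ :=
  ⟨fun q => lam q (X q), h.smooth X hX⟩

theorem sec_apply (h : L.IsAdapted c A lam) (hX : SmoothField X) (q : P) :
    h.sec hX q = lam q (X q) := rfl

theorem pairing_sec (h : L.IsAdapted c A lam) (hX : SmoothField X) (hY : SmoothField Y) (q : P) :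
    C.pairing q (h.sec hX q) (h.sec hY q) = c (A.form q (X q)) (A.form q (Y q)) :=
  h.pairing q _ _

theorem anchor_bracket_sec (h : L.IsAdapted c A lam) (hX : SmoothField X) (hY : SmoothField Y)
    (q : P) : C.anchor q (C.bracket (h.sec hX) (h.sec hY) q) = mlieBracket 𝓘(ℝ, EP) X Y q := by
  rw [C.anchor_bracket]
  simp only [sec_apply, h.anchor]

theorem isInvariantPerp_sec (h : L.IsAdapted c A lam) (hX : SmoothField X)
    (hX' : B.IsInvariant X) : L.IsInvariantPerp (h.sec hX) :=
  ⟨fun q z => h.pairing_rho q _ z, fun q g => by rw [sec_apply, sec_apply, h.lift, hX']⟩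

variable [LieGroup 𝓘(ℝ, EG) ∞ G]

theorem pairing_lam_vertical (h : L.IsAdapted c A lam) (hC : C.IsExact) {q : P}
    {v : TangentSpace 𝓘(ℝ, EP) q} (hv : B.dProj q v = 0) {u : V q}
    (hu : ∀ z, C.pairing q u (L.rho z q) = 0) :
    C.pairing q u (lam q v) = c (A.form q (C.anchor q u)) (A.form q v) := by
  obtain ⟨z, rfl⟩ := B.exists_fundamental_eq hv
  obtain ⟨α, hα⟩ := (hC q).2 (u - lam q (C.anchor q u)) (by rw [map_sub, h.anchor, sub_self])
  have hrho := hα (L.rho z q)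
  have hlam := hα (lam q (B.fundamental q z))
  rw [map_sub, LinearMap.sub_apply, hu, h.pairing_rho, L.anchor_rho, sub_zero] at hrho
  rwa [h.anchor, ← hrho, map_sub, LinearMap.sub_apply, h.pairing, sub_eq_zero] at hlam

theorem pairing_bracket_sec_vertical (h : L.IsAdapted c A lam) (hC : C.IsExact)
    (hX : SmoothField X) (hY : SmoothField Y) (hS : SmoothField S) (hX' : B.IsInvariant X)
    (hY' : B.IsInvariant Y) (hS' : ∀ q, B.dProj q (S q) = 0) (q : P) :
    C.pairing q (C.bracket (h.sec hX) (h.sec hY) q) (h.sec hS q) =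
      c (A.form q (mlieBracket 𝓘(ℝ, EP) X Y q)) (A.form q (S q)) := by
  rw [h.sec_apply hS, h.pairing_lam_vertical hC (hS' q), h.anchor_bracket_sec]
  exact ((h.isInvariantPerp_sec hX hX').bracket (h.isInvariantPerp_sec hY hY')).1 q

end IsAdapted

end LiftedAction

end Brackets

section ThreeForm

variable {EG : Type*} [NormedAddCommGroup EG] [NormedSpace ℝ EG]
  {G : Type*} [TopologicalSpace G] [ChartedSpace EG G] [Group G] [LieGroup 𝓘(ℝ, EG) ∞ G]
  {EP : Type*} [NormedAddCommGroup EP] [NormedSpace ℝ EP]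
  {P : Type*} [TopologicalSpace P] [ChartedSpace EP P] [IsManifold 𝓘(ℝ, EP) ∞ P]
  {EM : Type*} [NormedAddCommGroup EM] [NormedSpace ℝ EM]
  {M : Type*} [TopologicalSpace M] [ChartedSpace EM M]
  {B : PrincipalBundle EG G EP P EM M}
  {F : Type*} [NormedAddCommGroup F] [NormedSpace ℝ F]
  {V : P → Type*} [TopologicalSpace (TotalSpace F V)]
  [∀ q, AddCommGroup (V q)] [∀ q, Module ℝ (V q)] [∀ q, TopologicalSpace (V q)]
  [FiberBundle F V] [VectorBundle ℝ F V]
  {C : CourantAlgebroid EP F V} {L : LiftedAction B C}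
  {c : LinearMap.BilinForm ℝ (GroupLieAlgebra 𝓘(ℝ, EG) G)}
  {A : B.Connection} {lam : ∀ q, TangentSpace 𝓘(ℝ, EP) q →ₗ[ℝ] V q}

namespace LiftedAction

namespace IsAdapted

section Brackets

variable {X Y Z S T : ∀ q : P, TangentSpace 𝓘(ℝ, EP) q}

omit [LieGroup 𝓘(ℝ, EG) ∞ G] in
theorem pairing_sec_of_horizontal (h : L.IsAdapted c A lam) (hX : SmoothField X)
    (hZ : SmoothField Z) (hZh : ∀ q, A.form q (Z q) = 0) (q : P) :
    C.pairing q (h.sec hX q) (h.sec hZ q) = 0 := by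
  rw [h.pairing_sec, hZh, map_zero]

theorem pairing_bracket_sec_vertical_vertical (h : L.IsAdapted c A lam) (hC : C.IsExact)
    (hS : SmoothField S) (hT : SmoothField T) (hZ : SmoothField Z) (hS' : B.IsInvariant S)
    (hTv : ∀ q, B.dProj q (T q) = 0) (hZ' : B.IsInvariant Z) (hZh : ∀ q, A.form q (Z q) = 0)
    (q : P) : C.pairing q (C.bracket (h.sec hS) (h.sec hT) q) (h.sec hZ q) =
      c (A.form q (mlieBracket 𝓘(ℝ, EP) Z S q)) (A.form q (T q)) := by
  rw [C.pairing_bracket_comm_of_orthogonal (h.pairing_sec_of_horizontal hT hZ hZh),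
    C.pairing_bracket_swap_of_orthogonal (h.pairing_sec_of_horizontal hS hZ hZh), neg_neg,
    h.pairing_bracket_sec_vertical hC hZ hS hT hZ' hS' hTv]

theorem pairing_bracket_sec_horizontal_vertical (h : L.IsAdapted c A lam) (hC : C.IsExact)
    (hX : SmoothField X) (hS : SmoothField S) (hZ : SmoothField Z) (hX' : B.IsInvariant X)
    (hSv : ∀ q, B.dProj q (S q) = 0) (hZ' : B.IsInvariant Z) (hZh : ∀ q, A.form q (Z q) = 0)
    (q : P) : C.pairing q (C.bracket (h.sec hX) (h.sec hS) q) (h.sec hZ q) =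
      -c (A.form q (mlieBracket 𝓘(ℝ, EP) X Z q)) (A.form q (S q)) := by
  rw [C.pairing_bracket_comm_of_orthogonal (h.pairing_sec_of_horizontal hS hZ hZh),
    h.pairing_bracket_sec_vertical hC hX hZ hS hX' hZ' hSv]

theorem pairing_bracket_sec_vertical_horizontal (h : L.IsAdapted c A lam) (hC : C.IsExact)
    (hS : SmoothField S) (hX : SmoothField X) (hZ : SmoothField Z)
    (hSv : ∀ q, B.dProj q (S q) = 0) (hX' : B.IsInvariant X) (hXh : ∀ q, A.form q (X q) = 0)
    (hZ' : B.IsInvariant Z) (hZh : ∀ q, A.form q (Z q) = 0) (q : P) :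
    C.pairing q (C.bracket (h.sec hS) (h.sec hX) q) (h.sec hZ q) =
      c (A.form q (mlieBracket 𝓘(ℝ, EP) X Z q)) (A.form q (S q)) := by
  rw [C.pairing_bracket_swap_of_orthogonal (h.pairing_sec_of_horizontal hS hX hXh),
    h.pairing_bracket_sec_horizontal_vertical hC hX hS hZ hX' hSv hZ' hZh, neg_neg]

theorem sec_eq_sec_hor_add_sec_ver [FiniteDimensional ℝ EG] (h : L.IsAdapted c A lam)
    (hX : SmoothField X) :
    h.sec hX = h.sec (A.smoothField_hor hX) + h.sec (A.smoothField_ver hX) := by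
  ext q
  rw [ContMDiffSection.coe_add, Pi.add_apply, sec_apply, sec_apply, sec_apply, ← map_add,
    PrincipalBundle.Connection.hor, sub_add_cancel]

theorem pairing_bracket_sec [FiniteDimensional ℝ EG] (h : L.IsAdapted c A lam) (hC : C.IsExact)
    (hX : SmoothField X) (hY : SmoothField Y) (hZ : SmoothField Z) (hX' : B.IsInvariant X)
    (hY' : B.IsInvariant Y) (hZ' : B.IsInvariant Z) (hZh : ∀ q, A.form q (Z q) = 0) (q : P) :
    C.pairing q (C.bracket (h.sec hX) (h.sec hY) q) (h.sec hZ q) =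
      C.pairing q (C.bracket (h.sec (A.smoothField_hor hX)) (h.sec (A.smoothField_hor hY)) q)
        (h.sec hZ q) + c (A.covDeriv Z X q) (A.form q (Y q)) + c (A.curv X Z q) (A.form q (Y q))
        - c (A.curv Y Z q) (A.form q (X q)) := by
  have hor_Z : A.hor Z = Z := funext fun q =>
    A.eq_of_dProj_eq (A.dProj_hor Z q) ((A.form_hor Z q).trans (hZh q).symm)
  have hXh := A.smoothField_hor hX
  have hXv := A.smoothField_ver hX
  have hYh := A.smoothField_hor hY
  have hYv := A.smoothField_ver hY
  rw [h.sec_eq_sec_hor_add_sec_ver hX, h.sec_eq_sec_hor_add_sec_ver hY]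
  simp only [map_add, LinearMap.add_apply, ContMDiffSection.coe_add, Pi.add_apply]
  rw [h.pairing_bracket_sec_vertical_vertical hC hXv hYv hZ (A.isInvariant_ver hX')
      (A.dProj_ver Y) hZ' hZh,
    h.pairing_bracket_sec_horizontal_vertical hC hXh hYv hZ (A.isInvariant_hor hX')
      (A.dProj_ver Y) hZ' hZh,
    h.pairing_bracket_sec_vertical_horizontal hC hXv hYh hZ (A.dProj_ver X)
      (A.isInvariant_hor hY') (A.form_hor Y) hZ' hZh,
    A.form_ver, A.form_ver]
  simp only [PrincipalBundle.Connection.curv, PrincipalBundle.Connection.covDeriv, hor_Z, map_neg,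
    LinearMap.neg_apply]
  ring

end Brackets

section HorizontalLifts

variable [FiniteDimensional ℝ EG] [FiniteDimensional ℝ EP] [T2Space P] [IsManifold 𝓘(ℝ, EM) ∞ M]
  {X Y Z X' Y' Z' : Cₛ^∞⟮𝓘(ℝ, EM); EM, (TangentSpace 𝓘(ℝ, EM) : M → Type _)⟯}

/-- The section `λ (A^⊥ Z)`, for a smooth vector field `Z` on the base. -/
def horSec (h : L.IsAdapted c A lam) :
    Cₛ^∞⟮𝓘(ℝ, EM); EM, (TangentSpace 𝓘(ℝ, EM) : M → Type _)⟯ →ₗ[ℝ] Cₛ^∞⟮𝓘(ℝ, EP); F, V⟯ where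
  toFun Z := h.sec (A.smoothField_hlift Z.contMDiff)
  map_add' Z Z' := ContMDiffSection.ext fun q =>
    map_add (lam q ∘ₗ A.hlift q) (Z (B.proj q)) (Z' (B.proj q))
  map_smul' r Z := ContMDiffSection.ext fun q => map_smul (lam q ∘ₗ A.hlift q) r (Z (B.proj q))

theorem horSec_apply (h : L.IsAdapted c A lam)
    (Z : Cₛ^∞⟮𝓘(ℝ, EM); EM, (TangentSpace 𝓘(ℝ, EM) : M → Type _)⟯) (q : P) :
    h.horSec Z q = lam q (A.hlift q (Z (B.proj q))) := rfl

theorem isInvariantPerp_horSec (h : L.IsAdapted c A lam)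
    (Z : Cₛ^∞⟮𝓘(ℝ, EM); EM, (TangentSpace 𝓘(ℝ, EM) : M → Type _)⟯) :
    L.IsInvariantPerp (h.horSec Z) :=
  h.isInvariantPerp_sec (A.smoothField_hlift Z.contMDiff) (A.isInvariant_hlift Z)

theorem pairing_horSec (h : L.IsAdapted c A lam)
    (Y Z : Cₛ^∞⟮𝓘(ℝ, EM); EM, (TangentSpace 𝓘(ℝ, EM) : M → Type _)⟯) (q : P) :
    C.pairing q (h.horSec Y q) (h.horSec Z q) = 0 :=
  h.pairing_sec_of_horizontal (A.smoothField_hlift Y.contMDiff)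
    (A.smoothField_hlift Z.contMDiff) (fun q => A.form_hlift q _) q

/-- The function `2⟨[λ A^⊥X, λ A^⊥Y], λ A^⊥Z⟩`, which descends to the `3`-form `H`. -/
def tri (h : L.IsAdapted c A lam) (q : P)
    (X Y Z : Cₛ^∞⟮𝓘(ℝ, EM); EM, (TangentSpace 𝓘(ℝ, EM) : M → Type _)⟯) : ℝ :=
  2 * C.pairing q (C.bracket (h.horSec X) (h.horSec Y) q) (h.horSec Z q)

theorem tri_swap (h : L.IsAdapted c A lam) (q : P)
    (X Y Z : Cₛ^∞⟮𝓘(ℝ, EM); EM, (TangentSpace 𝓘(ℝ, EM) : M → Type _)⟯) :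
    h.tri q X Y Z = -h.tri q Y X Z := by
  rw [tri, tri, C.pairing_bracket_swap_of_orthogonal (h.pairing_horSec X Y), mul_neg]

theorem tri_comm (h : L.IsAdapted c A lam) (q : P)
    (X Y Z : Cₛ^∞⟮𝓘(ℝ, EM); EM, (TangentSpace 𝓘(ℝ, EM) : M → Type _)⟯) :
    h.tri q X Y Z = -h.tri q X Z Y := by
  rw [tri, tri, C.pairing_bracket_comm_of_orthogonal (h.pairing_horSec Y Z), mul_neg]

theorem tri_add_right (h : L.IsAdapted c A lam) (q : P)
    (X Y Z Z' : Cₛ^∞⟮𝓘(ℝ, EM); EM, (TangentSpace 𝓘(ℝ, EM) : M → Type _)⟯) :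
    h.tri q X Y (Z + Z') = h.tri q X Y Z + h.tri q X Y Z' := by
  rw [tri, map_add, ContMDiffSection.coe_add, Pi.add_apply, map_add, mul_add, tri, tri]

theorem tri_smul_right (h : L.IsAdapted c A lam) (q : P) (r : ℝ)
    (X Y Z : Cₛ^∞⟮𝓘(ℝ, EM); EM, (TangentSpace 𝓘(ℝ, EM) : M → Type _)⟯) :
    h.tri q X Y (r • Z) = r • h.tri q X Y Z := by
  rw [tri, map_smul, ContMDiffSection.coe_smul, Pi.smul_apply, map_smul, mul_smul_comm, tri]

theorem tri_congr_right (h : L.IsAdapted c A lam) {x : M} (q : B.Fib x)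
    (X Y : Cₛ^∞⟮𝓘(ℝ, EM); EM, (TangentSpace 𝓘(ℝ, EM) : M → Type _)⟯)
    (hZ : Z x = Z' x) : h.tri q.1 X Y Z = h.tri q.1 X Y Z' := by
  obtain ⟨q, rfl⟩ := q
  rw [tri, tri, h.horSec_apply Z', h.horSec_apply Z, hZ]

theorem tri_congr (h : L.IsAdapted c A lam) {x : M} (q : B.Fib x) (hX : X x = X' x)
    (hY : Y x = Y' x) (hZ : Z x = Z' x) : h.tri q.1 X Y Z = h.tri q.1 X' Y' Z' := by
  calc
    h.tri q.1 X Y Z = h.tri q.1 Y Z' X := by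
      rw [h.tri_congr_right q X Y hZ, h.tri_swap, h.tri_comm, neg_neg]
    _ = h.tri q.1 Z' X' Y := by
      rw [h.tri_congr_right q Y Z' hX, h.tri_swap, h.tri_comm, neg_neg]
    _ = h.tri q.1 X' Y' Z' := by
      rw [h.tri_congr_right q Z' X' hY, h.tri_swap, h.tri_comm, neg_neg]

theorem tri_act (h : L.IsAdapted c A lam) (q : P) (g : G)
    (X Y Z : Cₛ^∞⟮𝓘(ℝ, EM); EM, (TangentSpace 𝓘(ℝ, EM) : M → Type _)⟯) :
    h.tri (B.act q g) X Y Z = h.tri q X Y Z := by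
  rw [tri, tri, ((h.isInvariantPerp_horSec X).bracket (h.isInvariantPerp_horSec Y)).2,
    (h.isInvariantPerp_horSec Z).2, L.lift_pairing]

theorem tri_eq_of_proj_eq (h : L.IsAdapted c A lam) {q q' : P} (hq : B.proj q = B.proj q')
    (X Y Z : Cₛ^∞⟮𝓘(ℝ, EM); EM, (TangentSpace 𝓘(ℝ, EM) : M → Type _)⟯) :
    h.tri q X Y Z = h.tri q' X Y Z := by
  obtain ⟨g, rfl⟩ := B.exists_act_eq hq
  rw [h.tri_act]

variable [FiniteDimensional ℝ EM] [T2Space M]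

/-- The value at a point of the `3`-form `H` of an adapted splitting. -/
def formAt (h : L.IsAdapted c A lam) (x : M) : (TangentSpace 𝓘(ℝ, EM) x) [⋀^Fin 3]→ₗ[ℝ] ℝ :=
  alternatingMapOfSwap 2
    (fun m => h.tri (B.nonempty_fib x).some.1 (extendField (m 0)) (extendField (m 1))
      (extendField (m 2)))
    (fun m v w => (h.tri_congr_right _ _ _ ((extendField_apply _).trans
      (congrArg₂ (· + ·) (extendField_apply v) (extendField_apply w)).symm)).trans
        (h.tri_add_right _ _ _ _ _))
    (fun m r v => (h.tri_congr_right _ _ _ ((extendField_apply _).trans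
      (congrArg (r • ·) (extendField_apply v)).symm)).trans (h.tri_smul_right _ _ _ _ _))
    (fun m i hi => by
      fin_cases i
      · exact (h.tri_swap _ _ _ _).trans (congrArg Neg.neg ((h.tri_comm _ _ _ _).trans
          ((congrArg Neg.neg (h.tri_swap _ _ _ _)).trans (neg_neg _))))
      · exact h.tri_comm _ _ _ _
      · exact absurd rfl hi)

theorem formAt_apply (h : L.IsAdapted c A lam) (q : P)
    (X Y Z : Cₛ^∞⟮𝓘(ℝ, EM); EM, (TangentSpace 𝓘(ℝ, EM) : M → Type _)⟯) :
    h.formAt (B.proj q) ![X (B.proj q), Y (B.proj q), Z (B.proj q)] = h.tri q X Y Z :=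
  (h.tri_eq_of_proj_eq (B.nonempty_fib (B.proj q)).some.2 _ _ _).trans
    (h.tri_congr ⟨q, rfl⟩ (extendField_apply _) (extendField_apply _) (extendField_apply _))

/-- The `3`-form `H` of an adapted splitting. -/
def threeForm (h : L.IsAdapted c A lam) : SmoothForm EM M 3 where
  toFun := h.formAt
  smooth X hX := by
    let Y : Fin 3 → Cₛ^∞⟮𝓘(ℝ, EM); EM, (TangentSpace 𝓘(ℝ, EM) : M → Type _)⟯ :=
      fun i => ⟨X i, hX i⟩
    have hpull : ContMDiff 𝓘(ℝ, EP) 𝓘(ℝ, ℝ) ∞ (fun q => h.tri q (Y 0) (Y 1) (Y 2)) :=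
      contMDiff_const.mul (C.pairing_smooth _ _)
    refine B.contMDiff_of_comp_proj (hpull.congr fun q => ?_)
    rw [← h.formAt_apply q (Y 0) (Y 1) (Y 2)]
    exact congrArg _ (funext fun i => by fin_cases i <;> rfl)

end HorizontalLifts

end IsAdapted

end LiftedAction

end ThreeForm

section Presentation

variable {EG : Type*} [NormedAddCommGroup EG] [NormedSpace ℝ EG]
  {G : Type*} [TopologicalSpace G] [ChartedSpace EG G] [Group G]
  {EP : Type*} [NormedAddCommGroup EP] [NormedSpace ℝ EP]
  {P : Type*} [TopologicalSpace P] [ChartedSpace EP P] [IsManifold 𝓘(ℝ, EP) ∞ P]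
  {EM : Type*} [NormedAddCommGroup EM] [NormedSpace ℝ EM]
  {M : Type*} [TopologicalSpace M] [ChartedSpace EM M]
  {B : PrincipalBundle EG G EP P EM M}
  {F : Type*} [NormedAddCommGroup F] [NormedSpace ℝ F] [FiniteDimensional ℝ F]
  {V : P → Type*} [TopologicalSpace (TotalSpace F V)]
  [∀ q, AddCommGroup (V q)] [∀ q, Module ℝ (V q)] [∀ q, TopologicalSpace (V q)]
  [FiberBundle F V] [VectorBundle ℝ F V]
  {C : CourantAlgebroid EP F V} {L : LiftedAction B C}
  {c : LinearMap.BilinForm ℝ (GroupLieAlgebra 𝓘(ℝ, EG) G)}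
  {A : B.Connection} {lam : ∀ q, TangentSpace 𝓘(ℝ, EP) q →ₗ[ℝ] V q}

namespace LiftedAction

namespace IsAdapted

section Fiberwise

variable {x : M}

theorem pairing_baseCoanchor_lam (h : L.IsAdapted c A lam) (q : B.Fib x)
    (ξ : Module.Dual ℝ (TangentSpace 𝓘(ℝ, EM) x)) (v : TangentSpace 𝓘(ℝ, EP) q.1) :
    C.pairing q.1 (C.baseCoanchor q ξ) (lam q.1 v) = (1 / 2 : ℝ) * ξ (B.dProjFib q v) := by
  rw [C.pairing_baseCoanchor, h.anchor]

variable [FiniteDimensional ℝ EP] [T2Space P] [ContMDiffVectorBundle ∞ F V 𝓘(ℝ, EP)]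

theorem pairing_add_baseCoanchor (h : L.IsAdapted c A lam) (q : B.Fib x)
    (ξ η : Module.Dual ℝ (TangentSpace 𝓘(ℝ, EM) x)) (v w : TangentSpace 𝓘(ℝ, EP) q.1) :
    C.pairing q.1 (lam q.1 v + C.baseCoanchor q ξ) (lam q.1 w + C.baseCoanchor q η) =
      (1 / 2 : ℝ) * (η (B.dProjFib q v) + ξ (B.dProjFib q w)) +
        c (A.form q.1 v) (A.form q.1 w) := by
  rw [map_add, map_add, LinearMap.add_apply, LinearMap.add_apply, h.pairing,
    C.pairing_symm q.1 (lam q.1 v), h.pairing_baseCoanchor_lam, h.pairing_baseCoanchor_lam,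
    C.pairing_baseCoanchor, C.anchor_baseCoanchor, map_zero, map_zero]
  ring

omit [FiniteDimensional ℝ EP] [T2Space P] [ContMDiffVectorBundle ∞ F V 𝓘(ℝ, EP)] in
theorem two_mul_pairing_hlift [LieGroup 𝓘(ℝ, EG) ∞ G] [FiniteDimensional ℝ EG]
    (h : L.IsAdapted c A lam) (q : P) (v : TangentSpace 𝓘(ℝ, EP) q)
    (ξ : Module.Dual ℝ (TangentSpace 𝓘(ℝ, EM) (B.proj q)))
    (u : TangentSpace 𝓘(ℝ, EM) (B.proj q)) :
    2 * C.pairing q (lam q v + C.baseCoanchor (⟨q, rfl⟩ : B.Fib (B.proj q)) ξ)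
      (lam q (A.hlift q u)) = ξ u := by
  have hlift_u : B.dProjFib (⟨q, rfl⟩ : B.Fib (B.proj q)) (A.hlift q u) = u := A.dProj_hlift q u
  rw [map_add, LinearMap.add_apply, h.pairing, A.form_hlift, map_zero, zero_add,
    h.pairing_baseCoanchor_lam (⟨q, rfl⟩ : B.Fib (B.proj q)), hlift_u]
  ring

end Fiberwise

section Sections

variable [FiniteDimensional ℝ EP] [T2Space P] [ContMDiffVectorBundle ∞ F V 𝓘(ℝ, EP)]
  [FiniteDimensional ℝ EM] [IsManifold 𝓘(ℝ, EM) ∞ M] [T2Space M]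
  {X Y : ∀ q : P, TangentSpace 𝓘(ℝ, EP) q}
  {ξ η : ∀ x : M, Module.Dual ℝ (TangentSpace 𝓘(ℝ, EM) x)}

/-- The section `λ X + ½ π^* p^* ξ`. -/
def secAdd (h : L.IsAdapted c A lam) (hX : SmoothField X) (hξ : SmoothCovector ξ) :
    Cₛ^∞⟮𝓘(ℝ, EP); F, V⟯ :=
  h.sec hX + C.baseCoanchorSection B hξ

theorem anchor_secAdd (h : L.IsAdapted c A lam) (hX : SmoothField X) (hξ : SmoothCovector ξ)
    (q : P) : C.anchor q (h.secAdd hX hξ q) = X q := by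
  have hbase : C.anchor q (C.baseCoanchorSection B hξ q) = 0 :=
    C.anchor_baseCoanchor (⟨q, rfl⟩ : B.Fib (B.proj q)) (ξ (B.proj q))
  rw [secAdd, ContMDiffSection.coe_add, Pi.add_apply, map_add, hbase, add_zero, sec_apply, h.anchor]

theorem isInvariantPerp_secAdd (h : L.IsAdapted c A lam) (hX : SmoothField X)
    (hX' : B.IsInvariant X) (hξ : SmoothCovector ξ) : L.IsInvariantPerp (h.secAdd hX hξ) :=
  (h.isInvariantPerp_sec hX hX').add (isInvariantPerp_baseCoanchorSection hξ)

theorem anchor_bracket_secAdd (h : L.IsAdapted c A lam) (hX : SmoothField X) (hY : SmoothField Y)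
    (hξ : SmoothCovector ξ) (hη : SmoothCovector η) (q : P) :
    C.anchor q (C.bracket (h.secAdd hX hξ) (h.secAdd hY hη) q) =
      mlieBracket 𝓘(ℝ, EP) X Y q := by
  rw [C.anchor_bracket]
  simp only [anchor_secAdd]

variable [LieGroup 𝓘(ℝ, EG) ∞ G] [FiniteDimensional ℝ EG]
  {Xm Ym Z : ∀ x : M, TangentSpace 𝓘(ℝ, EM) x}

omit [FiniteDimensional ℝ F] [ContMDiffVectorBundle ∞ F V 𝓘(ℝ, EP)] in
theorem threeForm_apply_of_projects (h : L.IsAdapted c A lam) (hX : SmoothField X)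
    (hY : SmoothField Y) (hZ : SmoothField Z) (hXm : B.Projects X Xm) (hYm : B.Projects Y Ym)
    (q : P) : h.threeForm.toFun (B.proj q) ![Xm (B.proj q), Ym (B.proj q), Z (B.proj q)] =
      2 * C.pairing q
        (C.bracket (h.sec (A.smoothField_hor hX)) (h.sec (A.smoothField_hor hY)) q)
        (h.sec (A.smoothField_hlift hZ) q) := by
  have horSec_eq {X : ∀ q : P, TangentSpace 𝓘(ℝ, EP) q} (hX : SmoothField X)
      {Xm : ∀ x : M, TangentSpace 𝓘(ℝ, EM) x} (hXm : B.Projects X Xm) :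
      h.horSec ⟨Xm, hXm.smoothField B hX⟩ = h.sec (A.smoothField_hor hX) := by
    ext q
    rw [sec_apply, A.hor_eq_hlift, hXm q]
    rfl
  rw [← horSec_eq hX hXm, ← horSec_eq hY hYm]
  exact h.formAt_apply q ⟨Xm, hXm.smoothField B hX⟩ ⟨Ym, hYm.smoothField B hY⟩ ⟨Z, hZ⟩

theorem two_mul_pairing_bracket_secAdd (h : L.IsAdapted c A lam) (hC : C.IsExact)
    (hX : SmoothField X) (hY : SmoothField Y) (hX' : B.IsInvariant X) (hY' : B.IsInvariant Y)
    (hξ : SmoothCovector ξ) (hη : SmoothCovector η) (hXm : B.Projects X Xm)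
    (hYm : B.Projects Y Ym) (hZ : SmoothField Z) (q : P) :
    2 * C.pairing q (C.bracket (h.secAdd hX hξ) (h.secAdd hY hη) q)
        (h.sec (A.smoothField_hlift hZ) q) =
      dorfmanForm c A h.threeForm X Y (fun q => A.hlift q (Z (B.proj q))) Xm Ym Z ξ η q := by
  have hZh := A.smoothField_hlift hZ
  have projects_X : B.Projects (fun q => C.anchor q (h.sec hX q)) Xm := fun q =>
    (congrArg (B.dProj q) (h.anchor q _)).trans (hXm q)
  have projects_Y : B.Projects (fun q => C.anchor q (h.secAdd hY hη q)) Ym := fun q =>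
    (congrArg (B.dProj q) (h.anchor_secAdd hY hη q)).trans (hYm q)
  have projects_Z : B.Projects (fun q => C.anchor q (h.sec hZh q)) Z := fun q =>
    (congrArg (B.dProj q) (h.anchor q _)).trans (A.dProj_hlift q _)
  have bracket_eq : C.bracket (h.secAdd hX hξ) (h.secAdd hY hη) =
      C.bracket (h.sec hX) (h.sec hY) + C.bracket (h.sec hX) (C.baseCoanchorSection B hη) +
        C.bracket (C.baseCoanchorSection B hξ) (h.secAdd hY hη) := by
    rw [← map_add (C.bracket (h.sec hX)), ← secAdd, ← LinearMap.add_apply, ← map_add, ← secAdd]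
  rw [bracket_eq]
  simp only [ContMDiffSection.coe_add, Pi.add_apply, map_add, LinearMap.add_apply]
  rw [h.pairing_bracket_sec hC hX hY hZh hX' hY' (A.isInvariant_hlift Z)
      (fun q => A.form_hlift q _),
    C.pairing_bracket_baseCoanchorSection_right projects_X projects_Z,
    C.pairing_bracket_baseCoanchorSection_left projects_Y projects_Z, dorfmanForm,
    h.threeForm_apply_of_projects hX hY hZ hXm hYm]
  ring

end Sections

section Isomorphism

variable [LieGroup 𝓘(ℝ, EG) ∞ G] [FiniteDimensional ℝ EP] [T2Space P]
  [ContMDiffVectorBundle ∞ F V 𝓘(ℝ, EP)]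
  {σ : Cₛ^∞⟮𝓘(ℝ, EP); F, V⟯} {X Y : ∀ x, B.AtiyahFiber x}
  {ξ η : ∀ x : M, Module.Dual ℝ (TangentSpace 𝓘(ℝ, EM) x)}

theorem exists_represents_iso (h : L.IsAdapted c A lam) (hC : C.IsExact)
    (hc : L.IsQuadraticForm c) (hnd : ∀ z, (∀ w, c z w = 0) → z = 0) (hσ : L.IsInvariantPerp σ) :
    ∃ (X : ∀ x, B.AtiyahFiber x) (ξ : ∀ x : M, Module.Dual ℝ (TangentSpace 𝓘(ℝ, EM) x)),
      L.Represents σ (fun x => h.iso hC hc hnd x (X x, ξ x)) := by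
  choose a ha using fun x => h.toKperp_surjective hC x ⟨_, hσ.mem_quot x⟩
  exact ⟨fun x => (a x).1, fun x => (a x).2, fun x => ⟨hσ.mem_quot x, congrArg L.cls (ha x)⟩⟩

theorem anchor_of_represents_iso (h : L.IsAdapted c A lam) (hC : C.IsExact)
    (hc : L.IsQuadraticForm c) (hnd : ∀ z, (∀ w, c z w = 0) → z = 0)
    (hσ : L.Represents σ fun x => h.iso hC hc hnd x (X x, ξ x)) (q : P) :
    C.anchor q (σ q) = B.field X q := by
  rw [(h.represents_iso_iff hC hc hnd X ξ σ).1 hσ]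
  exact h.anchor_toKperp _ (X (B.proj q)) (ξ (B.proj q)) ⟨q, rfl⟩

theorem two_mul_pairing_of_represents_iso [FiniteDimensional ℝ EG] (h : L.IsAdapted c A lam)
    (hC : C.IsExact) (hc : L.IsQuadraticForm c) (hnd : ∀ z, (∀ w, c z w = 0) → z = 0)
    (hσ : L.Represents σ fun x => h.iso hC hc hnd x (X x, ξ x)) (q : P)
    (u : TangentSpace 𝓘(ℝ, EM) (B.proj q)) :
    2 * C.pairing q (σ q) (lam q (A.hlift q u)) = ξ (B.proj q) u := by
  rw [(h.represents_iso_iff hC hc hnd X ξ σ).1 hσ, h.two_mul_pairing_hlift]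

variable [FiniteDimensional ℝ EM] [IsManifold 𝓘(ℝ, EM) ∞ M] [T2Space M]

theorem represents_iso_iff_eq_secAdd (h : L.IsAdapted c A lam) (hC : C.IsExact)
    (hc : L.IsQuadraticForm c) (hnd : ∀ z, (∀ w, c z w = 0) → z = 0)
    (hX : SmoothField (B.field X)) (hξ : SmoothCovector ξ) :
    L.Represents σ (fun x => h.iso hC hc hnd x (X x, ξ x)) ↔ σ = h.secAdd hX hξ :=
  (h.represents_iso_iff hC hc hnd X ξ σ).trans
    ⟨fun hσ => ContMDiffSection.ext hσ, fun hσ q => congrArg (fun τ => τ q) hσ⟩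

variable [FiniteDimensional ℝ EG]

theorem smoothSection_iso_iff (h : L.IsAdapted c A lam) (hC : C.IsExact)
    (hc : L.IsQuadraticForm c) (hnd : ∀ z, (∀ w, c z w = 0) → z = 0) :
    L.SmoothSection (fun x => h.iso hC hc hnd x (X x, ξ x)) ↔
      SmoothField (B.field X) ∧ SmoothCovector ξ := by
  constructor
  · rintro ⟨σ, hσ⟩
    have hX : (fun q => C.anchor q (σ q)) = B.field X :=
      funext (h.anchor_of_represents_iso hC hc hnd hσ)
    refine ⟨hX ▸ C.anchor_smooth σ, fun Z hZ => B.contMDiff_of_comp_proj ?_⟩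
    have hpull : ContMDiff 𝓘(ℝ, EP) 𝓘(ℝ, ℝ) ∞
        (fun q => 2 * C.pairing q (σ q) (h.sec (A.smoothField_hlift hZ) q)) :=
      contMDiff_const.mul (C.pairing_smooth _ _)
    exact hpull.congr fun q => (h.two_mul_pairing_of_represents_iso hC hc hnd hσ q _).symm
  · rintro ⟨hX, hξ⟩
    exact ⟨h.secAdd hX hξ, (h.represents_iso_iff_eq_secAdd hC hc hnd hX hξ).2 rfl⟩

theorem isPresentation (h : L.IsAdapted c A lam) (hC : C.IsExact) (hc : L.IsQuadraticForm c)
    (hnd : ∀ z, (∀ w, c z w = 0) → z = 0) :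
    L.IsPresentation c A (h.iso hC hc hnd) h.threeForm where
  smooth_iff X ξ := h.smoothSection_iso_iff hC hc hnd
  proj x X ξ u hu q := by
    obtain rfl : h.toKperp x (X, ξ) = u := cls_injective hc hnd x hu
    exact h.anchor_toKperp x X ξ q
  pairing_eq q X Y ξ η := h.pairing_add_baseCoanchor (⟨q, rfl⟩ : B.Fib (B.proj q)) ξ η _ _
  bracket_eq X Y ξ η hX hY hξ hη := by
    have hX' := B.isInvariant_field X
    have hY' := B.isInvariant_field Y
    obtain ⟨W, ζ, hbracket⟩ := h.exists_represents_iso hC hc hnd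
      ((h.isInvariantPerp_secAdd hX hX' hξ).bracket (h.isInvariantPerp_secAdd hY hY' hη))
    refine ⟨W, ζ, fun q => ?_, fun Xm Ym Z Zh hXm hYm hZ hZh q => ?_,
      ⟨_, (h.represents_iso_iff_eq_secAdd hC hc hnd hX hξ).2 rfl⟩,
      ⟨_, (h.represents_iso_iff_eq_secAdd hC hc hnd hY hη).2 rfl⟩, fun σ τ hσ hτ => ?_⟩
    · rw [← h.anchor_of_represents_iso hC hc hnd hbracket, h.anchor_bracket_secAdd]
    · obtain rfl := hZh.eq_hlift
      rw [← h.two_mul_pairing_of_represents_iso hC hc hnd hbracket,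
        ← h.two_mul_pairing_bracket_secAdd hC hX hY hX' hY' hξ hη hXm hYm hZ, sec_apply]
    · obtain rfl := (h.represents_iso_iff_eq_secAdd hC hc hnd hX hξ).1 hσ
      obtain rfl := (h.represents_iso_iff_eq_secAdd hC hc hnd hY hη).1 hτ
      exact hbracket

end Isomorphism

end IsAdapted

end LiftedAction

end Presentation

section Contraction

variable {E : Type*} [NormedAddCommGroup E] [NormedSpace ℝ E]
  {M : Type*} [TopologicalSpace M] [ChartedSpace E M] [IsManifold 𝓘(ℝ, E) ∞ M]
  {X Y Z : ∀ x : M, TangentSpace 𝓘(ℝ, E) x}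
  {ξ η : ∀ x : M, Module.Dual ℝ (TangentSpace 𝓘(ℝ, E) x)}

theorem SmoothCovector.add (hξ : SmoothCovector ξ) (hη : SmoothCovector η) :
    SmoothCovector (fun x => ξ x + η x) :=
  fun X hX => (hξ X hX).add (hη X hX)

theorem SmoothCovector.sub (hξ : SmoothCovector ξ) (hη : SmoothCovector η) :
    SmoothCovector (fun x => ξ x - η x) :=
  fun X hX => (hξ X hX).sub (hη X hX)

theorem SmoothCovector.mdifferentiableAt_apply (hξ : SmoothCovector ξ) (hX : SmoothField X)
    (x : M) : MDifferentiableAt 𝓘(ℝ, E) 𝓘(ℝ, ℝ) (fun x => ξ x (X x)) x :=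
  (hξ X hX).mdifferentiableAt (by simp)

theorem lieDerivOne_add (hξ : SmoothCovector ξ) (hη : SmoothCovector η)
    (X : ∀ x : M, TangentSpace 𝓘(ℝ, E) x) (hZ : SmoothField Z) (x : M) :
    lieDerivOne X (fun y => ξ y + η y) Z x = lieDerivOne X ξ Z x + lieDerivOne X η Z x := by
  simp only [lieDerivOne, LinearMap.add_apply]
  rw [dirDeriv_add X (hξ.mdifferentiableAt_apply hZ x) (hη.mdifferentiableAt_apply hZ x)]
  ring

theorem extDerivOne_add (hξ : SmoothCovector ξ) (hη : SmoothCovector η) (hY : SmoothField Y)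
    (hZ : SmoothField Z) (x : M) :
    extDerivOne (fun y => ξ y + η y) Y Z x = extDerivOne ξ Y Z x + extDerivOne η Y Z x := by
  simp only [extDerivOne, LinearMap.add_apply]
  rw [dirDeriv_add Y (hξ.mdifferentiableAt_apply hZ x) (hη.mdifferentiableAt_apply hZ x),
    dirDeriv_add Z (hξ.mdifferentiableAt_apply hY x) (hη.mdifferentiableAt_apply hY x)]
  ring

namespace SmoothForm

variable (b : SmoothForm E M 2)

/-- The contraction `u ↦ i_u b` of a `2`-form. -/
def contract (x : M) :
    TangentSpace 𝓘(ℝ, E) x →ₗ[ℝ] Module.Dual ℝ (TangentSpace 𝓘(ℝ, E) x) :=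
  LinearMap.mk₂ ℝ (fun u v => b.toFun x ![u, v])
    (fun u u' v => (b.toFun x).map_vecCons_add ![v] u u')
    (fun r u v => (b.toFun x).map_vecCons_smul ![v] r u)
    (fun u v v' => ((b.toFun x).curryLeft u).map_vecCons_add ![] v v')
    (fun r u v => ((b.toFun x).curryLeft u).map_vecCons_smul ![] r v)

theorem contract_apply (x : M) (u v : TangentSpace 𝓘(ℝ, E) x) :
    b.contract x u v = b.toFun x ![u, v] := rfl

theorem contract_self (x : M) (u : TangentSpace 𝓘(ℝ, E) x) : b.contract x u u = 0 :=
  (b.toFun x).map_eq_zero_of_eq ![u, u] (i := 0) (j := 1) rfl (by decide)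

theorem contract_swap (x : M) (u v : TangentSpace 𝓘(ℝ, E) x) :
    b.contract x u v = -b.contract x v u :=
  (LinearMap.IsAlt.neg (B := b.contract x) (b.contract_self x) v u).symm

theorem smoothCovector_contract (hX : SmoothField X) :
    SmoothCovector (fun x => b.contract x (X x)) := fun Z hZ => by
  refine (b.smooth ![X, Z] (Fin.forall_fin_two.2 ⟨hX, hZ⟩)).congr fun x => ?_
  exact congrArg (b.toFun x) (funext (Fin.forall_fin_two.2 ⟨rfl, rfl⟩))

theorem lieDerivOne_contract_sub (X Y Z : ∀ x : M, TangentSpace 𝓘(ℝ, E) x) (x : M) :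
    lieDerivOne X (fun y => b.contract y (Y y)) Z x
      - extDerivOne (fun y => b.contract y (X y)) Y Z x =
    extDerivTwo b X Y Z x + b.contract x (mlieBracket 𝓘(ℝ, E) X Y x) (Z x) := by
  have swap_Y := b.contract_swap x (Y x) (mlieBracket 𝓘(ℝ, E) X Z x)
  have swap_X := b.contract_swap x (X x) (mlieBracket 𝓘(ℝ, E) Y Z x)
  simp only [contract_apply] at swap_Y swap_X
  simp only [lieDerivOne, extDerivOne, extDerivTwo, contract_apply, swap_Y, swap_X]
  ring

end SmoothForm

end Contraction

section Transformation

variable {EG : Type*} [NormedAddCommGroup EG] [NormedSpace ℝ EG]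
  {G : Type*} [TopologicalSpace G] [ChartedSpace EG G] [Group G]
  {EP : Type*} [NormedAddCommGroup EP] [NormedSpace ℝ EP]
  {P : Type*} [TopologicalSpace P] [ChartedSpace EP P] [IsManifold 𝓘(ℝ, EP) ∞ P]
  {EM : Type*} [NormedAddCommGroup EM] [NormedSpace ℝ EM]
  {M : Type*} [TopologicalSpace M] [ChartedSpace EM M]
  {B : PrincipalBundle EG G EP P EM M}
  {F : Type*} [NormedAddCommGroup F] [NormedSpace ℝ F]
  {V : P → Type*} [TopologicalSpace (TotalSpace F V)]
  [∀ q, AddCommGroup (V q)] [∀ q, Module ℝ (V q)] [∀ q, TopologicalSpace (V q)]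
  [FiberBundle F V] [VectorBundle ℝ F V]
  {C : CourantAlgebroid EP F V}

theorem PrincipalBundle.atiyahProj_eq_mlieBracket [LieGroup 𝓘(ℝ, EG) ∞ G]
    [FiniteDimensional ℝ EP] [T2Space P] [FiniteDimensional ℝ EM]
    [IsManifold 𝓘(ℝ, EM) ∞ M] [T2Space M] {X Y W : ∀ x, B.AtiyahFiber x}
    {Xm Ym : ∀ x : M, TangentSpace 𝓘(ℝ, EM) x} (hX : SmoothField (B.field X))
    (hY : SmoothField (B.field Y)) (hXm : B.Projects (B.field X) Xm)
    (hYm : B.Projects (B.field Y) Ym)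
    (hW : ∀ q, B.field W q = mlieBracket 𝓘(ℝ, EP) (B.field X) (B.field Y) q) (x : M) :
    B.atiyahProj x (W x) = mlieBracket 𝓘(ℝ, EM) Xm Ym x := by
  obtain ⟨q, rfl⟩ := B.proj_surjective x
  refine (B.projects_atiyahProj W q).symm.trans ?_
  rw [hW]
  exact mfderiv_mlieBracket_of_related B.contMDiff_proj hX hY
    (hXm.smoothField B hX) (hYm.smoothField B hY) hXm hYm q

namespace LiftedAction

variable {L : LiftedAction B C} {c : LinearMap.BilinForm ℝ (GroupLieAlgebra 𝓘(ℝ, EG) G)}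
  {A : B.Connection}

theorem Represents.unique {σ : Cₛ^∞⟮𝓘(ℝ, EP); F, V⟯} {s s' : ∀ x, L.RedFiber x}
    (h : L.Represents σ s) (h' : L.Represents σ s') : s = s' := by
  funext x
  obtain ⟨_, hs⟩ := h x
  obtain ⟨_, hs'⟩ := h' x
  rw [hs, hs']

theorem IsBracket.unique {s t r r' : ∀ x, L.RedFiber x} (h : L.IsBracket s t r)
    (h' : L.IsBracket s t r') : r = r' := by
  obtain ⟨⟨σ, hσ⟩, ⟨τ, hτ⟩, hr⟩ := h
  exact (hr σ τ hσ hτ).unique (h'.2.2 σ τ hσ hτ)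

variable [IsManifold 𝓘(ℝ, EM) ∞ M]
  {Φ Φ' : ∀ x, (B.AtiyahFiber x × Module.Dual ℝ (TangentSpace 𝓘(ℝ, EM) x)) ≃ₗ[ℝ] L.RedFiber x}
  {H H' : SmoothForm EM M 3} {b : SmoothForm EM M 2}

theorem dorfmanForm_add_contract (H : SmoothForm EM M 3) (b : SmoothForm EM M 2)
    (X Y Zh : ∀ q : P, TangentSpace 𝓘(ℝ, EP) q) {Xm Ym Z : ∀ x : M, TangentSpace 𝓘(ℝ, EM) x}
    (hXm : SmoothField Xm) (hYm : SmoothField Ym) (hZ : SmoothField Z)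
    {ξ η : ∀ x : M, Module.Dual ℝ (TangentSpace 𝓘(ℝ, EM) x)} (hξ : SmoothCovector ξ)
    (hη : SmoothCovector η) (q : P) :
    dorfmanForm c A H X Y Zh Xm Ym Z (fun x => ξ x + b.contract x (Xm x))
        (fun x => η x + b.contract x (Ym x)) q =
      dorfmanForm c A H X Y Zh Xm Ym Z ξ η q + extDerivTwo b Xm Ym Z (B.proj q) +
        b.contract (B.proj q) (mlieBracket 𝓘(ℝ, EM) Xm Ym (B.proj q)) (Z (B.proj q)) := by
  rw [dorfmanForm, dorfmanForm, lieDerivOne_add hη (b.smoothCovector_contract hYm) _ hZ,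
    extDerivOne_add hξ (b.smoothCovector_contract hXm) hYm hZ]
  linear_combination b.lieDerivOne_contract_sub Xm Ym Z (B.proj q)

/-- The composition of `Φ` with `X + ξ ↦ X + ξ + i_{pX} b`. -/
def bTransform (b : SmoothForm EM M 2)
    (Φ : ∀ x, (B.AtiyahFiber x × Module.Dual ℝ (TangentSpace 𝓘(ℝ, EM) x)) ≃ₗ[ℝ] L.RedFiber x)
    (x : M) : (B.AtiyahFiber x × Module.Dual ℝ (TangentSpace 𝓘(ℝ, EM) x)) ≃ₗ[ℝ] L.RedFiber x :=
  (LinearEquiv.skewProd (LinearEquiv.refl ℝ _) (LinearEquiv.refl ℝ _)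
    (b.contract x ∘ₗ B.atiyahProj x)).trans (Φ x)

theorem bTransform_apply (b : SmoothForm EM M 2) (x : M) (X : B.AtiyahFiber x)
    (ξ : Module.Dual ℝ (TangentSpace 𝓘(ℝ, EM) x)) :
    bTransform b Φ x (X, ξ) = Φ x (X, ξ + b.contract x (B.atiyahProj x X)) := rfl

variable [LieGroup 𝓘(ℝ, EG) ∞ G]

theorem isBTransform_bTransform : L.IsBTransform (bTransform b Φ) Φ b := by
  intro q X ξ ξ' hξ'
  have hX : B.dProj q (X.1 ⟨q, rfl⟩) = B.atiyahProj (B.proj q) X :=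
    B.dProj_eq_atiyahProj X ⟨q, rfl⟩
  obtain rfl : ξ' = ξ + b.contract (B.proj q) (B.atiyahProj (B.proj q) X) :=
    LinearMap.ext fun v => by rw [hξ' v, hX]; rfl
  rfl

namespace IsPresentation

theorem pairing_eq_atiyahProj (h : L.IsPresentation c A Φ H) (q : P)
    (X Y : B.AtiyahFiber (B.proj q))
    (ξ η : Module.Dual ℝ (TangentSpace 𝓘(ℝ, EM) (B.proj q))) :
    L.pairing ⟨q, rfl⟩ (Φ (B.proj q) (X, ξ)) (Φ (B.proj q) (Y, η)) =
      (1 / 2 : ℝ) * (η (B.atiyahProj (B.proj q) X) + ξ (B.atiyahProj (B.proj q) Y)) +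
        c (A.form q (X.1 ⟨q, rfl⟩)) (A.form q (Y.1 ⟨q, rfl⟩)) := by
  rw [h.pairing_eq, ← B.dProj_eq_atiyahProj X ⟨q, rfl⟩, ← B.dProj_eq_atiyahProj Y ⟨q, rfl⟩]

theorem bTransform [FiniteDimensional ℝ EP] [T2Space P] [FiniteDimensional ℝ EM] [T2Space M]
    (h : L.IsPresentation c A Φ H) (hH : EqAddExact H' H b) :
    L.IsPresentation c A (bTransform b Φ) H' where
  smooth_iff X ξ := by
    refine (h.smooth_iff X fun x => ξ x + b.contract x (B.atiyahProj x (X x))).trans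
      (and_congr_right fun hX => ?_)
    have hb := b.smoothCovector_contract ((B.projects_atiyahProj X).smoothField B hX)
    exact ⟨fun hξ => by simpa only [add_sub_cancel_right] using hξ.sub hb, fun hξ => hξ.add hb⟩
  proj x X ξ u hu q := h.proj x X _ u hu q
  pairing_eq q X Y ξ η := by
    rw [bTransform_apply, bTransform_apply, h.pairing_eq_atiyahProj, LinearMap.add_apply,
      LinearMap.add_apply, b.contract_swap _ (B.atiyahProj (B.proj q) Y),
      ← B.dProj_eq_atiyahProj X ⟨q, rfl⟩, ← B.dProj_eq_atiyahProj Y ⟨q, rfl⟩]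
    exact congrArg (· + _) (by ring)
  bracket_eq X Y ξ η hX hY hξ hη := by
    have hpX := (B.projects_atiyahProj X).smoothField B hX
    have hpY := (B.projects_atiyahProj Y).smoothField B hY
    obtain ⟨W, ζ, hW, hζ, hbracket⟩ := h.bracket_eq X Y _ _ hX hY
      (hξ.add (b.smoothCovector_contract hpX)) (hη.add (b.smoothCovector_contract hpY))
    refine ⟨W, fun x => ζ x - b.contract x (B.atiyahProj x (W x)), hW,
      fun Xm Ym Z Zh hXm hYm hZ hZh q => ?_, ?_⟩
    · obtain rfl := (B.projects_atiyahProj X).unique hXm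
      obtain rfl := (B.projects_atiyahProj Y).unique hYm
      rw [LinearMap.sub_apply, hζ _ _ Z Zh hXm hYm hZ hZh q,
        dorfmanForm_add_contract H b _ _ Zh hpX hpY hZ hξ hη,
        PrincipalBundle.atiyahProj_eq_mlieBracket hX hY hXm hYm hW, add_sub_cancel_right,
        dorfmanForm, dorfmanForm, hH _ _ _ hpX hpY hZ]
      ring
    · simpa only [bTransform_apply, sub_add_cancel] using hbracket

theorem fst_symm_apply (h : L.IsPresentation c A Φ H) (h' : L.IsPresentation c A Φ' H') (x : M)
    (X : B.AtiyahFiber x) (ξ : Module.Dual ℝ (TangentSpace 𝓘(ℝ, EM) x)) :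
    ((Φ x).symm (Φ' x (X, ξ))).1 = X := by
  obtain ⟨u, hu⟩ := Submodule.Quotient.mk_surjective _ (Φ' x (X, ξ))
  obtain ⟨q⟩ := B.nonempty_fib x
  refine B.atiyah_ext q (((h.proj x _ ((Φ x).symm (Φ' x (X, ξ))).2 u ?_ q).symm).trans
    (h'.proj x X ξ u hu.symm q))
  exact ((Φ x).apply_symm_apply _).trans hu.symm

variable (Φ Φ') in
/-- The cotangent component of `Φ⁻¹ ∘ Φ'`. -/
def transition (x : M) : (B.AtiyahFiber x × Module.Dual ℝ (TangentSpace 𝓘(ℝ, EM) x)) →ₗ[ℝ]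
    Module.Dual ℝ (TangentSpace 𝓘(ℝ, EM) x) :=
  LinearMap.snd ℝ _ _ ∘ₗ ((Φ' x).trans (Φ x).symm).toLinearMap

theorem apply_eq_transition (h : L.IsPresentation c A Φ H) (h' : L.IsPresentation c A Φ' H')
    (x : M) (X : B.AtiyahFiber x) (ξ : Module.Dual ℝ (TangentSpace 𝓘(ℝ, EM) x)) :
    Φ' x (X, ξ) = Φ x (X, transition Φ Φ' x (X, ξ)) :=
  (Φ x).symm_apply_eq.1 (Prod.ext (h.fst_symm_apply h' x X ξ) rfl)

theorem transition_add_transition (h : L.IsPresentation c A Φ H)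
    (h' : L.IsPresentation c A Φ' H') (x : M) (X Y : B.AtiyahFiber x)
    (ξ η : Module.Dual ℝ (TangentSpace 𝓘(ℝ, EM) x)) :
    transition Φ Φ' x (Y, η) (B.atiyahProj x X) + transition Φ Φ' x (X, ξ) (B.atiyahProj x Y) =
      η (B.atiyahProj x X) + ξ (B.atiyahProj x Y) := by
  obtain ⟨q, rfl⟩ := B.proj_surjective x
  have pairing_eq := h'.pairing_eq_atiyahProj q X Y ξ η
  rw [h.apply_eq_transition h', h.apply_eq_transition h', h.pairing_eq_atiyahProj] at pairing_eq
  linarith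

theorem transition_swap (h : L.IsPresentation c A Φ H) (h' : L.IsPresentation c A Φ' H') (x : M)
    (X Y : B.AtiyahFiber x) :
    transition Φ Φ' x (X, 0) (B.atiyahProj x Y) =
      -transition Φ Φ' x (Y, 0) (B.atiyahProj x X) := by
  have hsum := h.transition_add_transition h' x Y X 0 0
  simp only [LinearMap.zero_apply, add_zero] at hsum
  exact eq_neg_of_add_eq_zero_left hsum

theorem transition_zero_left (h : L.IsPresentation c A Φ H) (h' : L.IsPresentation c A Φ' H')
    (x : M) (ξ : Module.Dual ℝ (TangentSpace 𝓘(ℝ, EM) x)) : transition Φ Φ' x (0, ξ) = ξ := by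
  refine LinearMap.ext fun v => ?_
  have hsum := h.transition_add_transition h' x 0 (A.atiyahLift x v) ξ 0
  simpa only [map_zero, zero_add, LinearMap.zero_apply, A.atiyahProj_atiyahLift] using hsum

theorem transition_atiyahLift_swap (h : L.IsPresentation c A Φ H)
    (h' : L.IsPresentation c A Φ' H') (x : M) (u v : TangentSpace 𝓘(ℝ, EM) x) :
    transition Φ Φ' x (A.atiyahLift x u, 0) v = -transition Φ Φ' x (A.atiyahLift x v, 0) u := by
  have hswap := h.transition_swap h' x (A.atiyahLift x u) (A.atiyahLift x v)
  rwa [A.atiyahProj_atiyahLift, A.atiyahProj_atiyahLift] at hswap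

theorem transition_apply_eq_atiyahLift (h : L.IsPresentation c A Φ H)
    (h' : L.IsPresentation c A Φ' H') (x : M) (X : B.AtiyahFiber x)
    (ξ : Module.Dual ℝ (TangentSpace 𝓘(ℝ, EM) x)) :
    transition Φ Φ' x (X, ξ) =
      ξ + transition Φ Φ' x (A.atiyahLift x (B.atiyahProj x X), 0) := by
  have transition_fst :
      transition Φ Φ' x (X, 0) = transition Φ Φ' x (A.atiyahLift x (B.atiyahProj x X), 0) := by
    refine LinearMap.ext fun v => ?_
    have hswap := h.transition_swap h' x X (A.atiyahLift x v)
    rw [A.atiyahProj_atiyahLift] at hswap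
    rw [hswap, h.transition_atiyahLift_swap h']
    exact neg_neg _
  have split : ((X, ξ) : B.AtiyahFiber x × Module.Dual ℝ (TangentSpace 𝓘(ℝ, EM) x)) =
      (0, ξ) + (X, 0) := Prod.ext (zero_add X).symm (add_zero ξ).symm
  rw [split, map_add, h.transition_zero_left h', transition_fst]

variable [FiniteDimensional ℝ EG] [FiniteDimensional ℝ EP] [T2Space P]

/-- The `2`-form `(u, v) ↦ i_v (Φ⁻¹ ∘ Φ')(A^⊥ u)` relating two presentations. -/
def twoForm (h : L.IsPresentation c A Φ H) (h' : L.IsPresentation c A Φ' H') :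
    SmoothForm EM M 2 where
  toFun x := alternatingMapOfSwap 1
    (fun m => transition Φ Φ' x (A.atiyahLift x (m 0), 0) (m 1))
    (fun _ _ _ => map_add _ _ _) (fun _ _ _ => map_smul _ _ _)
    (fun m i hi => by
      obtain rfl : i = 0 := by omega
      exact h.transition_atiyahLift_swap h' x (m 1) (m 0))
  smooth X hX := by
    have hsmooth := (h'.smooth_iff (fun x => A.atiyahLift x (X 0 x)) fun _ => 0).2
      ⟨A.smoothField_hlift (hX 0), fun _ _ => contMDiff_const⟩
    simp only [h.apply_eq_transition h'] at hsmooth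
    exact ((h.smooth_iff _ _).1 hsmooth).2 (X 1) (hX 1)

theorem eq_bTransform_twoForm (h : L.IsPresentation c A Φ H) (h' : L.IsPresentation c A Φ' H') :
    Φ' = LiftedAction.bTransform (h.twoForm h') Φ := by
  refine funext fun x => LinearEquiv.ext fun ⟨X, ξ⟩ => ?_
  rw [bTransform_apply, h.apply_eq_transition h', h.transition_apply_eq_atiyahLift h']
  rfl

theorem isBTransform_twoForm (h : L.IsPresentation c A Φ H) (h' : L.IsPresentation c A Φ' H') :
    L.IsBTransform Φ' Φ (h.twoForm h') := by
  intro q X ξ ξ' hξ'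
  rw [congrFun (h.eq_bTransform_twoForm h') (B.proj q)]
  exact isBTransform_bTransform q X ξ ξ' hξ'

variable [FiniteDimensional ℝ EM] [T2Space M]

theorem eqAddExact_of_bTransform (h : L.IsPresentation c A Φ H)
    (h' : L.IsPresentation c A (LiftedAction.bTransform b Φ) H') : EqAddExact H' H b := by
  intro X Y Z hX hY hZ x
  obtain ⟨q, rfl⟩ := B.proj_surjective x
  let Xl : ∀ x, B.AtiyahFiber x := fun x => A.atiyahLift x (X x)
  let Yl : ∀ x, B.AtiyahFiber x := fun x => A.atiyahLift x (Y x)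
  have hXl : SmoothField (B.field Xl) := A.smoothField_hlift hX
  have hYl : SmoothField (B.field Yl) := A.smoothField_hlift hY
  have projects_Xl : B.Projects (B.field Xl) X := fun q => A.dProj_hlift q _
  have projects_Yl : B.Projects (B.field Yl) Y := fun q => A.dProj_hlift q _
  have hzero : SmoothCovector fun x : M => (0 : Module.Dual ℝ (TangentSpace 𝓘(ℝ, EM) x)) :=
    fun _ _ => contMDiff_const
  obtain ⟨W', ζ', hW', hζ', hbracket'⟩ := h'.bracket_eq Xl Yl _ _ hXl hYl hzero hzero
  obtain ⟨W, ζ, -, hζ, hbracket⟩ := h.bracket_eq Xl Yl _ _ hXl hYl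
    (hzero.add (b.smoothCovector_contract hX)) (hzero.add (b.smoothCovector_contract hY))
  simp only [bTransform_apply, Xl, Yl, A.atiyahProj_atiyahLift] at hbracket'
  have hsnd := congrArg Prod.snd
    ((Φ (B.proj q)).injective (congrFun (hbracket.unique hbracket') (B.proj q)))
  have dorfmanForm_eq := LinearMap.congr_fun hsnd (Z (B.proj q))
  simp only [LinearMap.add_apply] at dorfmanForm_eq
  rw [hζ X Y Z _ projects_Xl projects_Yl hZ (A.isHorLift_hlift Z) q,
    hζ' X Y Z _ projects_Xl projects_Yl hZ (A.isHorLift_hlift Z) q,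
    dorfmanForm_add_contract H b _ _ _ hX hY hZ hzero hzero,
    PrincipalBundle.atiyahProj_eq_mlieBracket hXl hYl projects_Xl projects_Yl hW',
    dorfmanForm, dorfmanForm] at dorfmanForm_eq
  linear_combination -dorfmanForm_eq

theorem eqAddExact_twoForm (h : L.IsPresentation c A Φ H) (h' : L.IsPresentation c A Φ' H') :
    EqAddExact H' H (h.twoForm h') :=
  h.eqAddExact_of_bTransform (h.eq_bTransform_twoForm h' ▸ h')

end IsPresentation

end LiftedAction

end Transformation

end CourantReduction

end

theorem mainTheorem6_general
    {EG : Type*} [NormedAddCommGroup EG] [NormedSpace ℝ EG] [FiniteDimensional ℝ EG]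
    {G : Type*} [TopologicalSpace G] [ChartedSpace EG G] [Group G] [LieGroup 𝓘(ℝ, EG) ∞ G]
    {EP : Type*} [NormedAddCommGroup EP] [NormedSpace ℝ EP] [FiniteDimensional ℝ EP]
    {P : Type*} [TopologicalSpace P] [ChartedSpace EP P] [IsManifold 𝓘(ℝ, EP) ∞ P]
    [T2Space P]
    {EM : Type*} [NormedAddCommGroup EM] [NormedSpace ℝ EM] [FiniteDimensional ℝ EM]
    {M : Type*} [TopologicalSpace M] [ChartedSpace EM M] [IsManifold 𝓘(ℝ, EM) ∞ M]
    [T2Space M]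
    (B : PrincipalBundle EG G EP P EM M)
    {F : Type*} [NormedAddCommGroup F] [NormedSpace ℝ F] [FiniteDimensional ℝ F]
    {V : P → Type*} [TopologicalSpace (TotalSpace F V)]
    [∀ q, AddCommGroup (V q)] [∀ q, Module ℝ (V q)] [∀ q, TopologicalSpace (V q)]
    [FiberBundle F V] [VectorBundle ℝ F V] [ContMDiffVectorBundle ∞ F V 𝓘(ℝ, EP)]
    (C : CourantAlgebroid EP F V) (hC : C.IsExact)
    (L : LiftedAction B C) (hL : L.IsEquivariant)
    (hs : ∃ s, L.IsEquivariantIsotropicSplitting s)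
    (c : LinearMap.BilinForm ℝ (GroupLieAlgebra 𝓘(ℝ, EG) G)) (hc : L.IsQuadraticForm c)
    (hnd : ∀ z, (∀ w, c z w = 0) → z = 0)
    (A : B.Connection) :
    (∃ Φ H, L.IsPresentation c A Φ H) ∧
    (∀ Φ H Φ' H', L.IsPresentation c A Φ H → L.IsPresentation c A Φ' H' →
      ∃ b : SmoothForm EM M 2, L.IsBTransform Φ' Φ b ∧ EqAddExact H' H b) ∧
    (∀ Φ H H' (b : SmoothForm EM M 2), L.IsPresentation c A Φ H → EqAddExact H' H b →
      ∃ Φ', L.IsBTransform Φ' Φ b ∧ L.IsPresentation c A Φ' H') := by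
  obtain ⟨s, hs⟩ := hs
  exact ⟨⟨_, _, (LiftedAction.isAdapted_adaptedSplitting hL hc hs A).isPresentation hC hc hnd⟩,
    fun _ _ _ _ h h' => ⟨h.twoForm h', h.isBTransform_twoForm h', h.eqAddExact_twoForm h'⟩,
    fun _ _ _ _ h hH => ⟨_, LiftedAction.isBTransform_bTransform, h.bTransform hH⟩⟩

theorem mainTheorem6
    {EG : Type*} [NormedAddCommGroup EG] [NormedSpace ℝ EG] [FiniteDimensional ℝ EG]
    {G : Type*} [TopologicalSpace G] [ChartedSpace EG G] [Group G] [LieGroup 𝓘(ℝ, EG) ∞ G]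
    [T2Space G] [SecondCountableTopology G]
    {EP : Type*} [NormedAddCommGroup EP] [NormedSpace ℝ EP] [FiniteDimensional ℝ EP]
    {P : Type*} [TopologicalSpace P] [ChartedSpace EP P] [IsManifold 𝓘(ℝ, EP) ∞ P]
    [T2Space P] [SecondCountableTopology P]
    {EM : Type*} [NormedAddCommGroup EM] [NormedSpace ℝ EM] [FiniteDimensional ℝ EM]
    {M : Type*} [TopologicalSpace M] [ChartedSpace EM M] [IsManifold 𝓘(ℝ, EM) ∞ M]
    [T2Space M] [SecondCountableTopology M]
    (B : PrincipalBundle EG G EP P EM M)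
    {F : Type*} [NormedAddCommGroup F] [NormedSpace ℝ F] [FiniteDimensional ℝ F]
    {V : P → Type*} [TopologicalSpace (TotalSpace F V)]
    [∀ q, AddCommGroup (V q)] [∀ q, Module ℝ (V q)] [∀ q, TopologicalSpace (V q)]
    [FiberBundle F V] [VectorBundle ℝ F V] [ContMDiffVectorBundle ∞ F V 𝓘(ℝ, EP)]
    (C : CourantAlgebroid EP F V) (hC : C.IsExact)
    (L : LiftedAction B C) (hL : L.IsEquivariant)
    (hs : ∃ s, L.IsEquivariantIsotropicSplitting s)
    (c : LinearMap.BilinForm ℝ (GroupLieAlgebra 𝓘(ℝ, EG) G)) (hc : L.IsQuadraticForm c)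
    (hnd : ∀ z, (∀ w, c z w = 0) → z = 0)
    (A : B.Connection) :
    (∃ Φ H, L.IsPresentation c A Φ H) ∧
    (∀ Φ H Φ' H', L.IsPresentation c A Φ H → L.IsPresentation c A Φ' H' →
      ∃ b : SmoothForm EM M 2, L.IsBTransform Φ' Φ b ∧ EqAddExact H' H b) ∧
    (∀ Φ H H' (b : SmoothForm EM M 2), L.IsPresentation c A Φ H → EqAddExact H' H b →
      ∃ Φ', L.IsBTransform Φ' Φ b ∧ L.IsPresentation c A Φ' H') :=
  mainTheorem6_general B C hC L hL hs c hc hnd A
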